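/- **Setting.** Let $L,K,P,r$ be fixed integers and $M=M(N)$ with $c_N=\frac{ML}{N}\to c_*\in(0,1)$ as $N\to\infty$. *Signal.* $(i_n)_{n\in\mathbb Z}$ is a $K$-dimensional white noise, $\mathbb E(i_{n+k}i_n^*)=I_K\delta_k$; $(x_n)$ is the second-order stationary $P$-dimensional solution of $x_{n+1}=Ax_n+Bi_n$, where $A$ has spectral radius $<1$; and $u_n=C_Nx_n+D_Ni_n\in\mathbb C^M$. Put $u_n^L=(u_n^T,\dots,u_{n+L-1}^T)^T$, $R_{u,N}^L=\mathbb E(u_n^Lu_n^{L*})$, $R^L_{f|p,N}=\mathbb E(u_{n+L}^Lu_n^{L*})$. For $N$ large, $R^L_{u,N}$ has rank $r$, with spectral decomposition $R^L_{u,N}=\Theta_N\Delta_N^2\Theta_N^*$, $\Theta_N^*\Theta_N=I_r$, $\Delta_N=\mathrm{Diag}(\delta_{1,N}\ge\dots\ge\delta_{r,N}>0)$. Assume $\Delta_N\to\Delta_*>0$ and $\Theta_N^*R^L_{f|p,N}\Theta_N\to\Gamma_*$. *Noise.* $R_N$ is the $M\times M$ noise covariance matrix, Hermitian with $aI\le R_N\le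 bI$ for constants $0<a\le b$, eigenvalues $\lambda_{1,N}\ge\dots\ge\lambda_{M,N}$ and orthonormal eigenvectors $f_{k,N}$. Assume that $\lambda_{1,N}$ and $\lambda_{M,N}$ converge; that $\frac1M\sum_k\delta_{\lambda_{k,N}}$ converges weakly to a probability measure $\omega_*$; that for some constant $\kappa$ and all large $N$, $|\lambda_{k,N}-\lambda_{l,N}|\le\kappa\left(\frac{|k-l|}{M}\right)^{1/2}$ and $\lambda_{1,N}-\lambda_{k,N}\le\kappa\frac{k-1}{M}$ for all $k,l$; and that the matrix-valued measures $\Theta_N^*\left(I_L\otimes\sum_k\delta_{\lambda_{k,N}}f_{k,N}f_{k,N}^*\right)\Theta_N$ converge weakly to a positive $r\times r$ matrix-valued measure $\gamma_*$. *Deterministic equivalents.* For $z\in\mathbb C^+$, $t_N(z)$ is the solution, with $t_N(z),\,zt_N(z)\in\mathbb C^+$, of $$t_N(z)=\frac1M\mathrm{Tr}\,R_N\left(-zI-\frac{zc_Nt_N(z)}{1-zc_N^2t_N(z)^2}R_N\right)^{-1},$$ and for real $x>0$, $t_N(x)=\lim_{z\to x,\,z\in\mathbb C^+}t_N(z)$.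 Let $\mu_N$ be the measure on $(0,\infty)$ with density $\frac1\pi\mathrm{Im}\,t_N(x)$ (for $c_N<1$, the positive measure on $\mathbb R^+$ whose Stieltjes transform is $t_N$), let $x_{+,N}$ be the largest element of its support, and put $$T_N(x)=-\left(xI+\frac{xc_Nt_N(x)}{1-xc_N^2t_N(x)^2}R_N\right)^{-1},\qquad T_{\beta_N}(x)=\Theta_N^*(I_L\otimes T_N(x))\Theta_N .$$ **Claim.** The following limits exist: $x_{+,*}=\lim_Nx_{+,N}>0$; for every real $x>x_{+,*}$, $t_*(x)=\lim_Nt_N(x)$ and $T_{\beta_*}(x)=\lim_NT_{\beta_N}(x)$; and the limits of $t_*(x)$ and $T_{\beta_*}(x)$ as $x\downarrow x_{+,*}$, which define $t_*(x_{+,*})$ and $T_{\beta_*}(x_{+,*})$. For $y\ge\sqrt{x_{+,*}}$ put $\mathbf t_*(y)=y\,t_*(y^2)$, $\mathbf T_{\beta_*}(y)=y\,T_{\beta_*}(y^2)$ and $$H_*(y)=\begin{pmatrix}\frac{c_*\mathbf t_*(y)}{1-(c_*\mathbf t_*(y))^2}\Delta_*^2-\mathbf T_{\beta_*}(y)^{-1}&\frac{\Gamma_*^*}{1-(c_*\mathbf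 t_*(y))^2}\\[2mm]\frac{\Gamma_*}{1-(c_*\mathbf t_*(y))^2}&\frac{c_*\mathbf t_*(y)}{1-(c_*\mathbf t_*(y))^2}\Delta_*^2-\mathbf T_{\beta_*}(y)^{-1}\end{pmatrix}.$$ Then $H_*(y)$ is Hermitian for $y\ge\sqrt{x_{+,*}}$, $H_*(y)\to H_*(\sqrt{x_{+,*}})$ as $y\downarrow\sqrt{x_{+,*}}$, $\det H_*$ is real-analytic on $(\sqrt{x_{+,*}},\infty)$, and: 1. the eigenvalues $\lambda_{1,*}(y)\ge\dots\ge\lambda_{2r,*}(y)$ of $H_*(y)$ satisfy $\lambda_{k,*}(y_1)<\lambda_{k,*}(y_2)$ for every $k=1,\dots,2r$ and all $\sqrt{x_{+,*}}\le y_1<y_2$; 2. the equation $\det H_*(y)=0$ has finitely many roots $y>\sqrt{x_{+,*}}$, and their number $s$, each root being counted with its order of vanishing, belongs to $\{0,1,\dots,2r\}$ and equals the number of strictly negative eigenvalues (with multiplicity) of $H_*(\sqrt{x_{+,*}})$. -/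

import Mathlib

open MeasureTheory Filter Topology Set
open scoped BoundedContinuousFunction Kronecker Matrix ComplexOrder

noncomputable section

/-! ### Deterministic equivalents attached to a noise covariance matrix -/

section Deterministic

variable {m : ℕ}

/-- `t` solves, at the point `z`, the equation
`t = (1/m) Tr R (-z I - (z c t / (1 - z c² t²)) R)⁻¹` with `t` and `z t` in the open upper
half-plane. -/
def IsCanonicalSolution (R : Matrix (Fin m) (Fin m) ℂ) (c : ℝ) (z t : ℂ) : Prop :=
  0 < t.im ∧ 0 < (z * t).im ∧
    t = (1 / (m : ℂ)) *
      (R * (-(z • (1 : Matrix (Fin m) (Fin m) ℂ))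
        - (z * c * t / (1 - z * (c : ℂ) ^ 2 * t ^ 2)) • R)⁻¹).trace

open Classical in
/-- `t_N(z)` for `z` in the open upper half-plane: the solution of the canonical equation. -/
def tUpper (R : Matrix (Fin m) (Fin m) ℂ) (c : ℝ) (z : ℂ) : ℂ :=
  if h : ∃ t, IsCanonicalSolution R c z t then h.choose else 0

/-- `t_N(x)` for real `x > 0`: the limit of `t_N(z)` as `z → x` within the upper half-plane. -/
def tReal (R : Matrix (Fin m) (Fin m) ℂ) (c : ℝ) (x : ℝ) : ℂ :=
  limUnder (𝓝[{z : ℂ | 0 < z.im}] (x : ℂ)) (tUpper R c)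

/-- The positive measure `μ_N` on `ℝ⁺` with Stieltjes transform `t_N`: it is absolutely
continuous, and its density is `x ↦ π⁻¹ Im t_N(x)` (Stieltjes inversion). -/
def muMeasure (R : Matrix (Fin m) (Fin m) ℂ) (c : ℝ) : Measure ℝ :=
  (volume.restrict (Ioi 0)).withDensity
    (fun x => ENNReal.ofReal (Real.pi⁻¹ * (tReal R c x).im))

/-- `x_{+,N}`: the largest element of the support of `μ_N`. -/
def xPlus (R : Matrix (Fin m) (Fin m) ℂ) (c : ℝ) : ℝ :=
  sSup (muMeasure R c).support

/-- `T_N(x) = -(x I + (x c t_N(x) / (1 - x c² t_N(x)²)) R)⁻¹`. -/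
def TMatrix (R : Matrix (Fin m) (Fin m) ℂ) (c : ℝ) (x : ℝ) : Matrix (Fin m) (Fin m) ℂ :=
  -((x : ℂ) • (1 : Matrix (Fin m) (Fin m) ℂ)
    + (x * c * tReal R c x / (1 - x * (c : ℂ) ^ 2 * (tReal R c x) ^ 2)) • R)⁻¹

/-- `T_{β_N}(x) = Θ* (I_L ⊗ T_N(x)) Θ`, the Stieltjes transform of
`dβ_N = Θ* (I_L ⊗ dν_N^T) Θ`, where `ν_N^T` is the matrix measure with transform `T_N`. -/
def TBeta {L r : ℕ} (Θ : Matrix (Fin L × Fin m) (Fin r) ℂ)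
    (R : Matrix (Fin m) (Fin m) ℂ) (c : ℝ) (x : ℝ) : Matrix (Fin r) (Fin r) ℂ :=
  Θᴴ * ((1 : Matrix (Fin L) (Fin L) ℂ) ⊗ₖ TMatrix R c x) * Θ

/-- `∫ f dω^R` for the matrix measure `ω^R = ∑ₖ δ_{λₖ} fₖ fₖ*`, where `(λₖ, fₖ)` are the
eigenvalues and orthonormal eigenvectors of the Hermitian matrix `R`. -/
def spectralIntegral {R : Matrix (Fin m) (Fin m) ℂ} (hR : R.IsHermitian) (f : ℝ → ℝ) :
    Matrix (Fin m) (Fin m) ℂ :=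
  ∑ k, (f (hR.eigenvalues k) : ℂ) •
    Matrix.vecMulVec (hR.eigenvectorBasis k).ofLp (star (hR.eigenvectorBasis k).ofLp)

end Deterministic

/-- A finite positive `r × r` matrix-valued Borel measure on `ℝ`. -/
structure PosMatrixMeasure (r : ℕ) where
  toVectorMeasure : VectorMeasure ℝ (Matrix (Fin r) (Fin r) ℂ)
  posSemidef : ∀ s, (toVectorMeasure s).PosSemidef

namespace PosMatrixMeasure

variable {r : ℕ}

/-- The additive map `A ↦ Re (v* A v)`. -/
def quadForm (v : Fin r → ℂ) : Matrix (Fin r) (Fin r) ℂ →+ ℝ where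
  toFun A := (star v ⬝ᵥ (A *ᵥ v)).re
  map_zero' := by simp
  map_add' A B := by simp [Matrix.add_mulVec, dotProduct_add]

theorem continuous_quadForm (v : Fin r → ℂ) : Continuous (quadForm v) := by
  change Continuous fun A : Matrix (Fin r) (Fin r) ℂ => (star v ⬝ᵥ (A *ᵥ v)).re
  fun_prop

/-- The finite positive scalar measure `s ↦ v* γ(s) v`. -/
def scalar (γ : PosMatrixMeasure r) (v : Fin r → ℂ) : Measure ℝ :=
  SignedMeasure.toMeasureOfZeroLE
    (γ.toVectorMeasure.mapRange (quadForm v) (continuous_quadForm v)) univ MeasurableSet.univ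
    (VectorMeasure.restrict_le_restrict_of_subset_le _ _ fun s _ _ => by
      have h := (γ.posSemidef s).re_dotProduct_nonneg v
      simpa [quadForm] using h)

end PosMatrixMeasure

/-! ### The signal plus noise model -/

/-- The second-order stationary solution `x` of `x_{n+1} = A x_n + B i_n`, where `i` is a
normalized white noise and the spectral radius of `A` is `< 1`. -/
structure IsStationaryState {Ω : Type*} [MeasurableSpace Ω] (ℙ : Measure Ω) {K P : ℕ}
    (A : Matrix (Fin P) (Fin P) ℂ) (B : Matrix (Fin P) (Fin K) ℂ)
    (i : ℤ → Ω → Fin K → ℂ) (x : ℤ → Ω → Fin P → ℂ) : Prop where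
  memLp_noise : ∀ n k, MemLp (fun ω => i n ω k) 2 ℙ
  memLp_state : ∀ n k, MemLp (fun ω => x n ω k) 2 ℙ
  white : ∀ n h k l, ∫ ω, i (n + h) ω k * star (i n ω l) ∂ℙ = if h = 0 ∧ k = l then 1 else 0
  spectrum_lt : ∀ μ ∈ spectrum ℂ A, ‖μ‖ < 1
  recursion : ∀ n, ∀ᵐ ω ∂ℙ, x (n + 1) ω = A *ᵥ x n ω + B *ᵥ i n ω
  stationary_state : ∀ n h k l,
    ∫ ω, x (n + h) ω k * star (x n ω l) ∂ℙ = ∫ ω, x h ω k * star (x 0 ω l) ∂ℙ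
  stationary_cross : ∀ n h k l,
    ∫ ω, x (n + h) ω k * star (i n ω l) ∂ℙ = ∫ ω, x h ω k * star (i 0 ω l) ∂ℙ

/-- The data of the model.  The sample size is `N`, the dimension of the observation is `M N`,
the useful signal is `u_n = C_N x_n + D_N i_n`, and `R N` is the covariance matrix of the
temporally white Gaussian noise. -/
structure SpikedModel (Ω : Type*) [MeasurableSpace Ω] (K P L r : ℕ) where
  /-- the probability measure -/
  prob : Measure Ω
  /-- the normalized innovation sequence `i` -/
  innov : ℤ → Ω → Fin K → ℂ
  /-- the state-space sequence `x` -/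
  state : ℤ → Ω → Fin P → ℂ
  A : Matrix (Fin P) (Fin P) ℂ
  B : Matrix (Fin P) (Fin K) ℂ
  M : ℕ → ℕ
  C : (N : ℕ) → Matrix (Fin (M N)) (Fin P) ℂ
  D : (N : ℕ) → Matrix (Fin (M N)) (Fin K) ℂ
  /-- noise covariance matrices -/
  R : (N : ℕ) → Matrix (Fin (M N)) (Fin (M N)) ℂ
  R_herm : ∀ N, (R N).IsHermitian
  /-- eigenvectors of the covariance matrix of the useful signal (the columns of `Θ N`) -/
  Θ : (N : ℕ) → Matrix (Fin L × Fin (M N)) (Fin r) ℂ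
  /-- square roots of the nonzero eigenvalues of the covariance matrix of the useful signal -/
  δ : ℕ → Fin r → ℝ
  cStar : ℝ
  /-- limit of the diagonal matrix `Δ_N = Diag (δ N)` -/
  δStar : Fin r → ℝ
  ΓStar : Matrix (Fin r) (Fin r) ℂ
  lamPlus : ℝ
  lamMinus : ℝ
  ωStar : Measure ℝ
  γStar : PosMatrixMeasure r

namespace SpikedModel

variable {Ω : Type*} [MeasurableSpace Ω] {K P L r : ℕ} (S : SpikedModel Ω K P L r)

/-- `c_N = M L / N`. -/
def c (N : ℕ) : ℝ := (S.M N : ℝ) * L / N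

/-- The useful signal `u_n = C_N x_n + D_N i_n`. -/
def u (N : ℕ) (n : ℤ) (ω : Ω) : Fin (S.M N) → ℂ :=
  S.C N *ᵥ S.state n ω + S.D N *ᵥ S.innov n ω

/-- The stacked vector `u_n^L = (u_nᵀ, …, u_{n+L-1}ᵀ)ᵀ`. -/
def uL (N : ℕ) (n : ℤ) (ω : Ω) : Fin L × Fin (S.M N) → ℂ :=
  fun p => S.u N (n + ((p.1 : ℕ) : ℤ)) ω p.2

/-- `R_{u,N}^L = E (u_n^L u_n^{L*})` (it does not depend on `n`; `n = 0` is taken). -/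
def Ru (N : ℕ) : Matrix (Fin L × Fin (S.M N)) (Fin L × Fin (S.M N)) ℂ :=
  Matrix.of fun p q => ∫ ω, S.uL N 0 ω p * star (S.uL N 0 ω q) ∂S.prob

/-- `R_{f|p,N}^L = E (u_{n+L}^L u_n^{L*})` (it does not depend on `n`; `n = 0` is taken). -/
def Rfp (N : ℕ) : Matrix (Fin L × Fin (S.M N)) (Fin L × Fin (S.M N)) ℂ :=
  Matrix.of fun p q => ∫ ω, S.uL N (L : ℤ) ω p * star (S.uL N 0 ω q) ∂S.prob

/-- The eigenvalues `λ_{1,N} ≥ … ≥ λ_{M,N}` of `R_N`, in decreasing order. -/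
def lam (N : ℕ) : Fin (Fintype.card (Fin (S.M N))) → ℝ := (S.R_herm N).eigenvalues₀

/-- `∫ f dγ_N`, where `dγ_N = Θ_N* (I_L ⊗ dω_N^R) Θ_N`. -/
def gammaIntegral (N : ℕ) (f : ℝ → ℝ) : Matrix (Fin r) (Fin r) ℂ :=
  (S.Θ N)ᴴ * ((1 : Matrix (Fin L) (Fin L) ℂ) ⊗ₖ spectralIntegral (S.R_herm N) f) * S.Θ N

/-- The standing assumptions. -/
structure Standing : Prop where
  isProb : IsProbabilityMeasure S.prob
  /-- the state-space representation of the useful signal -/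
  signal : IsStationaryState S.prob S.A S.B S.innov S.state
  /-- the asymptotic regime -/
  regime : Tendsto S.c atTop (𝓝 S.cStar)
  cStar_mem : S.cStar ∈ Ioo (0 : ℝ) 1
  /-- `a I ≤ R_N ≤ b I` -/
  noise_bounds : ∃ a b : ℝ, 0 < a ∧ 0 < b ∧ ∀ N,
    (S.R N - (a : ℂ) • (1 : Matrix (Fin (S.M N)) (Fin (S.M N)) ℂ)).PosSemidef ∧
      ((b : ℂ) • (1 : Matrix (Fin (S.M N)) (Fin (S.M N)) ℂ) - S.R N).PosSemidef
  /-- for `N` large, `R_{u,N}^L` has rank `r` and `R_{u,N}^L = Θ_N Δ_N² Θ_N*` is its spectral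
  decomposition, with eigenvalues in decreasing order -/
  eigen : ∀ᶠ N in atTop, (S.Θ N)ᴴ * S.Θ N = 1 ∧ (∀ k, 0 < S.δ N k) ∧ Antitone (S.δ N) ∧
    S.Ru N = S.Θ N * Matrix.diagonal (fun k => ((S.δ N k : ℂ)) ^ 2) * (S.Θ N)ᴴ
  /-- `Δ_N → Δ_* > 0` and `Θ_N* R_{f|p,N}^L Θ_N → Γ_*` -/
  delta_lim : Tendsto S.δ atTop (𝓝 S.δStar)
  deltaStar_pos : ∀ k, 0 < S.δStar k
  gamma_lim : Tendsto (fun N => (S.Θ N)ᴴ * S.Rfp N * S.Θ N) atTop (𝓝 S.ΓStar)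
  /-- convergence of the extreme eigenvalues and of the spectral distribution of `R_N` -/
  lamPlus_lim : Tendsto (fun N => ⨆ k, S.lam N k) atTop (𝓝 S.lamPlus)
  lamMinus_lim : Tendsto (fun N => ⨅ k, S.lam N k) atTop (𝓝 S.lamMinus)
  omega_prob : IsProbabilityMeasure S.ωStar
  omega_lim : ∀ f : ℝ →ᵇ ℝ,
    Tendsto (fun N => (1 / (S.M N : ℝ)) * ∑ k, f (S.lam N k)) atTop (𝓝 (∫ s, f s ∂S.ωStar))
  /-- regularity of the eigenvalues of `R_N` -/
  spacing : ∃ κ : ℝ, 0 < κ ∧ ∀ᶠ N in atTop,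
    (∀ k l, |S.lam N k - S.lam N l| ≤ κ * √(|(k : ℝ) - (l : ℝ)| / S.M N)) ∧
      ∀ k, (⨆ l, S.lam N l) - S.lam N k ≤ κ * ((k : ℝ) / S.M N)
  /-- `γ_N → γ_*` weakly -/
  gammaMeasure_lim : ∀ (f : ℝ →ᵇ ℝ) (v : Fin r → ℂ),
    Tendsto (fun N => star v ⬝ᵥ (S.gammaIntegral N f *ᵥ v)) atTop
      (𝓝 ((∫ s, f s ∂(S.γStar.scalar v) : ℝ) : ℂ))

/-- `xp`, `t` and `T` are the limit objects `x_{+,*}`, `t_*` and `T_{β_*}` (on `[x_{+,*}, ∞)`):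
`x_{+,*} = lim x_{+,N}`; `t_*(x) = lim t_N(x)` and `T_{β_*}(x) = lim T_{β_N}(x)` for
`x > x_{+,*}`; the values at `x_{+,*}` are the limits from the right. -/
structure IsLimit (xp : ℝ) (t : ℝ → ℂ) (T : ℝ → Matrix (Fin r) (Fin r) ℂ) : Prop where
  edge : Tendsto (fun N => xPlus (S.R N) (S.c N)) atTop (𝓝 xp)
  t_lim : ∀ x, xp < x → Tendsto (fun N => tReal (S.R N) (S.c N) x) atTop (𝓝 (t x))
  T_lim : ∀ x, xp < x → Tendsto (fun N => TBeta (S.Θ N) (S.R N) (S.c N) x) atTop (𝓝 (T x))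
  t_edge : Tendsto t (𝓝[>] xp) (𝓝 (t xp))
  T_edge : Tendsto T (𝓝[>] xp) (𝓝 (T xp))

/-- The matrix function `H_*`, built from `c_*`, `Δ_*`, `Γ_*` and from
`𝐭_*(y) = y t_*(y²)`, `𝐓_{β_*}(y) = y T_{β_*}(y²)`. -/
def HStar (t : ℝ → ℂ) (T : ℝ → Matrix (Fin r) (Fin r) ℂ) (y : ℝ) :
    Matrix (Fin r ⊕ Fin r) (Fin r ⊕ Fin r) ℂ :=
  let ct : ℂ := S.cStar * (y * t (y ^ 2))
  let Δ2 : Matrix (Fin r) (Fin r) ℂ := Matrix.diagonal fun k => (S.δStar k : ℂ) ^ 2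
  let Tb : Matrix (Fin r) (Fin r) ℂ := (y : ℂ) • T (y ^ 2)
  Matrix.fromBlocks
    ((ct / (1 - ct ^ 2)) • Δ2 - Tb⁻¹) ((1 / (1 - ct ^ 2)) • S.ΓStarᴴ)
    ((1 / (1 - ct ^ 2)) • S.ΓStar) ((ct / (1 - ct ^ 2)) • Δ2 - Tb⁻¹)

end SpikedModel

end

noncomputable section

/-! ### Monotonicity and continuity of ordered eigenvalues -/

section Eigenvalues

variable {E : Type*} [NormedAddCommGroup E] [InnerProductSpace ℂ E]

/-! The proof rests on a change of variable that makes the canonical equation explicit. Put w = -(1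
- zc²t²)/(ct). The matrix T_N becomes -(w/z)(w - R)⁻¹, and the equation for t turns into z = φ(w),
where φ(w) = k(w)(w + k(w)), k(w) = c ∫ sw/(w - s) dω(s) and ω is the spectral law of R; moreover t
= -1/(c(w + k(w))). To the right of the spectrum φ is strictly convex (`edgePhi'_strictMono`). It
tends to infinity at infinity, and also at the top b of the spectrum as soon as k is unbounded
there. At finite N this is due to the atom at the largest eigenvalue (`exists_lt_edgeK_empLaw`). In
the limit it follows from λ₁ - λ_k ≤ κ(k - 1)/M, which makes the integral diverge logarithmically
(`exists_lt_edgeK`). Hence φ has a unique critical point wp > b (`exists_edge`).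

The edge is x₊ = φ(wp) (`xPlus_eq`). For x > x₊ the increasing branch of φ gives a real w(x), hence
a real t(x). Just below x₊ the preimages under φ near wp leave the real axis and give Im t > 0. That
these explicit values are those of t_N relies on uniqueness for the canonical equation
(`IsCanonicalSolution.unique`). Weak convergence and monotonicity in w then carry wp, x₊, w(x), t
and T_β to the limit (`isLimit`), with the same formulas for the limit law.

For H_*, set p = -c_* 𝐭_*(y), so that p² = k/(w + k) lies in (0, 1). Partial fractions in p give H_*
= S₊/(2(1 + p)) - S₋/(2(1 - p)) + y diag(W(w), W(w)). Here S± has diagonal blocks Δ_*² and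
off-diagonal blocks ±Γ_*^*, ±Γ_*, and W(w) = (∫ w/(w - s) dγ_*(s))⁻¹. The matrix S₊ is a limit of
compressed covariance matrices, so it is positive semidefinite, and S₋ is unitarily equivalent to
it. As y grows, w grows and p decreases, so no term decreases; the last one gains at least (1 -
λ₊/wp) times the increment of y (`hMatrix_increasing`).

What remains is linear algebra (`Matrix.zeros_det_of_increasing`). By Weyl's inequality every
ordered eigenvalue grows at least linearly, so it vanishes beyond the starting point exactly once if
it starts negative and never otherwise. Near a zero, each vanishing eigenvalue is comparable to the
distance to that zero, so the order of the determinant is the number of vanishing eigenvalues, and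
no analytic choice of eigenvalues is needed. -/

theorem OrthonormalBasis.finrank_span_image {ι : Type*} [Fintype ι]
    (u : OrthonormalBasis ι ℂ E) (s : Finset ι) :
    Module.finrank ℂ (Submodule.span ℂ (u '' (s : Set ι))) = s.card := by
  have := finrank_span_eq_card (u.orthonormal.linearIndependent.comp _
    (Subtype.val_injective (p := fun i => i ∈ s)))
  rw [Set.image_eq_range]
  exact this.trans (by simp)

theorem OrthonormalBasis.inner_eq_zero_of_mem_span {ι : Type*} [Fintype ι]
    (u : OrthonormalBasis ι ℂ E) {s : Set ι} {x : E} (hx : x ∈ Submodule.span ℂ (u '' s))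
    {i : ι} (hi : i ∉ s) : inner ℂ (u i) x = 0 := by
  induction hx using Submodule.span_induction with
  | mem y hy =>
    obtain ⟨j, hj, rfl⟩ := hy
    exact u.orthonormal.2 (fun h => hi (h ▸ hj))
  | zero => simp
  | add y z _ _ hy hz => rw [inner_add_right, hy, hz, add_zero]
  | smul a y _ hy => rw [inner_smul_right, hy, mul_zero]

variable [FiniteDimensional ℂ E]

theorem LinearMap.IsSymmetric.re_inner_eq_sum {T : E →ₗ[ℂ] E} (hT : T.IsSymmetric) {n : ℕ}
    (hn : Module.finrank ℂ E = n) (x : E) :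
    (inner ℂ (T x) x).re =
      ∑ i, hT.eigenvalues hn i * ‖inner ℂ (hT.eigenvectorBasis hn i) x‖ ^ 2 := by
  rw [← (hT.eigenvectorBasis hn).sum_inner_mul_inner, Complex.re_sum]
  refine Finset.sum_congr rfl fun i _ => ?_
  rw [hT x, hT.apply_eigenvectorBasis, inner_smul_right, mul_assoc,
    ← inner_conj_symm x, mul_comm (starRingEnd ℂ _), Complex.mul_conj, Complex.normSq_eq_norm_sq]
  rw [RCLike.ofReal_eq_complex_ofReal, ← Complex.ofReal_mul, Complex.ofReal_re]

/-- Courant–Fischer argument: the span of the first k + 1 eigenvectors of T and the span of the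
eigenvectors of S from index k on have dimensions adding up to n + 1, so they share a nonzero
vector. On it the two quadratic forms are bounded by the k-th eigenvalues from the appropriate
sides. -/
theorem LinearMap.IsSymmetric.eigenvalues_add_le {T S : E →ₗ[ℂ] E} (hT : T.IsSymmetric)
    (hS : S.IsSymmetric) {n : ℕ} (hn : Module.finrank ℂ E = n) {κ : ℝ}
    (h : ∀ x, (inner ℂ (T x) x).re + κ * ‖x‖ ^ 2 ≤ (inner ℂ (S x) x).re) (k : Fin n) :
    hT.eigenvalues hn k + κ ≤ hS.eigenvalues hn k := by
  set u := hT.eigenvectorBasis hn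
  set v := hS.eigenvectorBasis hn
  set U := Submodule.span ℂ (u '' Set.Iic k)
  set V := Submodule.span ℂ (v '' Set.Ici k)
  have hU : Module.finrank ℂ U = k + 1 := by
    have := u.finrank_span_image (Finset.Iic k)
    rw [Finset.coe_Iic] at this
    rw [this]; simp
  have hV : Module.finrank ℂ V = n - k := by
    have := v.finrank_span_image (Finset.Ici k)
    rw [Finset.coe_Ici] at this
    rw [this]; simp
  have hne : U ⊓ V ≠ ⊥ := by
    intro hbot
    have h1 := Submodule.finrank_sup_add_finrank_inf_eq U V
    have h2 := Submodule.finrank_le (U ⊔ V)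
    rw [hbot, finrank_bot, hU, hV] at h1
    have := k.2
    omega
  obtain ⟨x, hx, hx0⟩ := Submodule.exists_mem_ne_zero_of_ne_bot hne
  have hx2 : 0 < ‖x‖ ^ 2 := by positivity
  have h1 : hT.eigenvalues hn k * ‖x‖ ^ 2 ≤ (inner ℂ (T x) x).re := by
    rw [hT.re_inner_eq_sum hn, ← u.sum_sq_norm_inner_right x, Finset.mul_sum]
    refine Finset.sum_le_sum fun i _ => ?_
    by_cases hi : i ≤ k
    · exact mul_le_mul_of_nonneg_right (hT.eigenvalues_antitone hn hi) (by positivity)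
    · rw [u.inner_eq_zero_of_mem_span hx.1 (i := i) hi]; simp
  have h2 : (inner ℂ (S x) x).re ≤ hS.eigenvalues hn k * ‖x‖ ^ 2 := by
    rw [hS.re_inner_eq_sum hn, ← v.sum_sq_norm_inner_right x, Finset.mul_sum]
    refine Finset.sum_le_sum fun i _ => ?_
    by_cases hi : k ≤ i
    · exact mul_le_mul_of_nonneg_right (hS.eigenvalues_antitone hn hi) (by positivity)
    · rw [v.inner_eq_zero_of_mem_span hx.2 (i := i) hi]; simp
  have := h x
  nlinarith

end Eigenvalues

namespace Matrix

variable {n : Type*} [Fintype n]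

/-- The real quadratic form `Re (v* A v)`. -/
def reQuad (A : Matrix n n ℂ) (v : n → ℂ) : ℝ := (star v ⬝ᵥ (A *ᵥ v)).re

theorem reQuad_sub (A B : Matrix n n ℂ) (v : n → ℂ) :
    reQuad (A - B) v = reQuad A v - reQuad B v := by
  simp [reQuad, sub_mulVec, dotProduct_sub]

theorem reQuad_add (A B : Matrix n n ℂ) (v : n → ℂ) :
    reQuad (A + B) v = reQuad A v + reQuad B v := by
  simp [reQuad, add_mulVec, dotProduct_add]

theorem reQuad_smul (a : ℝ) (A : Matrix n n ℂ) (v : n → ℂ) :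
    reQuad ((a : ℂ) • A) v = a * reQuad A v := by
  simp [reQuad, smul_mulVec, dotProduct_smul]

/-- The entrywise sum is a crude substitute for the operator norm; it transfers continuity and
Lipschitz bounds of the entries directly to the eigenvalues. -/
theorem abs_reQuad_le (A : Matrix n n ℂ) (v : n → ℂ) :
    |reQuad A v| ≤ (∑ i, ∑ j, ‖A i j‖) * ∑ i, ‖v i‖ ^ 2 := by
  have h1 : |reQuad A v| ≤ ∑ i, ∑ j, ‖A i j‖ * (‖v i‖ * ‖v j‖) := by
    refine (Complex.abs_re_le_norm _).trans ?_
    simp only [dotProduct, mulVec, Pi.star_apply, Finset.mul_sum]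
    refine (norm_sum_le _ _).trans (Finset.sum_le_sum fun i _ => (norm_sum_le _ _).trans
      (Finset.sum_le_sum fun j _ => le_of_eq ?_))
    simp; ring
  refine h1.trans ?_
  rw [Finset.sum_mul]
  refine Finset.sum_le_sum fun i _ => ?_
  rw [Finset.sum_mul]
  refine Finset.sum_le_sum fun j _ => mul_le_mul_of_nonneg_left ?_ (norm_nonneg _)
  have hi : ‖v i‖ ^ 2 ≤ ∑ i, ‖v i‖ ^ 2 :=
    Finset.single_le_sum (f := fun i => ‖v i‖ ^ 2) (fun _ _ => by positivity) (Finset.mem_univ i)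
  have hj : ‖v j‖ ^ 2 ≤ ∑ i, ‖v i‖ ^ 2 :=
    Finset.single_le_sum (f := fun i => ‖v i‖ ^ 2) (fun _ _ => by positivity) (Finset.mem_univ j)
  nlinarith [sq_nonneg (‖v i‖ - ‖v j‖)]

variable [DecidableEq n]

theorem re_inner_toEuclideanLin (A : Matrix n n ℂ) (x : EuclideanSpace ℂ n) :
    (inner ℂ (toEuclideanLin A x) x).re = reQuad A x.ofLp := by
  rw [← inner_conj_symm, Complex.conj_re, EuclideanSpace.inner_eq_star_dotProduct, dotProduct_comm]
  rfl

/-- Weyl's inequality with a uniform gap. -/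
theorem IsHermitian.eigenvalues₀_add_le {A B : Matrix n n ℂ} (hA : A.IsHermitian)
    (hB : B.IsHermitian) {κ : ℝ}
    (h : ∀ v, reQuad A v + κ * ∑ i, ‖v i‖ ^ 2 ≤ reQuad B v) (k : Fin (Fintype.card n)) :
    hA.eigenvalues₀ k + κ ≤ hB.eigenvalues₀ k := by
  refine LinearMap.IsSymmetric.eigenvalues_add_le _ _ _ (fun x => ?_) k
  rw [re_inner_toEuclideanLin, re_inner_toEuclideanLin, EuclideanSpace.norm_sq_eq]
  exact h x.ofLp

/-- Weyl's inequality applied in both directions, with minus the norm of the difference as the gap.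
-/
theorem IsHermitian.abs_eigenvalues₀_sub_le {A B : Matrix n n ℂ} (hA : A.IsHermitian)
    (hB : B.IsHermitian) (k : Fin (Fintype.card n)) :
    |hA.eigenvalues₀ k - hB.eigenvalues₀ k| ≤ ∑ i, ∑ j, ‖A i j - B i j‖ := by
  have key : ∀ v, |reQuad A v - reQuad B v| ≤ (∑ i, ∑ j, ‖A i j - B i j‖) * ∑ i, ‖v i‖ ^ 2 := by
    intro v
    rw [← reQuad_sub]
    exact abs_reQuad_le _ v
  rw [abs_le]
  constructor
  · have := hB.eigenvalues₀_add_le hA (κ := -∑ i, ∑ j, ‖A i j - B i j‖) (fun v => by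
      have := (abs_le.1 (key v)).1; linarith) k
    linarith
  · have := hA.eigenvalues₀_add_le hB (κ := -∑ i, ∑ j, ‖A i j - B i j‖) (fun v => by
      have := (abs_le.1 (key v)).2; linarith) k
    linarith

theorem IsHermitian.det_eq_prod_eigenvalues₀ {A : Matrix n n ℂ} (hA : A.IsHermitian) :
    A.det = ∏ k, (hA.eigenvalues₀ k : ℂ) := by
  rw [hA.det_eq_prod_eigenvalues]
  exact Fintype.prod_equiv (Fintype.equivOfCardEq (Fintype.card_fin _)).symm _ _ fun i => rfl

end Matrix

/-! ### Zeros of the determinant of an increasing analytic matrix function -/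

section Crossing

theorem frequently_sub_pow_ne_zero (y : ℝ) (m : ℕ) : ∃ᶠ x in 𝓝 y, (x - y) ^ m ≠ 0 := by
  have h : ∃ᶠ x in 𝓝[≠] y, (x - y) ^ m ≠ 0 := by
    apply Eventually.frequently
    filter_upwards [self_mem_nhdsWithin] with x hx
    exact pow_ne_zero _ (sub_ne_zero.2 hx)
  exact h.filter_mono nhdsWithin_le_nhds

/-- A function of finite order m is itself comparable to the m-th power, and two powers of x - y are
comparable only if the exponents agree. Infinite order would make a power vanish near y. -/
theorem analyticOrderAt_eq_of_isTheta {f : ℝ → ℂ} {y : ℝ} (hf : AnalyticAt ℝ f y) {d : ℕ}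
    (h : f =Θ[𝓝 y] fun x => (x - y) ^ d) : analyticOrderAt f y = d := by
  have hpow : ∀ m k : ℕ, (fun x : ℝ => (x - y) ^ m) =O[𝓝 y] (fun x => (x - y) ^ k) → k ≤ m := by
    intro m k hmk
    by_contra! hlt
    have hlo : (fun x : ℝ => (x - y) ^ k) =o[𝓝 y] fun x => (x - y) ^ m :=
      (Asymptotics.isLittleO_pow_pow hlt).comp_tendsto (tendsto_sub_nhds_zero_iff.2 tendsto_id)
    exact Asymptotics.isLittleO_irrefl (frequently_sub_pow_ne_zero y m)
      (hmk.trans_isLittleO hlo)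
  have hne : analyticOrderAt f y ≠ ⊤ := by
    intro htop
    rw [analyticOrderAt_eq_top] at htop
    have h1 : (fun x : ℝ => (x - y) ^ d) =O[𝓝 y] fun _ => (0 : ℂ) :=
      h.2.trans_eventuallyEq htop
    rw [Asymptotics.isBigO_zero_right_iff] at h1
    exact (frequently_sub_pow_ne_zero y d) (h1.mono fun x hx => by simpa using hx)
  obtain ⟨g, hg, hg0, hfg⟩ := (hf.analyticOrderAt_ne_top).1 hne
  set m := analyticOrderNatAt f y
  have hgT : g =Θ[𝓝 y] fun _ => (1 : ℝ) :=
    (Asymptotics.isTheta_of_div_tendsto_nhds_ne_zero (c := g y) (f := fun _ => (1 : ℂ))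
      (by simpa using hg.continuousAt.tendsto) hg0).symm.trans
      (by simp [Asymptotics.isTheta_const_const_iff])
  have hmT : f =Θ[𝓝 y] fun x => (x - y) ^ m := by
    have h1 : (fun x => (x - y) ^ m • g x) =Θ[𝓝 y] fun x => (x - y) ^ m • (1 : ℝ) :=
      Asymptotics.IsTheta.smul (Asymptotics.isTheta_refl _ _) hgT
    simp only [smul_eq_mul, mul_one] at h1
    exact (Asymptotics.IsTheta.of_norm_eventuallyEq_norm
      (hfg.mono fun x hx => by simp only [hx])).trans h1
  have hmd := le_antisymm (hpow _ _ (hmT.symm.trans h).1) (hpow _ _ (h.symm.trans hmT).1)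
  rw [hmd]
  exact (Nat.cast_analyticOrderNatAt hne).symm

variable {n : Type*} [Fintype n] [DecidableEq n]

theorem Matrix.analyticAt_det {A : ℝ → Matrix n n ℂ} {y : ℝ}
    (h : ∀ i j, AnalyticAt ℝ (fun x => A x i j) y) : AnalyticAt ℝ (fun x => (A x).det) y := by
  simp only [Matrix.det_apply]
  refine Finset.analyticAt_fun_sum _ fun σ _ => ?_
  have h1 : AnalyticAt ℝ (fun x => ∏ i, A x (σ i) i) y :=
    Finset.analyticAt_fun_prod _ fun i _ => h _ _
  simpa [Units.smul_def, zsmul_eq_mul] using! analyticAt_const.mul h1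

/-- A family of Hermitian matrices on `[y₀, ∞)` that increases at a uniform linear rate has strictly
increasing eigenvalues, and the zeros of its determinant beyond `y₀`, counted with order, are as
many as the negative eigenvalues at `y₀`. -/
theorem Matrix.zeros_det_of_increasing {H : ℝ → Matrix n n ℂ} {y₀ κ : ℝ} (hκ : 0 < κ)
    (hH : ∀ y, y₀ ≤ y → (H y).IsHermitian)
    (hinc : ∀ y₁ y₂, y₀ ≤ y₁ → y₁ < y₂ → ∀ v,
      reQuad (H y₁) v + κ * (y₂ - y₁) * ∑ i, ‖v i‖ ^ 2 ≤ reQuad (H y₂) v)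
    (hlim : Tendsto H (𝓝[>] y₀) (𝓝 (H y₀)))
    (han : ∀ y, y₀ < y → ∀ i j, AnalyticAt ℝ (fun x => H x i j) y) :
    (∀ (k : Fin (Fintype.card n)) (y₁ y₂ : ℝ) (h₁ : y₀ ≤ y₁) (h₂ : y₁ < y₂),
      (hH y₁ h₁).eigenvalues₀ k < (hH y₂ (h₁.trans h₂.le)).eigenvalues₀ k) ∧
    ∃ hfin : {y : ℝ | y₀ < y ∧ (H y).det = 0}.Finite,
      ∃ s : ℕ, ∑ y ∈ hfin.toFinset, analyticOrderAt (fun y => (H y).det) y = (s : ℕ∞) ∧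
        s ≤ Fintype.card n ∧ s = {k | (hH y₀ le_rfl).eigenvalues₀ k < 0}.ncard := by
  have hgap : ∀ (k : Fin (Fintype.card n)) (y₁ y₂ : ℝ) (h₁ : y₀ ≤ y₁) (h₂ : y₁ < y₂),
      (hH y₁ h₁).eigenvalues₀ k + κ * (y₂ - y₁) ≤ (hH y₂ (h₁.trans h₂.le)).eigenvalues₀ k :=
    fun k y₁ y₂ h₁ h₂ => (hH y₁ h₁).eigenvalues₀_add_le _ (hinc y₁ y₂ h₁ h₂) k
  refine ⟨fun k y₁ y₂ h₁ h₂ => ?_, ?_⟩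
  · have := hgap k y₁ y₂ h₁ h₂
    have : 0 < κ * (y₂ - y₁) := mul_pos hκ (sub_pos.2 h₂)
    linarith
  -- Ordered eigenvalues require a proof of hermiticity, available only from y₀ on; clamping the
  -- argument at y₀ makes them functions on the whole line.
  let e : Fin (Fintype.card n) → ℝ → ℝ :=
    fun k y => (hH (max y y₀) (le_max_right _ _)).eigenvalues₀ k
  have he : ∀ k y (h : y₀ ≤ y), e k y = (hH y h).eigenvalues₀ k := by
    intro k y h
    have : ∀ y' (h' : y₀ ≤ y'), y' = y → (hH y' h').eigenvalues₀ k = (hH y h).eigenvalues₀ k := by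
      rintro y' h' rfl; rfl
    exact this _ (le_max_right _ _) (max_eq_left h)
  have hegap : ∀ k y₁ y₂, y₀ ≤ y₁ → y₁ < y₂ → e k y₁ + κ * (y₂ - y₁) ≤ e k y₂ := by
    intro k y₁ y₂ h₁ h₂
    rw [he k y₁ h₁, he k y₂ (h₁.trans h₂.le)]
    exact hgap k y₁ y₂ h₁ h₂
  have hmono : ∀ k, StrictMonoOn (e k) (Ici y₀) := by
    intro k y₁ h₁ y₂ _ h₂
    have := hegap k y₁ y₂ h₁ h₂
    have : 0 < κ * (y₂ - y₁) := mul_pos hκ (sub_pos.2 h₂)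
    linarith
  have hdiff : ∀ k y₁ y₂, y₀ ≤ y₁ → y₀ ≤ y₂ →
      |e k y₁ - e k y₂| ≤ ∑ i, ∑ j, ‖H y₁ i j - H y₂ i j‖ := by
    intro k y₁ y₂ h₁ h₂
    rw [he k y₁ h₁, he k y₂ h₂]
    exact (hH y₁ h₁).abs_eigenvalues₀_sub_le _ k
  have hHc : ContinuousOn H (Ici y₀) := by
    intro y hy
    rcases eq_or_lt_of_le (mem_Ici.1 hy) with rfl | hlt
    · rw [← continuousWithinAt_Ioi_iff_Ici]
      exact hlim
    · refine ContinuousAt.continuousWithinAt ?_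
      refine continuousAt_pi.2 fun i => continuousAt_pi.2 fun j => (han y hlt i j).continuousAt
  have hec : ∀ k, ContinuousOn (e k) (Ici y₀) := by
    intro k y hy
    have h1 : Tendsto (fun x => ∑ i, ∑ j, ‖H x i j - H y i j‖) (𝓝[Ici y₀] y) (𝓝 0) := by
      have : Tendsto (fun x => ∑ i, ∑ j, ‖H x i j - H y i j‖) (𝓝[Ici y₀] y)
          (𝓝 (∑ i : n, ∑ j : n, ‖H y i j - H y i j‖)) := by
        refine tendsto_finsetSum _ fun i _ => tendsto_finsetSum _ fun j _ => ?_
        refine Tendsto.norm (Tendsto.sub_const ?_ _)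
        exact tendsto_pi_nhds.1 (tendsto_pi_nhds.1 (hHc y hy) i) j
      simpa using this
    rw [ContinuousWithinAt, tendsto_iff_norm_sub_tendsto_zero]
    refine squeeze_zero' (Eventually.of_forall fun _ => norm_nonneg _) ?_ h1
    filter_upwards [self_mem_nhdsWithin] with x hx
    exact hdiff k x y hx hy
  have hdet : ∀ y, y₀ ≤ y → (H y).det = ∏ k, (e k y : ℂ) := by
    intro y hy
    rw [(hH y hy).det_eq_prod_eigenvalues₀]
    exact Finset.prod_congr rfl fun k _ => by rw [he k y hy]
  -- Each factor of the determinant is compared with x - y or with 1, according to whether it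
  -- vanishes at y. Differentiability of the ordered eigenvalues, which can fail at crossings, is
  -- not used.
  have hord : ∀ y, y₀ < y → analyticOrderAt (fun y => (H y).det) y =
      ((Finset.univ.filter fun k => e k y = 0).card : ℕ∞) := by
    intro y hy
    refine analyticOrderAt_eq_of_isTheta (Matrix.analyticAt_det (han y hy)) ?_
    have hfac : ∀ k, (fun x => (e k x : ℂ)) =Θ[𝓝 y]
        fun x => if e k y = 0 then x - y else 1 := by
      intro k
      by_cases hk : e k y = 0
      · simp only [hk, if_true]
        constructor
        -- Upper bound: the entries are differentiable at y and eigenvalues are Lipschitz in the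
        -- entries.
        · have h1 : (fun x => ∑ i, ∑ j, ‖H x i j - H y i j‖) =O[𝓝 y] fun x => x - y := by
            refine Asymptotics.IsBigO.fun_sum fun i _ => Asymptotics.IsBigO.fun_sum fun j _ => ?_
            exact ((han y hy i j).differentiableAt.isBigO_sub).norm_left
          refine Asymptotics.IsBigO.trans ?_ h1
          refine Asymptotics.IsBigO.of_bound 1 ?_
          filter_upwards [Ioi_mem_nhds hy] with x hx
          have h2 := hdiff k x y (le_of_lt hx) hy.le
          rw [hk, sub_zero] at h2
          rw [Complex.norm_real, Real.norm_eq_abs, one_mul]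
          exact h2.trans (le_abs_self _)
        -- Lower bound: growth at rate at least κ on either side of the zero.
        · refine Asymptotics.IsBigO.of_bound κ⁻¹ ?_
          filter_upwards [Ioi_mem_nhds hy] with x hx
          rw [Complex.norm_real, Real.norm_eq_abs, Real.norm_eq_abs, inv_mul_eq_div, le_div_iff₀ hκ]
          rcases lt_trichotomy x y with h | rfl | h
          · have := hegap k x y (le_of_lt hx) h
            rw [abs_of_neg (sub_neg.2 h)]
            refine le_trans ?_ (neg_le_abs _)
            linarith
          · simp
          · have := hegap k y x hy.le h
            rw [abs_of_pos (sub_pos.2 h)]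
            refine le_trans ?_ (le_abs_self _)
            linarith
      · simp only [hk, if_false]
        refine (Asymptotics.isTheta_of_div_tendsto_nhds_ne_zero (c := (e k y : ℂ))
          (f := fun _ => (1 : ℂ)) ?_ (by exact_mod_cast hk)).symm.trans
          (by simp [Asymptotics.isTheta_const_const_iff])
        simp only [div_one]
        exact (Complex.continuous_ofReal.tendsto _).comp
          ((hec k).continuousAt (Ici_mem_nhds hy)).tendsto
    have hprod := Asymptotics.IsTheta.finsetProd (s := Finset.univ) fun k _ => hfac k
    refine Asymptotics.IsTheta.trans (Asymptotics.IsTheta.of_norm_eventuallyEq_norm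
      (g := fun x => ∏ k, (e k x : ℂ)) ?_) ?_
    · filter_upwards [Ioi_mem_nhds hy] with x hx
      rw [hdet x (le_of_lt hx)]
    · refine hprod.trans (Asymptotics.IsTheta.of_norm_eventuallyEq_norm
        (Eventually.of_forall fun x => ?_))
      simp [Finset.prod_ite]
  have hroot : ∀ k, e k y₀ < 0 → ∃ y, y₀ < y ∧ e k y = 0 := by
    intro k hk
    -- At this point growth at rate κ alone has already brought the eigenvalue up to zero.
    set Y := y₀ + (-e k y₀) / κ
    have hY : y₀ < Y := by
      have : 0 < (-e k y₀) / κ := div_pos (by linarith) hκ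
      simp only [Y]; linarith
    have h1 : 0 ≤ e k Y := by
      have := hegap k y₀ Y le_rfl hY
      have h2 : κ * (Y - y₀) = -e k y₀ := by simp only [Y]; field_simp; ring
      linarith
    obtain ⟨y, hy, hy0⟩ := intermediate_value_Icc hY.le
      ((hec k).mono Icc_subset_Ici_self) (show (0 : ℝ) ∈ Icc (e k y₀) (e k Y) from ⟨hk.le, h1⟩)
    refine ⟨y, lt_of_le_of_ne hy.1 ?_, hy0⟩
    rintro rfl
    linarith
  have hneg : ∀ k y, y₀ < y → e k y = 0 → e k y₀ < 0 := by
    intro k y hy h0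
    have := hmono k (mem_Ici.2 le_rfl) (mem_Ici.2 hy.le) hy
    linarith
  have hset : {y : ℝ | y₀ < y ∧ (H y).det = 0} ⊆ ⋃ k, {y | y₀ < y ∧ e k y = 0} := by
    rintro y ⟨hy, hd⟩
    rw [hdet y hy.le, Finset.prod_eq_zero_iff] at hd
    obtain ⟨k, _, hk⟩ := hd
    exact mem_iUnion.2 ⟨k, hy, by exact_mod_cast hk⟩
  have hfin : {y : ℝ | y₀ < y ∧ (H y).det = 0}.Finite := by
    refine (finite_iUnion fun k => ?_).subset hset
    refine Set.Subsingleton.finite ?_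
    rintro y ⟨hy, hy0⟩ z ⟨hz, hz0⟩
    exact (hmono k).injOn (mem_Ici.2 hy.le) (mem_Ici.2 hz.le) (hy0.trans hz0.symm)
  refine ⟨hfin, (Finset.univ.filter fun k => e k y₀ < 0).card, ?_, ?_, ?_⟩
  · rw [Finset.sum_congr rfl fun y hy => hord y ((hfin.mem_toFinset.1 hy).1), ← Nat.cast_sum]
    congr 1
    -- Strict monotonicity lets an index vanish at one zero only, so the index sets of distinct
    -- zeros are disjoint; their union consists of the indices that start negative.
    rw [← Finset.card_biUnion]
    · congr 1
      ext k
      simp only [Finset.mem_biUnion, Finset.mem_filter, Finset.mem_univ, true_and,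
        Set.Finite.mem_toFinset, Set.mem_ofPred_eq]
      constructor
      · rintro ⟨y, ⟨hy, _⟩, hk⟩
        exact hneg k y hy hk
      · intro hk
        obtain ⟨y, hy, hy0⟩ := hroot k hk
        refine ⟨y, ⟨hy, ?_⟩, hy0⟩
        rw [hdet y hy.le, Finset.prod_eq_zero_iff]
        exact ⟨k, Finset.mem_univ _, by exact_mod_cast hy0⟩
    · intro y hy z hz hyz
      rw [Function.onFun, Finset.disjoint_left]
      intro k hk hk'
      simp only [Finset.mem_filter, Finset.mem_univ, true_and] at hk hk'
      exact hyz ((hmono k).injOn (mem_Ici.2 (hfin.mem_toFinset.1 hy).1.le)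
        (mem_Ici.2 (hfin.mem_toFinset.1 hz).1.le) (hk.trans hk'.symm))
  · exact (Finset.card_le_univ _).trans (by simp)
  · rw [Set.ncard_eq_toFinset_card']
    congr 1
    ext k
    simp [he k y₀ le_rfl]

end Crossing

/-! ### Integrals of the type `∫ p(s) / (w - s) dω(s)` -/

section Stieltjes

variable {ω : Measure ℝ} {a b : ℝ}

theorem ContinuousOn.integrable_of_ae_mem_Icc {E : Type*} [NormedAddCommGroup E]
    [IsFiniteMeasure ω] (hω : ∀ᵐ s ∂ω, s ∈ Icc a b) {F : ℝ → E}
    (hF : ContinuousOn F (Icc a b)) : Integrable F ω := by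
  have h := hF.integrableOn_Icc (μ := ω)
  rwa [IntegrableOn, Measure.restrict_eq_self_of_ae_mem hω] at h

/-- Differentiation under the integral sign. The complex variable is taken because complex
differentiability on a half-plane yields analyticity at once. -/
theorem hasDerivAt_integral_div_sub [IsFiniteMeasure ω] (hω : ∀ᵐ s ∂ω, s ∈ Icc a b) {p : ℝ → ℝ}
    (hp : Continuous p) {z : ℂ} (hz : b < z.re) :
    HasDerivAt (fun z : ℂ => ∫ s, (p s : ℂ) / (z - s) ∂ω)
      (∫ s, -((p s : ℂ) / (z - s) ^ 2) ∂ω) z := by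
  -- Half the distance from Re z to b, so that the ball of radius δ about z keeps distance at least
  -- δ from [a, b].
  set δ := (z.re - b) / 2 with hδ
  have hδ0 : 0 < δ := by rw [hδ]; linarith
  have hne : ∀ x ∈ Metric.ball z δ, ∀ s ∈ Icc a b, δ ≤ ‖x - (s : ℂ)‖ := by
    intro x hx s hs
    have h1 : |(x - z).re| < δ := (Complex.abs_re_le_norm _).trans_lt (by
      rwa [Metric.mem_ball, dist_eq_norm] at hx)
    have h2 : (x - (s : ℂ)).re ≤ ‖x - (s : ℂ)‖ := Complex.re_le_norm _
    simp only [Complex.sub_re, Complex.ofReal_re] at h1 h2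
    have := (abs_lt.1 h1).1
    have := hs.2
    linarith
  have hcont : ∀ x ∈ Metric.ball z δ, ∀ n : ℕ,
      ContinuousOn (fun s : ℝ => (p s : ℂ) / (x - s) ^ n) (Icc a b) := by
    intro x hx n
    refine ContinuousOn.div (by fun_prop) (by fun_prop) fun s hs => pow_ne_zero _ ?_
    exact norm_pos_iff.1 (hδ0.trans_le (hne x hx s hs))
  refine (hasDerivAt_integral_of_dominated_loc_of_deriv_le (Metric.ball_mem_nhds z hδ0)
    (F' := fun x s => -((p s : ℂ) / (x - s) ^ 2)) (bound := fun s => |p s| / δ ^ 2)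
    ?_ ?_ ?_ ?_ ?_ ?_).2
  · filter_upwards [Metric.ball_mem_nhds z hδ0] with x hx
    have := hcont x hx 1
    simp only [pow_one] at this
    exact (this.integrable_of_ae_mem_Icc hω).aestronglyMeasurable
  · have := hcont z (Metric.mem_ball_self hδ0) 1
    simp only [pow_one] at this
    exact this.integrable_of_ae_mem_Icc hω
  · exact ((hcont z (Metric.mem_ball_self hδ0) 2).neg.integrable_of_ae_mem_Icc
      hω).aestronglyMeasurable
  · filter_upwards [hω] with s hs x hx
    rw [norm_neg, norm_div, norm_pow, Complex.norm_real, Real.norm_eq_abs]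
    gcongr
    exact hne x hx s hs
  · exact ContinuousOn.integrable_of_ae_mem_Icc hω (by fun_prop)
  · filter_upwards [hω] with s hs x hx
    have h0 : x - (s : ℂ) ≠ 0 := norm_pos_iff.1 (hδ0.trans_le (hne x hx s hs))
    have := (hasDerivAt_const x (p s : ℂ)).fun_div ((hasDerivAt_id x).sub_const (s : ℂ)) h0
    simpa [neg_div] using this

theorem ofReal_integral_div_sub (p : ℝ → ℝ) (w : ℝ) :
    ((∫ s, p s / (w - s) ∂ω : ℝ) : ℂ) = ∫ s, (p s : ℂ) / ((w : ℂ) - s) ∂ω := by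
  rw [← integral_complex_ofReal]
  push_cast
  rfl

/-- The integral is holomorphic on Re z > b; restriction to the real axis followed by the real part
is real-analytic. -/
theorem analyticAt_integral_div_sub [IsFiniteMeasure ω] (hω : ∀ᵐ s ∂ω, s ∈ Icc a b) {p : ℝ → ℝ}
    (hp : Continuous p) {w : ℝ} (hw : b < w) :
    AnalyticAt ℝ (fun w : ℝ => ∫ s, p s / (w - s) ∂ω) w := by
  have hopen : IsOpen {z : ℂ | b < z.re} := isOpen_lt continuous_const Complex.continuous_re
  have h : AnalyticAt ℂ (fun z : ℂ => ∫ s, (p s : ℂ) / (z - s) ∂ω) (w : ℂ) := by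
    refine DifferentiableOn.analyticAt (s := {z : ℂ | b < z.re}) (fun z hz => ?_)
      (hopen.mem_nhds (by simpa using hw))
    exact (hasDerivAt_integral_div_sub hω hp hz).differentiableAt.differentiableWithinAt
  refine h.re_ofReal.congr (Eventually.of_forall fun x => ?_)
  simp only [← ofReal_integral_div_sub, Complex.ofReal_re]

theorem hasDerivAt_real_integral_div_sub [IsFiniteMeasure ω] (hω : ∀ᵐ s ∂ω, s ∈ Icc a b)
    {p : ℝ → ℝ} (hp : Continuous p) {w : ℝ} (hw : b < w) :
    HasDerivAt (fun w : ℝ => ∫ s, p s / (w - s) ∂ω) (-∫ s, p s / (w - s) ^ 2 ∂ω) w := by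
  have h := (hasDerivAt_integral_div_sub hω hp (z := (w : ℂ)) (by simpa using hw)).real_of_complex
  simp only [← ofReal_integral_div_sub, Complex.ofReal_re] at h
  convert h using 1
  rw [integral_neg, Complex.neg_re]
  congr 1
  rw [← Complex.ofReal_re (∫ s, p s / (w - s) ^ 2 ∂ω), ← integral_complex_ofReal]
  push_cast
  rfl

theorem integral_lt_integral_of_ae_lt [NeZero ω] {f g : ℝ → ℝ} (hf : Integrable f ω)
    (hg : Integrable g ω) (h : ∀ᵐ s ∂ω, f s < g s) : ∫ s, f s ∂ω < ∫ s, g s ∂ω := by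
  rw [← sub_pos, ← integral_sub' hg hf, integral_pos_iff_support_of_nonneg_ae
    (h.mono fun s hs => by simpa using hs.le) (hg.sub hf)]
  have : Function.support (g - f) =ᵐ[ω] univ := by
    filter_upwards [h] with s hs
    exact eq_true (show g s - f s ≠ 0 by linarith) |>.trans (eq_true (mem_univ s)).symm
  rw [measure_congr this]
  simp [pos_iff_ne_zero, NeZero.ne]

end Stieltjes

/-! ### The real function `φ = k (w + k)` beyond the spectrum -/

/-- `ω` is a probability law carried by `[a, b]` with `0 < a`. -/
structure IsSpectralLaw (ω : Measure ℝ) (a b : ℝ) : Prop where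
  prob : IsProbabilityMeasure ω
  pos : 0 < a
  mem : ∀ᵐ s ∂ω, s ∈ Icc a b

/-- `k(w) = c ∫ s w / (w - s) dω(s)`. -/
def edgeK (c : ℝ) (ω : Measure ℝ) (w : ℝ) : ℝ := c * ∫ s, s * w / (w - s) ∂ω

/-- `-k'(w) = c ∫ s² / (w - s)² dω(s)`. -/
def edgeA (c : ℝ) (ω : Measure ℝ) (w : ℝ) : ℝ := c * ∫ s, s ^ 2 / (w - s) ^ 2 ∂ω

/-- `φ = k (w + k)`. -/
def edgePhi (c : ℝ) (ω : Measure ℝ) (w : ℝ) : ℝ := edgeK c ω w * (w + edgeK c ω w)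

/-- The derivative of `φ`. -/
def edgePhi' (c : ℝ) (ω : Measure ℝ) (w : ℝ) : ℝ :=
  edgeK c ω w - edgeA c ω w * (w + 2 * edgeK c ω w)

namespace IsSpectralLaw

variable {ω : Measure ℝ} {a b c : ℝ}

theorem le (h : IsSpectralLaw ω a b) : a ≤ b := by
  have := h.prob
  obtain ⟨s, hs⟩ := h.mem.exists
  exact hs.1.trans hs.2

theorem integrable (h : IsSpectralLaw ω a b) {F : ℝ → ℝ} (hF : ContinuousOn F (Icc a b)) :
    Integrable F ω :=
  have := h.prob
  hF.integrable_of_ae_mem_Icc h.mem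

theorem integral_mono (h : IsSpectralLaw ω a b) {F G : ℝ → ℝ} (hF : ContinuousOn F (Icc a b))
    (hG : ContinuousOn G (Icc a b)) (hFG : ∀ s ∈ Icc a b, F s ≤ G s) :
    ∫ s, F s ∂ω ≤ ∫ s, G s ∂ω :=
  integral_mono_ae (h.integrable hF) (h.integrable hG) (h.mem.mono hFG)

theorem integral_lt (h : IsSpectralLaw ω a b) {F G : ℝ → ℝ} (hF : ContinuousOn F (Icc a b))
    (hG : ContinuousOn G (Icc a b)) (hFG : ∀ s ∈ Icc a b, F s < G s) :
    ∫ s, F s ∂ω < ∫ s, G s ∂ω :=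
  have := h.prob
  integral_lt_integral_of_ae_lt (h.integrable hF) (h.integrable hG) (h.mem.mono hFG)

theorem continuousOn_div (w : ℝ) (hw : b < w) {p : ℝ → ℝ} (hp : Continuous p) (n : ℕ) :
    ContinuousOn (fun s => p s / (w - s) ^ n) (Icc a b) :=
  ContinuousOn.div (by fun_prop) (by fun_prop) fun s hs => pow_ne_zero _ (by linarith [hs.2])

/-- Writing sw/(w - s) = s + s²/(w - s) removes w from the numerator, so that the results on ∫
p(s)/(w - s) dω apply. -/
theorem edgeK_eq (h : IsSpectralLaw ω a b) {w : ℝ} (hw : b < w) :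
    edgeK c ω w = c * (∫ s, s ∂ω + ∫ s, s ^ 2 / (w - s) ∂ω) := by
  have h2 := continuousOn_div (a := a) w hw (p := fun s => s ^ 2) (by fun_prop) 1
  simp only [pow_one] at h2
  rw [edgeK, ← integral_add (h.integrable (F := fun s => s) (by fun_prop)) (h.integrable h2)]
  congr 1
  refine integral_congr_ae (h.mem.mono fun s hs => ?_)
  have : w - s ≠ 0 := by linarith [hs.2]
  field_simp
  ring

theorem continuousOn_k (w : ℝ) (hw : b < w) :
    ContinuousOn (fun s => s * w / (w - s)) (Icc a b) := by
  simpa using continuousOn_div (a := a) w hw (p := fun s => s * w) (by fun_prop) 1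

theorem le_edgeK (h : IsSpectralLaw ω a b) (hc : 0 < c) {w : ℝ} (hw : b < w) :
    c * a ≤ edgeK c ω w := by
  have := h.prob
  rw [edgeK]
  gcongr
  have h1 : ∫ _, a ∂ω ≤ ∫ s, s * w / (w - s) ∂ω := by
    refine h.integral_mono continuousOn_const (continuousOn_k w hw) fun s hs => ?_
    have : 0 < w - s := by linarith [hs.2]
    rw [le_div_iff₀ this]
    nlinarith [hs.1, hs.2, h.pos]
  simpa using h1

theorem edgeK_pos (h : IsSpectralLaw ω a b) (hc : 0 < c) {w : ℝ} (hw : b < w) :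
    0 < edgeK c ω w :=
  (mul_pos hc h.pos).trans_le (h.le_edgeK hc hw)

theorem edgeK_antitone (h : IsSpectralLaw ω a b) (hc : 0 < c) {w₁ w₂ : ℝ} (hw : b < w₁)
    (h12 : w₁ ≤ w₂) : edgeK c ω w₂ ≤ edgeK c ω w₁ := by
  rw [edgeK, edgeK]
  gcongr 1
  refine h.integral_mono (continuousOn_k _ (hw.trans_le h12)) (continuousOn_k _ hw) fun s hs => ?_
  have h1 : 0 < w₁ - s := by linarith [hs.2]
  have h2 : 0 < w₂ - s := by linarith [hs.2]
  rw [div_le_div_iff₀ h2 h1]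
  nlinarith [hs.1, h.pos, mul_nonneg (sq_nonneg s) (sub_nonneg.2 h12)]

theorem edgeA_strictAnti (h : IsSpectralLaw ω a b) (hc : 0 < c) {w₁ w₂ : ℝ} (hw : b < w₁)
    (h12 : w₁ < w₂) : edgeA c ω w₂ < edgeA c ω w₁ := by
  rw [edgeA, edgeA]
  refine mul_lt_mul_of_pos_left ?_ hc
  refine h.integral_lt (continuousOn_div _ (hw.trans h12) (by fun_prop) 2)
    (continuousOn_div _ hw (by fun_prop) 2) fun s hs => ?_
  have h1 : 0 < w₁ - s := by linarith [hs.2]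
  have h3 : 0 < s := h.pos.trans_le hs.1
  gcongr

theorem edgeA_pos (h : IsSpectralLaw ω a b) (hc : 0 < c) {w : ℝ} (hw : b < w) :
    0 < edgeA c ω w := by
  refine mul_pos hc ?_
  have := h.integral_lt (F := fun _ => 0) continuousOn_const
    (continuousOn_div w hw (p := fun s => s ^ 2) (by fun_prop) 2) fun s hs => by
      have h1 : 0 < w - s := by linarith [hs.2]
      have h3 : 0 < s := h.pos.trans_le hs.1
      positivity
  simpa using this

theorem hasDerivAt_edgeK (h : IsSpectralLaw ω a b) {w : ℝ} (hw : b < w) :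
    HasDerivAt (edgeK c ω) (-edgeA c ω w) w := by
  have := h.prob
  have h1 := ((hasDerivAt_real_integral_div_sub h.mem (p := fun s => s ^ 2) (by fun_prop)
    hw).const_add (∫ s, s ∂ω)).const_mul c
  rw [edgeA, ← mul_neg]
  refine h1.congr_of_eventuallyEq ?_
  filter_upwards [Ioi_mem_nhds hw] with x hx
  exact h.edgeK_eq hx

theorem analyticAt_edgeK (h : IsSpectralLaw ω a b) {w : ℝ} (hw : b < w) :
    AnalyticAt ℝ (edgeK c ω) w := by
  have := h.prob
  have h1 : AnalyticAt ℝ (fun w => c * (∫ s, s ∂ω + ∫ s, s ^ 2 / (w - s) ∂ω)) w :=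
    analyticAt_const.mul (analyticAt_const.add
      (analyticAt_integral_div_sub h.mem (p := fun s => s ^ 2) (by fun_prop) hw))
  refine h1.congr ?_
  filter_upwards [Ioi_mem_nhds hw] with x hx
  exact (h.edgeK_eq hx).symm

theorem analyticAt_edgePhi (h : IsSpectralLaw ω a b) {w : ℝ} (hw : b < w) :
    AnalyticAt ℝ (edgePhi c ω) w :=
  (h.analyticAt_edgeK hw).mul (analyticAt_id.add (h.analyticAt_edgeK hw))

theorem hasDerivAt_edgePhi (h : IsSpectralLaw ω a b) {w : ℝ} (hw : b < w) :
    HasDerivAt (edgePhi c ω) (edgePhi' c ω w) w := by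
  have h1 := h.hasDerivAt_edgeK (c := c) hw
  have := h1.mul ((hasDerivAt_id w).add h1)
  refine this.congr_deriv ?_
  simp only [edgePhi', Pi.add_apply, id]
  ring

/-- This is the strict convexity of φ. With A = -k', one has k - Aw = c ∫ (s - s³/(w - s)²) dω,
which does not decrease, while the remaining term -2Ak strictly increases because A strictly
decreases, k does not increase and both are positive. -/
theorem edgePhi'_strictMono (h : IsSpectralLaw ω a b) (hc : 0 < c) :
    StrictMonoOn (edgePhi' c ω) (Ioi b) := by
  have key : ∀ w, b < w →
      edgePhi' c ω w = c * ∫ s, (s - s ^ 3 / (w - s) ^ 2) ∂ω - 2 * (edgeA c ω w * edgeK c ω w) := by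
    intro w hw
    have h3 : edgeK c ω w - edgeA c ω w * w = c * ∫ s, (s - s ^ 3 / (w - s) ^ 2) ∂ω := by
      rw [edgeK, edgeA, mul_assoc, ← mul_sub, ← integral_mul_const, ← integral_sub]
      · congr 1
        refine integral_congr_ae (h.mem.mono fun s hs => ?_)
        have : w - s ≠ 0 := by linarith [hs.2]
        field_simp
        ring
      · exact h.integrable (continuousOn_k w hw)
      · exact (h.integrable (continuousOn_div w hw (by fun_prop) 2)).mul_const _
    rw [edgePhi', ← h3]; ring
  intro w₁ h₁ w₂ h₂ h12
  rw [key w₁ h₁, key w₂ h₂]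
  have hA := h.edgeA_strictAnti hc h₁ h12
  have hK := h.edgeK_antitone hc h₁ h12.le
  have hA2 := h.edgeA_pos hc h₂
  have hK1 := h.edgeK_pos hc h₁
  have hI : c * ∫ s, (s - s ^ 3 / (w₁ - s) ^ 2) ∂ω ≤ c * ∫ s, (s - s ^ 3 / (w₂ - s) ^ 2) ∂ω := by
    gcongr 1
    refine h.integral_mono ?_ ?_ fun s hs => ?_
    · exact continuousOn_id.sub (continuousOn_div _ h₁ (by fun_prop) 2)
    · exact continuousOn_id.sub (continuousOn_div _ h₂ (by fun_prop) 2)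
    · have h1 : 0 < w₁ - s := by linarith [hs.2, mem_Ioi.1 h₁]
      have h3 : 0 < s := h.pos.trans_le hs.1
      gcongr
  nlinarith

end IsSpectralLaw

/-! ### The critical point of φ and the increasing branch beyond it -/

namespace IsSpectralLaw

variable {ω : Measure ℝ} {a b c wp : ℝ}

theorem b_pos (h : IsSpectralLaw ω a b) : 0 < b := h.pos.trans_le h.le

/-- Gives both the growth of φ at infinity and its positivity. -/
theorem le_edgePhi (h : IsSpectralLaw ω a b) (hc : 0 < c) {w : ℝ} (hw : b < w) :
    c * a * w ≤ edgePhi c ω w := by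
  have h1 := h.le_edgeK hc hw
  have h2 := h.edgeK_pos hc hw
  have h3 := h.b_pos
  rw [edgePhi]
  nlinarith

/-- φ exceeds its value at the reference point b + 1 near both ends of (b, ∞), so it has an interior
minimum, where the derivative vanishes. Unboundedness of k near b is the only input beyond the
spectral law. -/
theorem exists_edge (h : IsSpectralLaw ω a b) (hc : 0 < c)
    (hco : ∀ B, ∃ w, b < w ∧ B < edgeK c ω w) : ∃ wp, b < wp ∧ edgePhi' c ω wp = 0 := by
  set w₀ := b + 1
  set v := edgePhi c ω w₀
  have hw0 : b < w₀ := by simp [w₀]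
  have hv : 0 < v := (mul_pos (mul_pos hc h.pos) (h.b_pos.trans hw0)).trans_le (h.le_edgePhi hc hw0)
  have hb := h.b_pos
  -- On (b, w₁] one has k > v/b, hence φ ≥ kw > v.
  obtain ⟨w₁, hw1, hk1⟩ := hco (v / b)
  have hlow : ∀ w, b < w → w ≤ w₁ → v < edgePhi c ω w := by
    intro w hw hle
    have h1 := hk1.trans_le (h.edgeK_antitone hc hw hle)
    have h2 := h.edgeK_pos hc hw
    rw [div_lt_iff₀ hb] at h1
    rw [edgePhi]
    nlinarith
  set w₂ := max w₀ (v / (c * a)) + 1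
  have hca := mul_pos hc h.pos
  have hhigh : ∀ w, w₂ ≤ w → v < edgePhi c ω w := by
    intro w hw
    have h1 : v / (c * a) < w := by
      have := le_max_right w₀ (v / (c * a)); simp only [w₂] at hw; linarith
    have h2 : b < w := by
      have := le_max_left w₀ (v / (c * a)); simp only [w₂] at hw; linarith
    rw [div_lt_iff₀ hca] at h1
    have := h.le_edgePhi hc h2
    linarith
  have hw10 : w₁ < w₀ := by
    by_contra! hh
    exact lt_irrefl _ (hlow w₀ hw0 hh)
  have hw02 : w₀ < w₂ := by
    have := le_max_left w₀ (v / (c * a)); simp only [w₂]; linarith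
  have hcont : ContinuousOn (edgePhi c ω) (Icc w₁ w₂) := fun w hw =>
    (h.hasDerivAt_edgePhi (hw1.trans_le hw.1)).continuousAt.continuousWithinAt
  obtain ⟨wp, hwp, hmin⟩ := isCompact_Icc.exists_isMinOn ⟨w₀, hw10.le, hw02.le⟩ hcont
  have hle : edgePhi c ω wp ≤ v := hmin ⟨hw10.le, hw02.le⟩
  have hwp1 : w₁ < wp := by
    by_contra! hh
    exact absurd (hlow wp (hw1.trans_le hwp.1) hh) (not_lt.2 hle)
  have hwp2 : wp < w₂ := by
    by_contra! hh
    exact absurd (hhigh wp hh) (not_lt.2 hle)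
  refine ⟨wp, hw1.trans hwp1, ?_⟩
  exact (hmin.isLocalMin (Icc_mem_nhds hwp1 hwp2)).hasDerivAt_eq_zero
    (h.hasDerivAt_edgePhi (hw1.trans hwp1))

theorem edgePhi'_pos (h : IsSpectralLaw ω a b) (hc : 0 < c) (hb : b < wp)
    (hwp : edgePhi' c ω wp = 0) {w : ℝ} (hw : wp < w) : 0 < edgePhi' c ω w :=
  hwp ▸ h.edgePhi'_strictMono hc hb (hb.trans hw) hw

theorem edgePhi'_neg (h : IsSpectralLaw ω a b) (hc : 0 < c) (hb : b < wp)
    (hwp : edgePhi' c ω wp = 0) {w : ℝ} (hbw : b < w) (hw : w < wp) : edgePhi' c ω w < 0 :=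
  hwp ▸ h.edgePhi'_strictMono hc hbw hb hw

theorem edgePhi_strictMonoOn (h : IsSpectralLaw ω a b) (hc : 0 < c) (hb : b < wp)
    (hwp : edgePhi' c ω wp = 0) : StrictMonoOn (edgePhi c ω) (Ici wp) := by
  refine strictMonoOn_of_deriv_pos (convex_Ici _)
    (fun w hw => (h.hasDerivAt_edgePhi (hb.trans_le hw)).continuousAt.continuousWithinAt)
    fun w hw => ?_
  rw [interior_Ici] at hw
  rw [(h.hasDerivAt_edgePhi (hb.trans hw)).deriv]
  exact h.edgePhi'_pos hc hb hwp hw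

theorem edgePhi_lt_of_ne (h : IsSpectralLaw ω a b) (hc : 0 < c) (hb : b < wp)
    (hwp : edgePhi' c ω wp = 0) {w : ℝ} (hw : b < w) (hne : w ≠ wp) :
    edgePhi c ω wp < edgePhi c ω w := by
  rcases lt_or_gt_of_ne hne with hlt | hgt
  · have : StrictAntiOn (edgePhi c ω) (Icc w wp) := by
      refine strictAntiOn_of_deriv_neg (convex_Icc _ _)
        (fun x hx => (h.hasDerivAt_edgePhi (hw.trans_le hx.1)).continuousAt.continuousWithinAt)
        fun x hx => ?_
      rw [interior_Icc] at hx
      rw [(h.hasDerivAt_edgePhi (hw.trans hx.1)).deriv]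
      exact h.edgePhi'_neg hc hb hwp (hw.trans hx.1) hx.2
    exact this (left_mem_Icc.2 hlt.le) (right_mem_Icc.2 hlt.le) hlt
  · exact h.edgePhi_strictMonoOn hc hb hwp self_mem_Ici (mem_Ici.2 hgt.le) hgt

theorem exists_edgePhi_eq (h : IsSpectralLaw ω a b) (hc : 0 < c) (hb : b < wp)
    {x : ℝ} (hx : edgePhi c ω wp ≤ x) : ∃ w, wp ≤ w ∧ edgePhi c ω w = x := by
  have hca := mul_pos hc h.pos
  set w₂ := max wp (x / (c * a))
  have h2 : x ≤ edgePhi c ω w₂ := by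
    refine le_trans ?_ (h.le_edgePhi hc (hb.trans_le (le_max_left _ _)))
    have := le_max_right wp (x / (c * a))
    rw [div_le_iff₀ hca] at this
    linarith
  obtain ⟨w, hw, hwx⟩ := intermediate_value_Icc (le_max_left wp (x / (c * a)))
    (fun w hw => (h.hasDerivAt_edgePhi (c := c)
      (hb.trans_le hw.1)).continuousAt.continuousWithinAt) ⟨hx, h2⟩
  exact ⟨w, hw.1, hwx⟩

/-- If A ≥ 1 then φ' ≤ k - (w + 2k) < 0. The bound is what places the solution built from w in the
upper half-plane. -/
theorem edgeA_lt_one (h : IsSpectralLaw ω a b) (hc : 0 < c) {w : ℝ} (hw : b < w)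
    (h' : 0 ≤ edgePhi' c ω w) : edgeA c ω w < 1 := by
  have h1 := h.edgeK_pos hc hw
  have h2 := h.b_pos
  rw [edgePhi'] at h'
  by_contra! hA
  nlinarith

theorem edgePhi_pos (h : IsSpectralLaw ω a b) (hc : 0 < c) {w : ℝ} (hw : b < w) :
    0 < edgePhi c ω w :=
  (mul_pos (mul_pos hc h.pos) (h.b_pos.trans hw)).trans_le (h.le_edgePhi hc hw)

end IsSpectralLaw

open Classical in
/-- The inverse of `φ` on `[wp, ∞)`. -/
def edgeInv (c : ℝ) (ω : Measure ℝ) (wp x : ℝ) : ℝ :=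
  -- The default is never used at or above the edge, where a preimage exists.
  if h : ∃ w, wp ≤ w ∧ edgePhi c ω w = x then h.choose else wp

/-! ### Monotonicity, continuity and analyticity of the inverse branch -/

namespace IsSpectralLaw

variable {ω : Measure ℝ} {a b c wp : ℝ}

theorem edgeInv_spec (h : IsSpectralLaw ω a b) (hc : 0 < c) (hb : b < wp) {x : ℝ}
    (hx : edgePhi c ω wp ≤ x) :
    wp ≤ edgeInv c ω wp x ∧ edgePhi c ω (edgeInv c ω wp x) = x := by
  have := h.exists_edgePhi_eq hc hb hx
  rw [edgeInv, dif_pos this]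
  exact this.choose_spec

theorem edgeInv_eq (h : IsSpectralLaw ω a b) (hc : 0 < c) (hb : b < wp)
    (hwp : edgePhi' c ω wp = 0) {w : ℝ} (hw : wp ≤ w) :
    edgeInv c ω wp (edgePhi c ω w) = w := by
  have h1 := h.edgeInv_spec hc hb (x := edgePhi c ω w)
    ((h.edgePhi_strictMonoOn hc hb hwp).monotoneOn self_mem_Ici hw hw)
  exact (h.edgePhi_strictMonoOn hc hb hwp).injOn h1.1 hw h1.2

theorem edgeInv_strictMonoOn (h : IsSpectralLaw ω a b) (hc : 0 < c) (hb : b < wp)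
    (hwp : edgePhi' c ω wp = 0) : StrictMonoOn (edgeInv c ω wp) (Ici (edgePhi c ω wp)) := by
  intro x hx y hy hxy
  have h1 := h.edgeInv_spec hc hb hx
  have h2 := h.edgeInv_spec hc hb hy
  by_contra! hle
  have := (h.edgePhi_strictMonoOn hc hb hwp).monotoneOn h2.1 h1.1 hle
  rw [h1.2, h2.2] at this
  linarith

theorem lt_edgeInv (h : IsSpectralLaw ω a b) (hc : 0 < c) (hb : b < wp)
    (hwp : edgePhi' c ω wp = 0) {x w : ℝ} (hw : wp ≤ w) (hx : edgePhi c ω w < x) :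
    w < edgeInv c ω wp x := by
  have h0 := (h.edgePhi_strictMonoOn hc hb hwp).monotoneOn self_mem_Ici hw hw
  rw [← h.edgeInv_eq hc hb hwp hw]
  exact h.edgeInv_strictMonoOn hc hb hwp h0 (h0.trans hx.le) hx

theorem edgeInv_lt (h : IsSpectralLaw ω a b) (hc : 0 < c) (hb : b < wp)
    (hwp : edgePhi' c ω wp = 0) {x w : ℝ} (hw : wp ≤ w) (hx0 : edgePhi c ω wp ≤ x)
    (hx : x < edgePhi c ω w) : edgeInv c ω wp x < w := by
  have h0 := (h.edgePhi_strictMonoOn hc hb hwp).monotoneOn self_mem_Ici hw hw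
  conv_rhs => rw [← h.edgeInv_eq hc hb hwp hw]
  exact h.edgeInv_strictMonoOn hc hb hwp hx0 h0 hx

theorem edgeInv_edge (h : IsSpectralLaw ω a b) (hc : 0 < c) (hb : b < wp)
    (hwp : edgePhi' c ω wp = 0) : edgeInv c ω wp (edgePhi c ω wp) = wp :=
  h.edgeInv_eq hc hb hwp le_rfl

/-- φ' vanishes at wp, so the inverse function theorem is not available at the edge; monotonicity
alone gives continuity from the right. -/
theorem tendsto_edgeInv_edge (h : IsSpectralLaw ω a b) (hc : 0 < c) (hb : b < wp)
    (hwp : edgePhi' c ω wp = 0) :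
    Tendsto (edgeInv c ω wp) (𝓝[>] (edgePhi c ω wp)) (𝓝 wp) := by
  rw [tendsto_order]
  constructor
  · intro w hw
    filter_upwards [self_mem_nhdsWithin] with x hx
    exact hw.trans_le (h.edgeInv_spec hc hb (le_of_lt hx)).1
  · intro w hw
    have h1 := h.edgePhi_strictMonoOn hc hb hwp self_mem_Ici (mem_Ici.2 hw.le) hw
    filter_upwards [self_mem_nhdsWithin, mem_nhdsWithin_of_mem_nhds (Iio_mem_nhds h1)] with x hx hx2
    exact h.edgeInv_lt hc hb hwp hw.le (le_of_lt hx) hx2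

/-- Beyond wp the derivative is positive, so φ has an analytic local inverse. It takes values in
(wp, ∞), where φ is injective, and therefore coincides with the chosen inverse. -/
theorem analyticAt_edgeInv (h : IsSpectralLaw ω a b) (hc : 0 < c) (hb : b < wp)
    (hwp : edgePhi' c ω wp = 0) {x : ℝ} (hx : edgePhi c ω wp < x) :
    AnalyticAt ℝ (edgeInv c ω wp) x := by
  set w := edgeInv c ω wp x
  have hw : wp < w := h.lt_edgeInv hc hb hwp le_rfl hx
  have hwx : edgePhi c ω w = x := (h.edgeInv_spec hc hb hx.le).2
  have han := h.analyticAt_edgePhi (c := c) (hb.trans hw)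
  have hd : deriv (edgePhi c ω) w ≠ 0 := by
    rw [(h.hasDerivAt_edgePhi (hb.trans hw)).deriv]
    exact (h.edgePhi'_pos hc hb hwp hw).ne'
  have h1 := han.analyticAt_localInverse hd
  have h0 : han.hasStrictDerivAt.localInverse _ _ _ hd (edgePhi c ω w) = w :=
    HasStrictFDerivAt.localInverse_apply_image ..
  have h2 := h1.continuousAt.tendsto
  rw [h0] at h2
  have h3 : ∀ᶠ y in 𝓝 (edgePhi c ω w),
      edgePhi c ω (han.hasStrictDerivAt.localInverse _ _ _ hd y) = y :=
    HasStrictDerivAt.eventually_right_inverse ..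
  rw [← hwx]
  refine h1.congr ?_
  filter_upwards [h2.eventually (Ioi_mem_nhds hw), h3] with y hy1 hy2
  conv_rhs => rw [← hy2]
  exact (h.edgeInv_eq hc hb hwp (le_of_lt hy1)).symm

end IsSpectralLaw

/-! ### The canonical equation in terms of the eigenvalues -/

namespace Matrix.IsHermitian

variable {n : Type*} [Fintype n] [DecidableEq n] {R : Matrix n n ℂ}

theorem affine_eq (hR : R.IsHermitian) (α β : ℂ) :
    α • (1 : Matrix n n ℂ) + β • R = (hR.eigenvectorUnitary : Matrix n n ℂ) *
      diagonal (fun k => α + β * hR.eigenvalues k) *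
      star (hR.eigenvectorUnitary : Matrix n n ℂ) := by
  have h1 : diagonal (fun k => α + β * (hR.eigenvalues k : ℂ)) =
      α • (1 : Matrix n n ℂ) + β • diagonal (fun k => (hR.eigenvalues k : ℂ)) := by
    ext i j
    by_cases hij : i = j <;> simp [hij, diagonal]
  have h2 := hR.spectral_theorem
  rw [Unitary.conjStarAlgAut_apply] at h2
  have hU : (hR.eigenvectorUnitary : Matrix n n ℂ) *
      star (hR.eigenvectorUnitary : Matrix n n ℂ) = 1 := Unitary.coe_mul_star_self _
  rw [h1, mul_add, add_mul, mul_smul_comm, mul_one, smul_mul_assoc, hU, mul_smul_comm,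
    smul_mul_assoc]
  congr 2

theorem inv_affine (hR : R.IsHermitian) {α β : ℂ} (h : ∀ k, α + β * hR.eigenvalues k ≠ 0) :
    (α • (1 : Matrix n n ℂ) + β • R)⁻¹ = (hR.eigenvectorUnitary : Matrix n n ℂ) *
      diagonal (fun k => (α + β * hR.eigenvalues k)⁻¹) *
      star (hR.eigenvectorUnitary : Matrix n n ℂ) := by
  apply inv_eq_right_inv
  rw [hR.affine_eq]
  set U : Matrix n n ℂ := (hR.eigenvectorUnitary : Matrix n n ℂ)
  have hU : star U * U = 1 := Unitary.coe_star_mul_self _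
  have hU' : U * star U = 1 := Unitary.coe_mul_star_self _
  calc U * diagonal (fun k => α + β * (hR.eigenvalues k : ℂ)) * star U *
        (U * diagonal (fun k => (α + β * (hR.eigenvalues k : ℂ))⁻¹) * star U)
      = U * (diagonal (fun k => α + β * (hR.eigenvalues k : ℂ)) * (star U * U) *
        diagonal (fun k => (α + β * (hR.eigenvalues k : ℂ))⁻¹)) * star U := by
          simp only [Matrix.mul_assoc]
    _ = 1 := by
      rw [hU, Matrix.mul_one, diagonal_mul_diagonal]
      have : (fun k => (α + β * (hR.eigenvalues k : ℂ)) * (α + β * (hR.eigenvalues k : ℂ))⁻¹) =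
          fun _ => 1 := funext fun k => mul_inv_cancel₀ (h k)
      rw [this, diagonal_one, Matrix.mul_one, hU']

theorem trace_mul_inv_affine (hR : R.IsHermitian) {α β : ℂ}
    (h : ∀ k, α + β * hR.eigenvalues k ≠ 0) :
    (R * (α • (1 : Matrix n n ℂ) + β • R)⁻¹).trace =
      ∑ k, (hR.eigenvalues k : ℂ) / (α + β * hR.eigenvalues k) := by
  rw [hR.inv_affine h]
  have h2 := hR.affine_eq 0 1
  simp only [zero_smul, one_smul, zero_add, one_mul] at h2
  set U : Matrix n n ℂ := (hR.eigenvectorUnitary : Matrix n n ℂ)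
  have hU : star U * U = 1 := Unitary.coe_star_mul_self _
  set d := fun k => (α + β * (hR.eigenvalues k : ℂ))⁻¹
  have h3 : R * (U * diagonal d * star U) =
      U * (diagonal (fun k => (hR.eigenvalues k : ℂ)) * (star U * U) * diagonal d) * star U := by
    conv_lhs => rw [h2]
    simp only [Matrix.mul_assoc]
  rw [h3, trace_mul_comm, ← Matrix.mul_assoc, hU, Matrix.one_mul, Matrix.mul_one,
    diagonal_mul_diagonal, trace_diagonal]
  rfl

end Matrix.IsHermitian

section Canonical

/-- Contraction argument for the symmetrized canonical equation. -/
theorem symmetrized_canonical_unique {m : ℕ} (hm : 0 < m) {lam : Fin m → ℝ} (hl : ∀ k, 0 < lam k)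
    {C : ℝ} (hC : 0 < C) {y G₁ G₂ : ℂ} (hy : 0 < y.im) (hG₁ : 0 < G₁.im) (hG₂ : 0 < G₂.im)
    (h₁ : G₁ = C * ∑ k, (lam k : ℂ) / (-y + lam k * ((1 / (G₁ - 1) + 1 / (G₁ + 1)) / 2)))
    (h₂ : G₂ = C * ∑ k, (lam k : ℂ) / (-y + lam k * ((1 / (G₂ - 1) + 1 / (G₂ + 1)) / 2))) :
    G₁ = G₂ := by
  have hsub : ∀ G : ℂ, 0 < G.im → G - 1 ≠ 0 := fun G hG h => by
    have := congrArg Complex.im h; simp at this; linarith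
  have hadd : ∀ G : ℂ, 0 < G.im → G + 1 ≠ 0 := fun G hG h => by
    have := congrArg Complex.im h; simp at this; linarith
  have hP : ∀ G : ℂ, ((1 / (G - 1) + 1 / (G + 1)) / 2).im =
      -(G.im * ((‖G - 1‖⁻¹ ^ 2 + ‖G + 1‖⁻¹ ^ 2) / 2)) := by
    intro G
    have : ∀ X : ℂ, (1 / X).im = -(X.im * ‖X‖⁻¹ ^ 2) := by
      intro X
      rw [one_div, Complex.inv_im, Complex.normSq_eq_norm_sq, inv_pow, div_eq_mul_inv, neg_mul]
    rw [show (1 / (G - 1) + 1 / (G + 1)) / 2 = ((1 / 2 : ℝ) : ℂ) * (1 / (G - 1) + 1 / (G + 1)) by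
      push_cast; ring, Complex.im_ofReal_mul, Complex.add_im, this, this]
    simp; ring
  have hDim : ∀ G : ℂ, 0 < G.im → ∀ k,
      (-y + lam k * ((1 / (G - 1) + 1 / (G + 1)) / 2)).im =
      -(y.im + lam k * (G.im * ((‖G - 1‖⁻¹ ^ 2 + ‖G + 1‖⁻¹ ^ 2) / 2))) := by
    intro G hG k
    rw [Complex.add_im, Complex.neg_im, Complex.im_ofReal_mul, hP]
    ring
  have hD : ∀ G : ℂ, 0 < G.im → ∀ k, -y + lam k * ((1 / (G - 1) + 1 / (G + 1)) / 2) ≠ 0 := by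
    intro G hG k h0
    have h1 := hDim G hG k
    rw [h0, Complex.zero_im] at h1
    have := hl k
    have : 0 ≤ lam k * (G.im * ((‖G - 1‖⁻¹ ^ 2 + ‖G + 1‖⁻¹ ^ 2) / 2)) := by positivity
    linarith
  -- Take imaginary parts in the equation: the term with y.im is positive, so dropping it gives a
  -- strict inequality, which is then divided by G.im.
  have hsmall : ∀ G : ℂ, 0 < G.im →
      G = C * ∑ k, (lam k : ℂ) / (-y + lam k * ((1 / (G - 1) + 1 / (G + 1)) / 2)) →
      C * ∑ k, lam k ^ 2 * ‖-y + lam k * ((1 / (G - 1) + 1 / (G + 1)) / 2)‖⁻¹ ^ 2 *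
        ((‖G - 1‖⁻¹ ^ 2 + ‖G + 1‖⁻¹ ^ 2) / 2) < 1 := by
    intro G hG hGeq
    set q := (‖G - 1‖⁻¹ ^ 2 + ‖G + 1‖⁻¹ ^ 2) / 2
    set D : Fin m → ℂ := fun k => -y + lam k * ((1 / (G - 1) + 1 / (G + 1)) / 2)
    have him : G.im = C * ∑ k, lam k * (y.im + lam k * (G.im * q)) * ‖D k‖⁻¹ ^ 2 := by
      conv_lhs => rw [hGeq]
      rw [Complex.im_ofReal_mul, Complex.im_sum]
      congr 1
      refine Finset.sum_congr rfl fun k _ => ?_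
      rw [div_eq_mul_inv, Complex.im_ofReal_mul, Complex.inv_im, hDim G hG k,
        Complex.normSq_eq_norm_sq, inv_pow]
      simp only [D, q]
      ring
    have hlt : C * ∑ k, lam k ^ 2 * ‖D k‖⁻¹ ^ 2 * q * G.im < G.im := by
      conv_rhs => rw [him]
      refine mul_lt_mul_of_pos_left (Finset.sum_lt_sum_of_nonempty ?_ fun k _ => ?_) hC
      · exact ⟨⟨0, hm⟩, Finset.mem_univ _⟩
      · have h1 : 0 < ‖D k‖⁻¹ ^ 2 := by
          have := norm_pos_iff.2 (hD G hG k)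
          positivity
        have h2 := mul_pos (mul_pos (hl k) hy) h1
        nlinarith
    rw [← Finset.sum_mul, ← mul_assoc] at hlt
    exact (mul_lt_iff_lt_one_left hG).1 hlt
  by_contra hne
  have hs₁ := hsmall G₁ hG₁ h₁
  have hs₂ := hsmall G₂ hG₂ h₂
  set q₁ := (‖G₁ - 1‖⁻¹ ^ 2 + ‖G₁ + 1‖⁻¹ ^ 2) / 2
  set q₂ := (‖G₂ - 1‖⁻¹ ^ 2 + ‖G₂ + 1‖⁻¹ ^ 2) / 2
  set D₁ : Fin m → ℂ := fun k => -y + lam k * ((1 / (G₁ - 1) + 1 / (G₁ + 1)) / 2)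
  set D₂ : Fin m → ℂ := fun k => -y + lam k * ((1 / (G₂ - 1) + 1 / (G₂ + 1)) / 2)
  set Q : ℂ := ((G₁ - 1)⁻¹ * (G₂ - 1)⁻¹ + (G₁ + 1)⁻¹ * (G₂ + 1)⁻¹) / 2
  -- Subtracting the two equations, the difference reproduces itself with a factor that must equal 1
  -- when the solutions differ.
  have hdiff : G₁ - G₂ = (C * ∑ k, (lam k : ℂ) ^ 2 * (D₁ k)⁻¹ * (D₂ k)⁻¹ * Q) * (G₁ - G₂) := by
    have e : G₁ - G₂ = C * ∑ k, ((lam k : ℂ) / D₁ k - (lam k : ℂ) / D₂ k) := by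
      rw [Finset.sum_sub_distrib, mul_sub, ← h₁, ← h₂]
    conv_lhs => rw [e]
    rw [mul_assoc, Finset.sum_mul]
    congr 1
    refine Finset.sum_congr rfl fun k _ => ?_
    have hd1 : D₁ k ≠ 0 := hD G₁ hG₁ k
    have hd2 : D₂ k ≠ 0 := hD G₂ hG₂ k
    have hsubD : D₂ k - D₁ k = lam k * (Q * (G₁ - G₂)) := by
      have a1 := hsub G₁ hG₁
      have a2 := hsub G₂ hG₂
      have a3 := hadd G₁ hG₁
      have a4 := hadd G₂ hG₂
      simp only [D₁, D₂, Q]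
      field_simp
      ring
    calc (lam k : ℂ) / D₁ k - (lam k : ℂ) / D₂ k = lam k * (D₂ k - D₁ k) * (D₁ k)⁻¹ * (D₂ k)⁻¹ := by
          field_simp
      _ = _ := by rw [hsubD]; ring
  have hone : C * ∑ k, (lam k : ℂ) ^ 2 * (D₁ k)⁻¹ * (D₂ k)⁻¹ * Q = 1 := by
    have := sub_ne_zero.2 hne
    exact (mul_eq_right₀ this).1 hdiff.symm
  -- By the inequality 2αβ ≤ α² + β², the factor is at most the mean of the two quantities already
  -- shown to be less than 1.
  have hbound : ‖(C : ℂ) * ∑ k, (lam k : ℂ) ^ 2 * (D₁ k)⁻¹ * (D₂ k)⁻¹ * Q‖ ≤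
      C * ∑ k, (lam k ^ 2 * ‖D₁ k‖⁻¹ ^ 2 * q₁ + lam k ^ 2 * ‖D₂ k‖⁻¹ ^ 2 * q₂) / 2 := by
    rw [norm_mul, Complex.norm_real, Real.norm_of_nonneg hC.le]
    refine mul_le_mul_of_nonneg_left ((norm_sum_le _ _).trans (Finset.sum_le_sum fun k _ => ?_))
      hC.le
    have hQ : ‖Q‖ ≤ (‖G₁ - 1‖⁻¹ * ‖G₂ - 1‖⁻¹ + ‖G₁ + 1‖⁻¹ * ‖G₂ + 1‖⁻¹) / 2 := by
      simp only [Q]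
      rw [norm_div, Complex.norm_ofNat]
      gcongr
      refine (norm_add_le _ _).trans (le_of_eq ?_)
      simp only [norm_mul, norm_inv]
    rw [norm_mul, norm_mul, norm_mul, norm_pow, Complex.norm_real, norm_inv, norm_inv,
      Real.norm_eq_abs, sq_abs]
    refine (mul_le_mul_of_nonneg_left hQ (by positivity)).trans ?_
    simp only [q₁, q₂]
    have e1 := mul_nonneg (sq_nonneg (lam k))
      (sq_nonneg (‖D₁ k‖⁻¹ * ‖G₁ - 1‖⁻¹ - ‖D₂ k‖⁻¹ * ‖G₂ - 1‖⁻¹))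
    have e2 := mul_nonneg (sq_nonneg (lam k))
      (sq_nonneg (‖D₁ k‖⁻¹ * ‖G₁ + 1‖⁻¹ - ‖D₂ k‖⁻¹ * ‖G₂ + 1‖⁻¹))
    nlinarith
  rw [hone, norm_one, ← Finset.sum_div, Finset.sum_add_distrib, ← mul_div_assoc, mul_add] at hbound
  linarith

theorem exists_sq_eq_of_im_pos {z : ℂ} (hz : 0 < z.im) :
    ∃ y : ℂ, y ^ 2 = z ∧ 0 < y.re ∧ 0 < y.im := by
  obtain ⟨y, hy⟩ := IsAlgClosed.exists_pow_nat_eq z (n := 2) two_pos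
  have him : z.im = 2 * (y.re * y.im) := by rw [← hy, sq, Complex.mul_im]; ring
  have hpos : 0 < y.re * y.im := by linarith
  rcases pos_and_pos_or_neg_and_neg_of_mul_pos hpos with h | h
  · exact ⟨y, hy, h⟩
  · exact ⟨-y, by rw [neg_sq, hy], by simpa using h.1, by simpa using h.2⟩

variable {m : ℕ} {R : Matrix (Fin m) (Fin m) ℂ} {c : ℝ}

/-- Set z = y² with y in the open first quadrant and G = cyt. Since G/(1 - G²) = -(1/(G - 1) + 1/(G
+ 1))/2, the equation takes the symmetrized form, whose coefficient maps the upper half-plane to the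
lower one and so admits the contraction argument. -/
theorem IsCanonicalSolution.unique (hR : R.IsHermitian) (hm : 0 < m)
    (hl : ∀ k, 0 < hR.eigenvalues k) (hc : 0 < c) {z t₁ t₂ : ℂ} (hz : 0 < z.im)
    (h₁ : IsCanonicalSolution R c z t₁) (h₂ : IsCanonicalSolution R c z t₂) : t₁ = t₂ := by
  obtain ⟨y, rfl, hyr, hyi⟩ := exists_sq_eq_of_im_pos hz
  have hy0 : y ≠ 0 := fun h => by simp [h] at hyi
  have hm0 : (m : ℂ) ≠ 0 := by exact_mod_cast hm.ne'
  have hc0 : (c : ℂ) ≠ 0 := by exact_mod_cast hc.ne'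
  have key : ∀ t, IsCanonicalSolution R c (y ^ 2) t → 0 < (c * y * t).im ∧
      c * y * t = ((c / m : ℝ) : ℂ) * ∑ k, (hR.eigenvalues k : ℂ) / (-y + hR.eigenvalues k *
        ((1 / (c * y * t - 1) + 1 / (c * y * t + 1)) / 2)) := by
    rintro t ⟨ht, hzt, heq⟩
    -- The sum |y|² Im t + Im(y²t) equals 2 Re y · Im(yt), so the two sign conditions on t combine
    -- into one on yt.
    have him : 0 < (y * t).im := by
      have e1 : 0 < Complex.normSq y * t.im := mul_pos (Complex.normSq_pos.2 hy0) ht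
      have e2 : Complex.normSq y * t.im = y.re * (y * t).im - y.im * (y * t).re := by
        simp only [Complex.normSq_apply, Complex.mul_im, Complex.mul_re]; ring
      have e3 : (y ^ 2 * t).im = y.re * (y * t).im + y.im * (y * t).re := by
        simp only [sq, Complex.mul_im, Complex.mul_re]; ring
      rw [e3] at hzt
      nlinarith
    have hG : 0 < (c * y * t).im := by
      rw [mul_assoc, Complex.im_ofReal_mul]; exact mul_pos hc him
    refine ⟨hG, ?_⟩
    set G := c * y * t with hGdef
    have a1 : G - 1 ≠ 0 := fun h => by
      have := congrArg Complex.im h; simp at this; linarith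
    have a2 : G + 1 ≠ 0 := fun h => by
      have := congrArg Complex.im h; simp at this; linarith
    have a3 : 1 - G ^ 2 ≠ 0 := by
      rw [show 1 - G ^ 2 = -((G - 1) * (G + 1)) by ring]
      exact neg_ne_zero.2 (mul_ne_zero a1 a2)
    have hP : ((1 / (G - 1) + 1 / (G + 1)) / 2).im < 0 := by
      have : ∀ X : ℂ, 0 < X.im → (1 / X).im < 0 := by
        intro X hX
        have hX0 : X ≠ 0 := fun h => by simp [h] at hX
        rw [one_div, Complex.inv_im]
        exact div_neg_of_neg_of_pos (by linarith) (Complex.normSq_pos.2 hX0)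
      rw [show (1 / (G - 1) + 1 / (G + 1)) / 2 = ((1 / 2 : ℝ) : ℂ) * (1 / (G - 1) + 1 / (G + 1)) by
        push_cast; ring, Complex.im_ofReal_mul, Complex.add_im]
      have b1 := this (G - 1) (by simpa using hG)
      have b2 := this (G + 1) (by simpa using hG)
      linarith
    set P := (1 / (G - 1) + 1 / (G + 1)) / 2 with hPdef
    have hcoef : y ^ 2 * c * t / (1 - y ^ 2 * (c : ℂ) ^ 2 * t ^ 2) = -(y * P) := by
      rw [show y ^ 2 * (c : ℂ) ^ 2 * t ^ 2 = G ^ 2 by rw [hGdef]; ring,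
        show y ^ 2 * c * t = y * G by rw [hGdef]; ring, hPdef, div_eq_iff a3]
      field_simp
      ring
    have hD : ∀ k, -y + hR.eigenvalues k * P ≠ 0 := by
      intro k h0
      have := congrArg Complex.im h0
      rw [Complex.add_im, Complex.neg_im, Complex.im_ofReal_mul, Complex.zero_im] at this
      have := mul_neg_of_pos_of_neg (hl k) hP
      linarith
    have hfac : ∀ k, -y ^ 2 + y * P * hR.eigenvalues k = y * (-y + hR.eigenvalues k * P) := by
      intro k; ring
    rw [hcoef, neg_smul, sub_neg_eq_add, ← neg_smul, hR.trace_mul_inv_affine (fun k => by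
      rw [hfac]; exact mul_ne_zero hy0 (hD k))] at heq
    calc G = c * y * t := hGdef
      _ = c * y * (1 / (m : ℂ) * ∑ k, (hR.eigenvalues k : ℂ) /
            (-y ^ 2 + y * P * hR.eigenvalues k)) := by rw [← heq]
      _ = _ := by
        push_cast
        rw [show (c : ℂ) * y * (1 / (m : ℂ) * ∑ k, (hR.eigenvalues k : ℂ) /
            (-y ^ 2 + y * P * hR.eigenvalues k)) = c / m * ∑ k, y * ((hR.eigenvalues k : ℂ) /
            (-y ^ 2 + y * P * hR.eigenvalues k)) by rw [← Finset.mul_sum]; ring]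
        congr 1
        refine Finset.sum_congr rfl fun k _ => ?_
        rw [hfac]
        have := hD k
        field_simp
  obtain ⟨hG₁, e₁⟩ := key t₁ h₁
  obtain ⟨hG₂, e₂⟩ := key t₂ h₂
  have := symmetrized_canonical_unique hm hl (div_pos hc (Nat.cast_pos.2 hm)) hyi hG₁ hG₂ e₁ e₂
  exact mul_left_cancel₀ (mul_ne_zero hc0 hy0) this

theorem tUpper_eq (hR : R.IsHermitian) (hm : 0 < m)
    (hl : ∀ k, 0 < hR.eigenvalues k) (hc : 0 < c) {z t : ℂ} (hz : 0 < z.im)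
    (h : IsCanonicalSolution R c z t) : tUpper R c z = t := by
  have hex : ∃ t, IsCanonicalSolution R c z t := ⟨t, h⟩
  rw [tUpper, dif_pos hex]
  exact hex.choose_spec.unique hR hm hl hc hz h

end Canonical

/-! ### Solving the canonical equation through `φ(w) = z` -/

section Resolvent

variable {m : ℕ}

/-- `g(w) = (c/m) ∑ λ w / (λ - w)`. -/
def resG (c : ℝ) (lam : Fin m → ℝ) (w : ℂ) : ℂ :=
  ((c / m : ℝ) : ℂ) * ∑ k, (lam k : ℂ) * w / (lam k - w)

/-- `φ(w) = g(w) (g(w) - w)`. -/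
def resPhi (c : ℝ) (lam : Fin m → ℝ) (w : ℂ) : ℂ := resG c lam w * (resG c lam w - w)

/-- `(c/m) ∑ λ² / |λ - w|²`. -/
def resA (c : ℝ) (lam : Fin m → ℝ) (w : ℂ) : ℝ :=
  c / m * ∑ k, lam k ^ 2 / ‖(lam k : ℂ) - w‖ ^ 2

variable {c : ℝ} {lam : Fin m → ℝ} {w : ℂ}

/-- In the upper half-plane the condition `resA < 1` thus means that g - w has negative imaginary
part. -/
theorem resG_im : (resG c lam w).im = resA c lam w * w.im := by
  rw [resG, resA, Complex.im_ofReal_mul, Complex.im_sum, mul_assoc, Finset.sum_mul]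
  congr 1
  refine Finset.sum_congr rfl fun k _ => ?_
  rw [Complex.div_im, ← Complex.normSq_eq_norm_sq]
  simp only [Complex.im_ofReal_mul, Complex.re_ofReal_mul, Complex.sub_re, Complex.ofReal_re,
    Complex.sub_im, Complex.ofReal_im]
  ring

/-- At a real point beyond the spectrum the bracket is φ', so near a point with φ' > 0 the function
φ preserves the sign of the imaginary part. -/
theorem resPhi_im : (resPhi c lam w).im = w.im *
    (resA c lam w * (resG c lam w - w).re - (1 - resA c lam w) * (resG c lam w).re) := by
  rw [resPhi, Complex.mul_im, Complex.sub_im, resG_im]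
  ring

theorem resG_conj : resG c lam (starRingEnd ℂ w) = starRingEnd ℂ (resG c lam w) := by
  simp [resG, map_sum]

theorem resPhi_conj : resPhi c lam (starRingEnd ℂ w) = starRingEnd ℂ (resPhi c lam w) := by
  simp [resPhi, resG_conj]

theorem analyticAt_resG (h : ∀ k, (lam k : ℂ) ≠ w) : AnalyticAt ℂ (resG c lam) w := by
  refine analyticAt_const.mul (Finset.analyticAt_fun_sum _ fun k _ => ?_)
  exact (analyticAt_const.mul analyticAt_id).div (analyticAt_const.sub analyticAt_id)
    (sub_ne_zero.2 (h k))

theorem analyticAt_resPhi (h : ∀ k, (lam k : ℂ) ≠ w) : AnalyticAt ℂ (resPhi c lam) w :=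
  (analyticAt_resG h).mul ((analyticAt_resG h).sub analyticAt_id)

theorem continuousAt_resA (h : ∀ k, (lam k : ℂ) ≠ w) : ContinuousAt (resA c lam) w := by
  refine continuousAt_const.mul (tendsto_finsetSum _ fun k _ => ?_)
  refine ContinuousAt.div continuousAt_const (by fun_prop) ?_
  exact pow_ne_zero _ (norm_ne_zero_iff.2 (sub_ne_zero.2 (h k)))

theorem im_ne_of_im_pos (hw : 0 < w.im) (k : Fin m) : (lam k : ℂ) ≠ w := by
  rintro h; rw [← h] at hw; simp at hw

variable {R : Matrix (Fin m) (Fin m) ℂ}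

/-- For this t the coefficient of R in the equation collapses to -z/w, so the trace is a multiple of
g and the equation becomes an identity. The signs follow from Im(g - w) < 0 and from zt = g/c. -/
theorem isCanonicalSolution_of_resPhi (hR : R.IsHermitian) (hm : 0 < m) (hc : 0 < c)
    (hl : ∀ k, 0 < hR.eigenvalues k) (hw : 0 < w.im)
    (hA : resA c hR.eigenvalues w < 1) (hz : 0 < (resPhi c hR.eigenvalues w).im) :
    IsCanonicalSolution R c (resPhi c hR.eigenvalues w)
      (1 / (c * (resG c hR.eigenvalues w - w))) := by
  set g := resG c hR.eigenvalues w with hg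
  have hm0 : (m : ℂ) ≠ 0 := by exact_mod_cast hm.ne'
  have hc0 : (c : ℂ) ≠ 0 := by exact_mod_cast hc.ne'
  have hw0 : w ≠ 0 := fun h => by simp [h] at hw
  have hAp : 0 < resA c hR.eigenvalues w := by
    refine mul_pos (div_pos hc (Nat.cast_pos.2 hm)) (Finset.sum_pos (fun k _ => ?_)
      ⟨⟨0, hm⟩, Finset.mem_univ _⟩)
    exact div_pos (pow_pos (hl k) 2)
      (pow_pos (norm_pos_iff.2 (sub_ne_zero.2 (im_ne_of_im_pos hw k))) 2)
  have hgi : 0 < g.im := by rw [hg, resG_im]; exact mul_pos hAp hw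
  have hhi : (g - w).im < 0 := by
    rw [Complex.sub_im, hg, resG_im]; nlinarith
  have hh0 : g - w ≠ 0 := fun h => by simp [h] at hhi
  have hphi : resPhi c hR.eigenvalues w = g * (g - w) := rfl
  have hphi0 : g * (g - w) ≠ 0 := by
    rw [← hphi]; exact fun h => by simp [h] at hz
  rw [hphi]
  refine ⟨?_, ?_, ?_⟩
  · have hX : (c * (g - w)).im < 0 := by
      rw [Complex.im_ofReal_mul]; exact mul_neg_of_pos_of_neg hc hhi
    have hX0 : c * (g - w) ≠ 0 := mul_ne_zero hc0 hh0
    rw [one_div, Complex.inv_im]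
    exact div_pos (by linarith) (Complex.normSq_pos.2 hX0)
  · rw [show g * (g - w) * (1 / (c * (g - w))) = ((c⁻¹ : ℝ) : ℂ) * g by
      push_cast; field_simp, Complex.im_ofReal_mul]
    exact mul_pos (inv_pos.2 hc) hgi
  · have hcoef : g * (g - w) * c * (1 / (c * (g - w))) /
        (1 - g * (g - w) * (c : ℂ) ^ 2 * (1 / (c * (g - w))) ^ 2) = -(g * (g - w) / w) := by
      have : 1 - g * (g - w) * (c : ℂ) ^ 2 * (1 / (c * (g - w))) ^ 2 = -w / (g - w) := by
        field_simp; ring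
      rw [this]
      field_simp
    have hlw : ∀ k, (hR.eigenvalues k : ℂ) - w ≠ 0 := fun k =>
      sub_ne_zero.2 (im_ne_of_im_pos hw k)
    have hfac : ∀ k, -(g * (g - w)) + g * (g - w) / w * hR.eigenvalues k =
        g * (g - w) * (hR.eigenvalues k - w) / w := by
      intro k; field_simp; ring
    rw [hcoef, neg_smul, sub_neg_eq_add, ← neg_smul, hR.trace_mul_inv_affine (fun k => by
      rw [hfac]; exact div_ne_zero (mul_ne_zero hphi0 (hlw k)) hw0)]
    have hsum : ∑ k, (hR.eigenvalues k : ℂ) / (-(g * (g - w)) + g * (g - w) / w * hR.eigenvalues k)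
        = (g * (g - w))⁻¹ * (m / c * g) := by
      have hgs : (m : ℂ) / c * g = ∑ k, (hR.eigenvalues k : ℂ) * w / (hR.eigenvalues k - w) := by
        rw [hg, resG, ← mul_assoc]
        push_cast
        rw [show (m : ℂ) / c * (c / m) = 1 by field_simp, one_mul]
      rw [hgs, Finset.mul_sum]
      refine Finset.sum_congr rfl fun k _ => ?_
      rw [hfac]
      have := hlw k
      have hg0 : g ≠ 0 := left_ne_zero_of_mul hphi0
      field_simp
    rw [hsum]
    have hg0 : g ≠ 0 := left_ne_zero_of_mul hphi0
    field_simp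

/-- Boundary values of `t_N` at the points `x = φ(w₀)` where `φ` is open. -/
theorem tendsto_tUpper (hR : R.IsHermitian) (hm : 0 < m) (hc : 0 < c)
    (hl : ∀ k, 0 < hR.eigenvalues k) {w₀ : ℂ} (hne : ∀ k, (hR.eigenvalues k : ℂ) ≠ w₀)
    (hA : resA c hR.eigenvalues w₀ < 1)
    (hopen : 𝓝 (resPhi c hR.eigenvalues w₀) ≤ map (resPhi c hR.eigenvalues) (𝓝 w₀))
    (hsign : ∀ᶠ w in 𝓝 w₀, 0 < (resPhi c hR.eigenvalues w).im → 0 < w.im)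
    (hh : resG c hR.eigenvalues w₀ - w₀ ≠ 0) :
    Tendsto (tUpper R c) (𝓝[{z : ℂ | 0 < z.im}] (resPhi c hR.eigenvalues w₀))
      (𝓝 (1 / (c * (resG c hR.eigenvalues w₀ - w₀)))) := by
  have hc0 : (c : ℂ) ≠ 0 := by exact_mod_cast hc.ne'
  have hcont : ContinuousAt (fun w => 1 / (c * (resG c hR.eigenvalues w - w))) w₀ :=
    continuousAt_const.div (continuousAt_const.mul
      ((analyticAt_resG hne).continuousAt.sub continuousAt_id)) (mul_ne_zero hc0 hh)
  intro V hV
  have h1 : ∀ᶠ w in 𝓝 w₀, 1 / (c * (resG c hR.eigenvalues w - w)) ∈ V := hcont.tendsto hV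
  have h2 : ∀ᶠ w in 𝓝 w₀, resA c hR.eigenvalues w < 1 :=
    (continuousAt_resA hne).tendsto.eventually (Iio_mem_nhds hA)
  -- Openness makes every z near φ(w₀) an image of some w near w₀; `hsign` puts w in the upper
  -- half-plane when z is there, and uniqueness identifies t(z).
  have h3 := hopen (image_mem_map (h1.and (h2.and hsign)))
  rw [mem_map, mem_nhdsWithin_iff_eventually]
  filter_upwards [h3] with z hz hzi
  obtain ⟨w, ⟨hw1, hw2, hw3⟩, rfl⟩ := hz
  have hzi' : 0 < (resPhi c hR.eigenvalues w).im := hzi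
  rw [mem_preimage, tUpper_eq hR hm hl hc hzi'
    (isCanonicalSolution_of_resPhi hR hm hc hl (hw3 hzi') hw2 hzi')]
  exact hw1

/-- Without nontriviality of this filter, the boundary value defined by `limUnder` could not be
identified with a computed limit. -/
instance nhdsWithin_upperHalfPlane_neBot (x : ℝ) : (𝓝[{z : ℂ | 0 < z.im}] (x : ℂ)).NeBot := by
  rw [← mem_closure_iff_nhdsWithin_neBot, Complex.closure_setOfPred_lt_im]
  simp

end Resolvent

/-! ### The edge of `μ_N` and the values of `t_N` beyond it -/

section FiniteEdge

variable {m : ℕ}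

/-- The law `(1/m) ∑ₖ δ_{λₖ}`. -/
def empLaw (lam : Fin m → ℝ) : Measure ℝ := (m : ENNReal)⁻¹ • ∑ k, Measure.dirac (lam k)

theorem integral_empLaw (lam : Fin m → ℝ) (F : ℝ → ℝ) :
    ∫ s, F s ∂(empLaw lam) = 1 / (m : ℝ) * ∑ k, F (lam k) := by
  rw [empLaw, integral_smul_measure,
    integral_finsetSum_measure fun k _ => integrable_dirac (by simp)]
  simp

theorem isSpectralLaw_empLaw (hm : 0 < m) {lam : Fin m → ℝ} {a b : ℝ} (ha : 0 < a)
    (hlam : ∀ k, lam k ∈ Icc a b) : IsSpectralLaw (empLaw lam) a b where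
  prob := ⟨by
    have : (m : ENNReal) ≠ 0 := by exact_mod_cast hm.ne'
    simp [empLaw, ENNReal.inv_mul_cancel this (ENNReal.natCast_ne_top m)]⟩
  pos := ha
  mem := by
    rw [ae_iff, empLaw]
    simp only [Measure.smul_apply, Measure.coe_finsetSum, Finset.sum_apply, smul_eq_mul]
    refine mul_eq_zero.2 (Or.inr (Finset.sum_eq_zero fun k _ => ?_))
    change Measure.dirac (lam k) (Icc a b)ᶜ = 0
    rw [Measure.dirac_apply' _ measurableSet_Icc.compl]
    simpa using hlam k

/-- The atom of the law at its top point b makes one term of the sum blow up as w decreases to b. -/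
theorem exists_lt_edgeK_empLaw (hm : 0 < m) {c : ℝ} (hc : 0 < c) {lam : Fin m → ℝ} {b : ℝ}
    (hlam : ∀ k, 0 < lam k ∧ lam k ≤ b) {k₀ : Fin m} (hk₀ : lam k₀ = b) (B : ℝ) :
    ∃ w, b < w ∧ B < edgeK c (empLaw lam) w := by
  have hm' : (0 : ℝ) < m := Nat.cast_pos.2 hm
  have hb : 0 < b := hk₀ ▸ (hlam k₀).1
  have hB : 0 < |B| + 1 := by positivity
  -- The offset ε solves (c/m) b²/ε = |B| + 1.
  refine ⟨b + c / m * b ^ 2 / (|B| + 1),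
    by linarith [show 0 < c / m * b ^ 2 / (|B| + 1) by positivity], ?_⟩
  set ε := c / m * b ^ 2 / (|B| + 1) with hε
  have hε0 : 0 < ε := by positivity
  rw [edgeK, integral_empLaw, ← mul_assoc, mul_one_div]
  have h1 : lam k₀ * (b + ε) / (b + ε - lam k₀) ≤ ∑ k, lam k * (b + ε) / (b + ε - lam k) := by
    refine Finset.single_le_sum (f := fun k => lam k * (b + ε) / (b + ε - lam k)) (fun k _ => ?_)
      (Finset.mem_univ k₀)
    exact div_nonneg (mul_nonneg (hlam k).1.le (by linarith)) (by linarith [(hlam k).2])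
  rw [hk₀, add_sub_cancel_left] at h1
  refine lt_of_lt_of_le ?_ (mul_le_mul_of_nonneg_left h1 (by positivity))
  have h2 : |B| + 1 = c / m * (b * b / ε) := by
    rw [hε]; field_simp
  calc B < |B| + 1 := by linarith [le_abs_self B]
    _ = c / m * (b * b / ε) := h2
    _ ≤ _ := by gcongr; linarith

/-- The sign convention changes between the complex and the real notation: g = -k, so g(g - w) = k(w
+ k). -/
theorem resG_ofReal (c : ℝ) (lam : Fin m → ℝ) (w : ℝ) :
    resG c lam (w : ℂ) = -(edgeK c (empLaw lam) w : ℂ) := by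
  rw [resG, edgeK, integral_empLaw, ← mul_assoc, mul_one_div]
  push_cast
  rw [← mul_neg, ← Finset.sum_neg_distrib]
  congr 1
  refine Finset.sum_congr rfl fun k _ => ?_
  rw [← div_neg, neg_sub]

theorem resA_ofReal (c : ℝ) (lam : Fin m → ℝ) (w : ℝ) :
    resA c lam (w : ℂ) = edgeA c (empLaw lam) w := by
  rw [resA, edgeA, integral_empLaw, ← mul_assoc, mul_one_div]
  congr 1
  refine Finset.sum_congr rfl fun k _ => ?_
  rw [← Complex.ofReal_sub, Complex.norm_real, Real.norm_eq_abs, sq_abs, ← neg_sub w, neg_sq]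

theorem resPhi_ofReal (c : ℝ) (lam : Fin m → ℝ) (w : ℝ) :
    resPhi c lam (w : ℂ) = (edgePhi c (empLaw lam) w : ℂ) := by
  rw [resPhi, resG_ofReal, edgePhi]
  push_cast
  ring

variable {R : Matrix (Fin m) (Fin m) ℂ} {a b c wp : ℝ}

theorem deriv_resPhi_re {lam : Fin m → ℝ} (h : IsSpectralLaw (empLaw lam) a b)
    (hlam : ∀ k, lam k ≤ b) {w : ℝ} (hw : b < w) :
    (deriv (resPhi c lam) (w : ℂ)).re = edgePhi' c (empLaw lam) w := by
  have hne : ∀ k, (lam k : ℂ) ≠ (w : ℂ) := fun k => by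
    have := hlam k
    exact_mod_cast (this.trans_lt hw).ne
  have h1 := (analyticAt_resPhi (c := c) hne).differentiableAt.hasDerivAt.real_of_complex
  simp only [resPhi_ofReal, Complex.ofReal_re] at h1
  exact h1.unique (h.hasDerivAt_edgePhi hw)

/-- The data of a Hermitian noise covariance together with its edge parameter. -/
structure HasEdge (hR : R.IsHermitian) (a b c wp : ℝ) : Prop where
  size_pos : 0 < m
  a_pos : 0 < a
  c_pos : 0 < c
  mem : ∀ k, hR.eigenvalues k ∈ Icc a b
  lt : b < wp
  zero : edgePhi' c (empLaw hR.eigenvalues) wp = 0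

namespace HasEdge

variable {hR : R.IsHermitian}

theorem law (h : HasEdge hR a b c wp) : IsSpectralLaw (empLaw hR.eigenvalues) a b :=
  isSpectralLaw_empLaw h.size_pos h.a_pos h.mem

theorem eig_pos (h : HasEdge hR a b c wp) (k : Fin m) : 0 < hR.eigenvalues k :=
  h.a_pos.trans_le (h.mem k).1

theorem eig_ne (h : HasEdge hR a b c wp) {w : ℂ} (hw : b < w.re) (k : Fin m) :
    (hR.eigenvalues k : ℂ) ≠ w := by
  rintro hk
  have := (h.mem k).2
  rw [← hk] at hw
  simp at hw
  linarith

/-- At the preimage w > wp of x the derivative φ' is positive, which supplies all that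
`tendsto_tUpper` asks for: local openness, the bound on A, and preservation of the upper half-plane.
-/
theorem tReal_eq (h : HasEdge hR a b c wp) {x : ℝ}
    (hx : edgePhi c (empLaw hR.eigenvalues) wp < x) :
    tReal R c x = -(1 / (c * (edgeInv c (empLaw hR.eigenvalues) wp x +
      edgeK c (empLaw hR.eigenvalues) (edgeInv c (empLaw hR.eigenvalues) wp x))) : ℝ) := by
  set ω := empLaw hR.eigenvalues
  set w := edgeInv c ω wp x
  have hwp : wp < w := h.law.lt_edgeInv h.c_pos h.lt h.zero le_rfl hx
  have hb : b < w := h.lt.trans hwp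
  have hwx : edgePhi c ω w = x := (h.law.edgeInv_spec h.c_pos h.lt hx.le).2
  have hd := h.law.edgePhi'_pos h.c_pos h.lt h.zero hwp
  have hK := h.law.edgeK_pos h.c_pos hb
  have hw0 := h.law.b_pos.trans hb
  have hne := h.eig_ne (w := (w : ℂ)) (by simpa using hb)
  have han := analyticAt_resPhi (c := c) hne
  have hlim := tendsto_tUpper hR h.size_pos h.c_pos h.eig_pos hne
    (by rw [resA_ofReal]; exact h.law.edgeA_lt_one h.c_pos hb hd.le)
    (by
      have hd0 : deriv (resPhi c hR.eigenvalues) (w : ℂ) ≠ 0 := fun h0 => by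
        have := deriv_resPhi_re (c := c) h.law (fun k => (h.mem k).2) hb
        rw [h0, Complex.zero_re] at this
        linarith
      exact (han.hasStrictDerivAt.map_nhds_eq hd0).ge)
    (by
      have hcont : ContinuousAt (fun z => resA c hR.eigenvalues z *
          (resG c hR.eigenvalues z - z).re -
          (1 - resA c hR.eigenvalues z) * (resG c hR.eigenvalues z).re) (w : ℂ) := by
        have hA := continuousAt_resA (c := c) hne
        have hG := (analyticAt_resG (c := c) hne).continuousAt
        exact (hA.mul (Complex.continuous_re.continuousAt.comp (hG.sub continuousAt_id))).sub
          ((continuousAt_const.sub hA).mul (Complex.continuous_re.continuousAt.comp hG))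
      have hpos : 0 < resA c hR.eigenvalues (w : ℂ) * (resG c hR.eigenvalues (w : ℂ) - w).re -
          (1 - resA c hR.eigenvalues (w : ℂ)) * (resG c hR.eigenvalues (w : ℂ)).re := by
        rw [resA_ofReal, resG_ofReal]
        simp only [Complex.sub_re, Complex.neg_re, Complex.ofReal_re]
        rw [edgePhi'] at hd
        linarith
      filter_upwards [hcont.tendsto.eventually (Ioi_mem_nhds hpos)] with z hz him
      rw [resPhi_im] at him
      exact (pos_iff_pos_of_mul_pos him).2 hz)
    (by
      rw [resG_ofReal]
      have : -(edgeK c ω w) - w ≠ 0 := by linarith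
      exact_mod_cast this)
  rw [resPhi_ofReal, hwx] at hlim
  rw [tReal, hlim.limUnder_eq, resG_ofReal]
  push_cast
  rw [← neg_add', add_comm, mul_neg, one_div_neg_eq_neg_one_div]

/-- Points of the upper half-plane near `wp` mapped by `φ` to a point slightly below the edge. -/
theorem eventually_exists_resPhi_eq (h : HasEdge hR a b c wp) :
    ∀ᶠ x : ℝ in 𝓝 (edgePhi c (empLaw hR.eigenvalues) wp),
      x < edgePhi c (empLaw hR.eigenvalues) wp →
      ∃ w : ℂ, 0 < w.im ∧ resA c hR.eigenvalues w < 1 ∧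
        deriv (resPhi c hR.eigenvalues) w ≠ 0 ∧ resPhi c hR.eigenvalues w = x := by
  set ω := empLaw hR.eigenvalues
  set φ := resPhi c hR.eigenvalues
  have hne := h.eig_ne (w := (wp : ℂ)) (by simpa using h.lt)
  have han : AnalyticAt ℂ φ wp := analyticAt_resPhi hne
  -- The derivative is positive on the real axis to the right of wp, so it is not identically zero
  -- near wp and its zeros are isolated.
  have hder : ∀ᶠ w : ℂ in 𝓝 (wp : ℂ), w ≠ (wp : ℂ) → deriv φ w ≠ 0 := by
    rcases han.deriv.eventually_eq_zero_or_eventually_ne_zero with h0 | h0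
    · exfalso
      have h1 : ∀ᶠ w : ℝ in 𝓝 wp, deriv φ (w : ℂ) = 0 :=
        (Complex.continuous_ofReal.tendsto wp).eventually h0
      have h2 : ∀ᶠ w : ℝ in 𝓝[>] wp, deriv φ (w : ℂ) = 0 := h1.filter_mono nhdsWithin_le_nhds
      obtain ⟨w, hw0, hw⟩ := (h2.and self_mem_nhdsWithin).exists
      have hw' : wp < w := hw
      have := deriv_resPhi_re (c := c) h.law (fun k => (h.mem k).2) (h.lt.trans hw')
      have h3 := h.law.edgePhi'_pos h.c_pos h.lt h.zero hw'
      rw [hw0, Complex.zero_re] at this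
      linarith
    · exact eventually_nhdsWithin_iff.1 h0
  -- Since wp is critical, the open mapping theorem replaces the inverse function theorem here.
  have hopen : 𝓝 (φ (wp : ℂ)) ≤ map φ (𝓝 (wp : ℂ)) := by
    rcases han.eventually_constant_or_nhds_le_map_nhds with h0 | h0
    · exfalso
      have h1 : ∀ᶠ w : ℝ in 𝓝 wp, φ (w : ℂ) = φ wp :=
        (Complex.continuous_ofReal.tendsto wp).eventually h0
      have h2 : ∀ᶠ w : ℝ in 𝓝[>] wp, φ (w : ℂ) = φ wp := h1.filter_mono nhdsWithin_le_nhds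
      obtain ⟨w, hw0, hw⟩ := (h2.and self_mem_nhdsWithin).exists
      have hw' : wp < w := hw
      have h3 := h.law.edgePhi_lt_of_ne h.c_pos h.lt h.zero (h.lt.trans hw') hw'.ne'
      simp only [φ, resPhi_ofReal] at hw0
      have : edgePhi c ω w = edgePhi c ω wp := by exact_mod_cast hw0
      linarith
    · exact h0
  have hA : ∀ᶠ w in 𝓝 (wp : ℂ), resA c hR.eigenvalues w < 1 := by
    refine (continuousAt_resA hne).tendsto.eventually (Iio_mem_nhds ?_)
    rw [resA_ofReal]
    exact h.law.edgeA_lt_one h.c_pos h.lt h.zero.ge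
  have hre : ∀ᶠ w in 𝓝 (wp : ℂ), b < w.re :=
    Complex.continuous_re.continuousAt.tendsto.eventually (Ioi_mem_nhds (by simpa using h.lt))
  have hP := hder.and (hA.and hre)
  -- The preimage may fall in the lower half-plane; imposing the conditions at its conjugate as well
  -- allows reflection, because x is real.
  have hconj : Tendsto (starRingEnd ℂ) (𝓝 (wp : ℂ)) (𝓝 (wp : ℂ)) := by
    have := Complex.continuous_conj.tendsto (wp : ℂ)
    rwa [Complex.conj_ofReal] at this
  have himg := hopen (image_mem_map (hP.and (hconj.eventually hP)))
  rw [show φ (wp : ℂ) = (edgePhi c ω wp : ℂ) from resPhi_ofReal _ _ _] at himg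
  filter_upwards [(Complex.continuous_ofReal.tendsto _).eventually himg] with x hx hlt
  obtain ⟨w, ⟨⟨hd, hA, hre⟩, ⟨hd', hA', hre'⟩⟩, hwx⟩ := hx
  -- On real points beyond b, φ is at least its value at wp, so a value below the edge has no real
  -- preimage there.
  have him : w.im ≠ 0 := by
    intro him
    have hwre : w = (w.re : ℂ) := Complex.ext rfl (by simpa using him)
    rw [hwre, show φ (w.re : ℂ) = (edgePhi c ω w.re : ℂ) from resPhi_ofReal _ _ _] at hwx
    have hwx' : edgePhi c ω w.re = x := by exact_mod_cast hwx
    rcases eq_or_ne w.re wp with h1 | h1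
    · rw [h1] at hwx'; linarith
    · have := h.law.edgePhi_lt_of_ne h.c_pos h.lt h.zero hre h1
      linarith
  rcases lt_or_gt_of_ne him with hneg | hpos
  · refine ⟨starRingEnd ℂ w, by simpa using hneg, hA', hd' ?_, ?_⟩
    · intro h0
      have := congrArg Complex.im h0
      simp at this
      exact him this
    · rw [show φ (starRingEnd ℂ w) = starRingEnd ℂ (φ w) from resPhi_conj, hwx,
        Complex.conj_ofReal]
  · refine ⟨w, hpos, hA, hd ?_, hwx⟩
    rintro rfl
    simp at him

/-- φ is a local homeomorphism at w, so real points near x also have upper half-plane preimages near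
w, where 1/(c(g - w)) is continuous with positive imaginary part. The uniform δ makes the density
integrate to a positive mass. -/
theorem tReal_im_pos (h : HasEdge hR a b c wp) {w : ℂ} (him : 0 < w.im)
    (hA : resA c hR.eigenvalues w < 1) (hd : deriv (resPhi c hR.eigenvalues) w ≠ 0) {x : ℝ}
    (hx : resPhi c hR.eigenvalues w = x) :
    ∃ δ > 0, ∀ᶠ x' in 𝓝 x, δ < (tReal R c x').im := by
  have hne : ∀ {z : ℂ}, 0 < z.im → ∀ k, (hR.eigenvalues k : ℂ) ≠ z := fun hz k =>
    im_ne_of_im_pos hz k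
  have han := analyticAt_resPhi (c := c) (hne him)
  have hh : ∀ {z : ℂ}, 0 < z.im → resA c hR.eigenvalues z < 1 →
      (resG c hR.eigenvalues z - z).im < 0 := by
    intro z hz hAz
    rw [Complex.sub_im, resG_im]; nlinarith
  have hh0 : ∀ {z : ℂ}, 0 < z.im → resA c hR.eigenvalues z < 1 →
      resG c hR.eigenvalues z - z ≠ 0 := by
    intro z hz hAz h0
    have := hh hz hAz
    rw [h0] at this
    simp at this
  have hval : ∀ {z : ℂ} {x' : ℝ}, 0 < z.im → resA c hR.eigenvalues z < 1 →
      deriv (resPhi c hR.eigenvalues) z ≠ 0 → resPhi c hR.eigenvalues z = x' →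
      tReal R c x' = 1 / (c * (resG c hR.eigenvalues z - z)) := by
    intro z x' hz hAz hdz hzx
    have hlim := tendsto_tUpper hR h.size_pos h.c_pos h.eig_pos (hne hz) hAz
      ((analyticAt_resPhi (c := c) (hne hz)).hasStrictDerivAt.map_nhds_eq hdz).ge
      (by
        filter_upwards [Complex.continuous_im.continuousAt.tendsto.eventually
          (Ioi_mem_nhds hz)] with z' hz' _
        exact hz') (hh0 hz hAz)
    rw [hzx] at hlim
    rw [tReal, hlim.limUnder_eq]
  set τ : ℂ → ℂ := fun z => 1 / (c * (resG c hR.eigenvalues z - z))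
  have hc0 : (c : ℂ) ≠ 0 := by exact_mod_cast h.c_pos.ne'
  have hτ : ContinuousAt τ w := continuousAt_const.div (continuousAt_const.mul
    ((analyticAt_resG (hne him)).continuousAt.sub continuousAt_id))
      (mul_ne_zero hc0 (hh0 him hA))
  have hτpos : 0 < (τ w).im := by
    have hX : (c * (resG c hR.eigenvalues w - w)).im < 0 := by
      rw [Complex.im_ofReal_mul]; exact mul_neg_of_pos_of_neg h.c_pos (hh him hA)
    simp only [τ]
    rw [one_div, Complex.inv_im]
    exact div_pos (by linarith) (Complex.normSq_pos.2 (mul_ne_zero hc0 (hh0 him hA)))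
  refine ⟨(τ w).im / 2, by linarith, ?_⟩
  have e1 : ∀ᶠ z in 𝓝 w, (τ w).im / 2 < (τ z).im :=
    (Complex.continuous_im.continuousAt.comp hτ).tendsto.eventually
      (Ioi_mem_nhds (by simp only [Function.comp]; linarith))
  have e2 : ∀ᶠ z in 𝓝 w, 0 < z.im :=
    Complex.continuous_im.continuousAt.tendsto.eventually (Ioi_mem_nhds him)
  have e3 : ∀ᶠ z in 𝓝 w, resA c hR.eigenvalues z < 1 :=
    (continuousAt_resA (hne him)).tendsto.eventually (Iio_mem_nhds hA)
  have e4 : ∀ᶠ z in 𝓝 w, deriv (resPhi c hR.eigenvalues) z ≠ 0 :=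
    han.deriv.continuousAt.eventually_ne hd
  have himg := (han.hasStrictDerivAt.map_nhds_eq hd).ge
    (image_mem_map (e1.and (e2.and (e3.and e4))))
  rw [hx] at himg
  filter_upwards [(Complex.continuous_ofReal.tendsto x).eventually himg] with x' hx'
  obtain ⟨z, ⟨h1, h2, h3, h4⟩, hz⟩ := hx'
  rw [hval h2 h3 h4 hz]
  exact h1

/-- Every neighbourhood of φ(wp) contains an interval slightly to its left on which the density is
bounded below; to its right t is real and the density vanishes. -/
theorem xPlus_eq (h : HasEdge hR a b c wp) :
    xPlus R c = edgePhi c (empLaw hR.eigenvalues) wp := by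
  set x₀ := edgePhi c (empLaw hR.eigenvalues) wp
  have hx0 : 0 < x₀ := h.law.edgePhi_pos h.c_pos h.lt
  refine IsGreatest.csSup_eq ⟨?_, ?_⟩
  · rw [Measure.mem_support_iff_forall]
    intro U hU
    obtain ⟨l, u, hlu, hsub⟩ := mem_nhds_iff_exists_Ioo_subset.1
      (inter_mem (inter_mem hU (Ioi_mem_nhds hx0)) h.eventually_exists_resPhi_eq)
    set x := (max l 0 + x₀) / 2
    have hlx : max l 0 < x₀ := max_lt hlu.1 hx0
    have hxl : l < x := by have := le_max_left l 0; simp only [x]; linarith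
    have hxx : x < x₀ := by simp only [x]; linarith
    have hxI : x ∈ Ioo l u := ⟨hxl, hxx.trans hlu.2⟩
    obtain ⟨w, h1, h2, h3, h4⟩ := (hsub hxI).2 hxx
    obtain ⟨δ, hδ, hev⟩ := h.tReal_im_pos h1 h2 h3 h4
    obtain ⟨l', u', hlu', hsub'⟩ := mem_nhds_iff_exists_Ioo_subset.1
      (inter_mem hev (Ioo_mem_nhds hxI.1 hxI.2))
    have hIU : Ioo l' u' ⊆ U := fun y hy => (hsub (hsub' hy).2).1.1
    have hI0 : Ioo l' u' ⊆ Ioi 0 := fun y hy => (hsub (hsub' hy).2).1.2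
    refine lt_of_lt_of_le ?_ (measure_mono hIU)
    rw [muMeasure, withDensity_apply _ measurableSet_Ioo,
      Measure.restrict_restrict measurableSet_Ioo,
      inter_eq_left.2 hI0]
    refine lt_of_lt_of_le ?_ (setLIntegral_mono' measurableSet_Ioo
      (f := fun _ => ENNReal.ofReal (Real.pi⁻¹ * δ)) fun y hy => ENNReal.ofReal_le_ofReal ?_)
    · rw [setLIntegral_const, Real.volume_Ioo]
      refine ENNReal.mul_pos (by simpa using mul_pos (inv_pos.2 Real.pi_pos) hδ) ?_
      simpa using hlu'.1.trans hlu'.2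
    · exact mul_le_mul_of_nonneg_left (le_of_lt (hsub' hy).1) (inv_pos.2 Real.pi_pos).le
  · intro x hx
    by_contra! hlt
    refine Measure.notMem_support_iff_exists.2 ⟨Ioi x₀, Ioi_mem_nhds hlt, ?_⟩ hx
    rw [muMeasure, withDensity_apply _ measurableSet_Ioi]
    rw [setLIntegral_congr_fun (g := fun _ => 0) measurableSet_Ioi fun y hy => ?_]
    · simp
    · simp only
      rw [h.tReal_eq hy, ← Complex.ofReal_neg, Complex.ofReal_im, mul_zero, ENNReal.ofReal_zero]

end HasEdge

end FiniteEdge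

/-! ### Weak convergence of discrete laws with converging upper edge -/

section Weak

/-- The discrete measures `∑ₖ pₖ δ_{λₖ}` converge weakly to `μ`, with `λₖ ∈ [a, b_N]` and
`b_N → b`. -/
structure WeakApprox (M : ℕ → ℕ) (p lam : (N : ℕ) → Fin (M N) → ℝ) (μ : Measure ℝ) (a : ℝ)
    (bN : ℕ → ℝ) (b : ℝ) : Prop where
  finite : IsFiniteMeasure μ
  nonneg : ∀ N k, 0 ≤ p N k
  lim : ∀ f : ℝ →ᵇ ℝ, Tendsto (fun N => ∑ k, p N k * f (lam N k)) atTop (𝓝 (∫ s, f s ∂μ))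
  mem : ∀ᶠ N in atTop, ∀ k, lam N k ∈ Icc a (bN N)
  tendsto_b : Tendsto bN atTop (𝓝 b)

variable {M : ℕ → ℕ} {p lam : (N : ℕ) → Fin (M N) → ℝ} {μ : Measure ℝ} {a b : ℝ} {bN : ℕ → ℝ}

namespace WeakApprox

theorem tendsto_mass (h : WeakApprox M p lam μ a bN b) :
    Tendsto (fun N => ∑ k, p N k) atTop (𝓝 (μ.real univ)) := by
  have := h.lim (BoundedContinuousFunction.const ℝ 1)
  simpa using this

/-- The total masses converge, hence stay bounded, and the atoms see values of f tending uniformly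
to zero. -/
theorem integral_eq_zero (h : WeakApprox M p lam μ a bN b) (f : ℝ →ᵇ ℝ) {ε : ℕ → ℝ}
    (hε : Tendsto ε atTop (𝓝 0)) (hf : ∀ᶠ N in atTop, ∀ k, |f (lam N k)| ≤ ε N) :
    ∫ s, f s ∂μ = 0 := by
  refine tendsto_nhds_unique (h.lim f) ?_
  have h1 : Tendsto (fun N => (∑ k, p N k) * ε N) atTop (𝓝 0) := by
    simpa using h.tendsto_mass.mul hε
  refine squeeze_zero_norm' ?_ h1
  filter_upwards [hf] with N hN
  rw [Finset.sum_mul]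
  refine (norm_sum_le _ _).trans (Finset.sum_le_sum fun k _ => ?_)
  rw [norm_mul, Real.norm_of_nonneg (h.nonneg N k)]
  exact mul_le_mul_of_nonneg_left (hN k) (h.nonneg N k)

theorem ae_mem (h : WeakApprox M p lam μ a bN b) : ∀ᵐ s ∂μ, s ∈ Icc a b := by
  have := h.finite
  have key : ∀ g : ℝ → ℝ, Continuous g → ∀ ε : ℕ → ℝ, Tendsto ε atTop (𝓝 0) →
      (∀ᶠ N in atTop, ∀ k, max 0 (g (lam N k)) ≤ ε N) → ∀ᵐ s ∂μ, g s ≤ 0 := by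
    intro g hg ε hε hgε
    -- The truncated positive part is a bounded continuous test function that vanishes exactly where
    -- g ≤ 0; it is applied with g = s - b and g = a - s.
    have hcont : Continuous fun s => min 1 (max 0 (g s)) := by fun_prop
    have hbd : ∀ s, 0 ≤ min 1 (max 0 (g s)) ∧ min 1 (max 0 (g s)) ≤ 1 := fun s =>
      ⟨le_min zero_le_one (le_max_left _ _), min_le_left _ _⟩
    set f : ℝ →ᵇ ℝ := BoundedContinuousFunction.ofNormedAddCommGroup
      (fun s => min 1 (max 0 (g s))) hcont 1 fun s => by
        rw [Real.norm_of_nonneg (hbd s).1]; exact (hbd s).2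
    have h0 := h.integral_eq_zero f hε (by
      filter_upwards [hgε] with N hN k
      change |min 1 (max 0 (g (lam N k)))| ≤ _
      rw [abs_of_nonneg (hbd _).1]
      exact (min_le_right _ _).trans (hN k))
    have h1 := (integral_eq_zero_iff_of_nonneg (fun s => (hbd s).1) (f.integrable μ)).1 h0
    filter_upwards [h1] with s hs
    have hs' : min 1 (max 0 (g s)) = 0 := hs
    by_contra! hpos
    have : 0 < min 1 (max 0 (g s)) := lt_min one_pos (lt_max_of_lt_right hpos)
    linarith
  have h1 := key (fun s => s - b) (by fun_prop) (fun N => max 0 (bN N - b)) (by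
    have : Tendsto (fun N => max 0 (bN N - b)) atTop (𝓝 (max 0 (b - b))) :=
      tendsto_const_nhds.max (h.tendsto_b.sub_const b)
    simpa using this) (by
      filter_upwards [h.mem] with N hN k
      exact max_le_max le_rfl (by linarith [(hN k).2]))
  have h2 := key (fun s => a - s) (by fun_prop) (fun _ => 0) tendsto_const_nhds (by
      filter_upwards [h.mem] with N hN k
      exact max_le le_rfl (by linarith [(hN k).1]))
  filter_upwards [h1, h2] with s hs1 hs2
  exact ⟨by linarith, by linarith⟩

/-- Precomposition with the projection onto [a, m] extends F to a bounded continuous function. The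
margin m > b absorbs the fluctuation of b_N. -/
theorem tendsto_sum (h : WeakApprox M p lam μ a bN b) {m : ℝ} (ham : a ≤ m) (hm : b < m) {F : ℝ → ℝ}
    (hF : ContinuousOn F (Icc a m)) :
    Tendsto (fun N => ∑ k, p N k * F (lam N k)) atTop (𝓝 (∫ s, F s ∂μ)) := by
  set f : ℝ →ᵇ ℝ := (BoundedContinuousFunction.mkOfCompact
    (⟨(Icc a m).domRestrict F, hF.domRestrict⟩ : C(Icc a m, ℝ))).compContinuous
      ⟨projIcc a m ham, continuous_projIcc⟩
  have hf : ∀ s ∈ Icc a m, f s = F s := by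
    intro s hs
    change F (projIcc a m ham s : ℝ) = F s
    rw [projIcc_of_mem ham hs]
  have h1 := h.lim f
  rw [integral_congr_ae (h.ae_mem.mono fun s hs => hf s ⟨hs.1, hs.2.trans hm.le⟩)] at h1
  refine h1.congr' ?_
  filter_upwards [h.mem, h.tendsto_b.eventually (Iio_mem_nhds hm)] with N hN hb
  exact Finset.sum_congr rfl fun k _ => by rw [hf _ ⟨(hN k).1, (hN k).2.trans (le_of_lt hb)⟩]

end WeakApprox

/-- A fixed point close to w on either side traps the value at the moving argument, so monotonicity
replaces uniform convergence. -/
theorem tendsto_apply_of_antitoneOn {f : ℕ → ℝ → ℝ} {F : ℝ → ℝ} {wN : ℕ → ℝ} {β w : ℝ}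
    (hβ : β < w) (hw : Tendsto wN atTop (𝓝 w)) (hf : ∀ᶠ N in atTop, AntitoneOn (f N) (Ioi β))
    (hlim : ∀ w', β < w' → Tendsto (fun N => f N w') atTop (𝓝 (F w'))) (hF : ContinuousAt F w) :
    Tendsto (fun N => f N (wN N)) atTop (𝓝 (F w)) := by
  rw [tendsto_order]
  constructor
  · intro l hl
    have h1 : ∀ᶠ w' in 𝓝[>] w, l < F w' :=
      (hF.tendsto.eventually (Ioi_mem_nhds hl)).filter_mono nhdsWithin_le_nhds
    obtain ⟨w', hw', hww'⟩ := (h1.and self_mem_nhdsWithin).exists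
    have hww : w < w' := hww'
    filter_upwards [hf, hw.eventually (Ioo_mem_nhds hβ hww),
      (hlim w' (hβ.trans hww)).eventually (Ioi_mem_nhds hw')] with N hN hwN hl'
    exact lt_of_lt_of_le hl' (hN hwN.1 (hβ.trans hww) hwN.2.le)
  · intro u hu
    have h1 : ∀ᶠ w' in 𝓝[<] w, F w' < u :=
      (hF.tendsto.eventually (Iio_mem_nhds hu)).filter_mono nhdsWithin_le_nhds
    have h2 : ∀ᶠ w' in 𝓝[<] w, β < w' :=
      nhdsWithin_le_nhds (Ioi_mem_nhds hβ)
    obtain ⟨w', ⟨hw', hβw'⟩, hww'⟩ := ((h1.and h2).and self_mem_nhdsWithin).exists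
    filter_upwards [hf, hw.eventually (Ioi_mem_nhds hww'),
      (hlim w' hβw').eventually (Iio_mem_nhds hw')] with N hN hwN hl'
    exact lt_of_le_of_lt (hN hβw' (hβw'.trans hwN) (le_of_lt hwN)) hl'

end Weak

/-! ### Polarization -/

section Polarization

variable {r : ℕ}

/-- The matrix entry recovered from a quadratic form by polarization. -/
def polarEntry (Q : (Fin r → ℂ) → ℂ) (i j : Fin r) : ℂ :=
  (Q (Pi.single i 1 + Pi.single j 1) - Q (Pi.single i 1 - Pi.single j 1)
    - Complex.I * Q (Pi.single i 1 + Complex.I • Pi.single j 1)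
    + Complex.I * Q (Pi.single i 1 - Complex.I • Pi.single j 1)) / 4

theorem polarEntry_eq (A : Matrix (Fin r) (Fin r) ℂ) (i j : Fin r) :
    polarEntry (fun v => star v ⬝ᵥ (A *ᵥ v)) i j = A i j := by
  have hb : ∀ i j, star (Pi.single i (1 : ℂ)) ⬝ᵥ (A *ᵥ Pi.single j 1) = A i j := by
    intro i j
    simp
  have hI : star Complex.I = -Complex.I := Complex.conj_I
  simp only [polarEntry, star_add, star_sub, star_smul, Matrix.mulVec_add, Matrix.mulVec_sub,
    Matrix.mulVec_smul, add_dotProduct, sub_dotProduct, dotProduct_add, dotProduct_sub,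
    smul_dotProduct, dotProduct_smul, hb, hI, smul_eq_mul]
  ring_nf
  simp only [Complex.I_sq]
  ring

theorem tendsto_polarEntry {A : ℕ → Matrix (Fin r) (Fin r) ℂ} {Q : (Fin r → ℂ) → ℂ}
    (h : ∀ v, Tendsto (fun N => star v ⬝ᵥ (A N *ᵥ v)) atTop (𝓝 (Q v))) :
    Tendsto A atTop (𝓝 (Matrix.of fun i j => polarEntry Q i j)) := by
  refine tendsto_pi_nhds.2 fun i => tendsto_pi_nhds.2 fun j => ?_
  simp only [← polarEntry_eq (A _) i j]
  exact ((((h _).sub (h _)).sub ((h _).const_mul _)).add ((h _).const_mul _)).div_const _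

end Polarization

/-! ### Spectral integrals compressed by an isometry -/

section Compression

variable {m L r : ℕ} {R : Matrix (Fin m) (Fin m) ℂ}

/-- `Θ* (I_L ⊗ f_k f_k*) Θ`. -/
def compressedProj (Θ : Matrix (Fin L × Fin m) (Fin r) ℂ) (hR : R.IsHermitian) (k : Fin m) :
    Matrix (Fin r) (Fin r) ℂ :=
  Θᴴ * ((1 : Matrix (Fin L) (Fin L) ℂ) ⊗ₖ
    Matrix.vecMulVec (hR.eigenvectorBasis k).ofLp (star (hR.eigenvectorBasis k).ofLp)) * Θ

/-- `Θ* (I_L ⊗ ∫ f dω^R) Θ`. -/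
def compressedIntegral (Θ : Matrix (Fin L × Fin m) (Fin r) ℂ) (hR : R.IsHermitian) (f : ℝ → ℝ) :
    Matrix (Fin r) (Fin r) ℂ :=
  Θᴴ * ((1 : Matrix (Fin L) (Fin L) ℂ) ⊗ₖ spectralIntegral hR f) * Θ

theorem compressedProj_posSemidef (Θ : Matrix (Fin L × Fin m) (Fin r) ℂ) (hR : R.IsHermitian)
    (k : Fin m) : (compressedProj Θ hR k).PosSemidef := by
  have h1 := Matrix.posSemidef_vecMulVec_self_star (hR.eigenvectorBasis k).ofLp
  have h2 : ((1 : Matrix (Fin L) (Fin L) ℂ) ⊗ₖ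
    Matrix.vecMulVec (hR.eigenvectorBasis k).ofLp
      (star (hR.eigenvectorBasis k).ofLp)).PosSemidef := Matrix.PosSemidef.one.kronecker h1
  exact h2.conjTranspose_mul_mul_same Θ

theorem compressedIntegral_eq_sum (Θ : Matrix (Fin L × Fin m) (Fin r) ℂ) (hR : R.IsHermitian)
    (f : ℝ → ℝ) : compressedIntegral Θ hR f =
      ∑ k, (f (hR.eigenvalues k) : ℂ) • compressedProj Θ hR k := by
  have h : (1 : Matrix (Fin L) (Fin L) ℂ) ⊗ₖ spectralIntegral hR f =
      ∑ k, (f (hR.eigenvalues k) : ℂ) • ((1 : Matrix (Fin L) (Fin L) ℂ) ⊗ₖ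
        Matrix.vecMulVec (hR.eigenvectorBasis k).ofLp (star (hR.eigenvectorBasis k).ofLp)) := by
    ext i j
    simp only [spectralIntegral, Matrix.kroneckerMap_apply, Matrix.sum_apply, Matrix.smul_apply,
      Finset.mul_sum, smul_eq_mul]
    exact Finset.sum_congr rfl fun k _ => by ring
  rw [compressedIntegral, h, Matrix.mul_sum, Matrix.sum_mul]
  simp only [Matrix.mul_smul, Matrix.smul_mul, compressedProj]

theorem compressedIntegral_isHermitian (Θ : Matrix (Fin L × Fin m) (Fin r) ℂ) (hR : R.IsHermitian)
    (f : ℝ → ℝ) : (compressedIntegral Θ hR f).IsHermitian := by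
  rw [compressedIntegral_eq_sum, Matrix.IsHermitian, Matrix.conjTranspose_sum]
  refine Finset.sum_congr rfl fun k _ => ?_
  rw [Matrix.conjTranspose_smul, (compressedProj_posSemidef Θ hR k).1.eq]
  simp

theorem reQuad_compressedIntegral (Θ : Matrix (Fin L × Fin m) (Fin r) ℂ) (hR : R.IsHermitian)
    (f : ℝ → ℝ) (v : Fin r → ℂ) : Matrix.reQuad (compressedIntegral Θ hR f) v =
      ∑ k, Matrix.reQuad (compressedProj Θ hR k) v * f (hR.eigenvalues k) := by
  rw [compressedIntegral_eq_sum, Matrix.reQuad, Matrix.sum_mulVec, dotProduct_sum, Complex.re_sum]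
  refine Finset.sum_congr rfl fun k _ => ?_
  rw [mul_comm]
  exact Matrix.reQuad_smul _ _ _

theorem reQuad_compressedProj_nonneg (Θ : Matrix (Fin L × Fin m) (Fin r) ℂ) (hR : R.IsHermitian)
    (k : Fin m) (v : Fin r → ℂ) : 0 ≤ Matrix.reQuad (compressedProj Θ hR k) v :=
  (compressedProj_posSemidef Θ hR k).re_dotProduct_nonneg v

theorem spectralIntegral_eq (hR : R.IsHermitian) (f : ℝ → ℝ) :
    spectralIntegral hR f = (hR.eigenvectorUnitary : Matrix (Fin m) (Fin m) ℂ) *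
      Matrix.diagonal (fun k => (f (hR.eigenvalues k) : ℂ)) *
      star (hR.eigenvectorUnitary : Matrix (Fin m) (Fin m) ℂ) := by
  ext i j
  rw [Matrix.mul_apply]
  simp only [spectralIntegral, Matrix.sum_apply, Matrix.smul_apply, Matrix.vecMulVec_apply,
    Matrix.mul_diagonal, Matrix.star_apply, Matrix.IsHermitian.eigenvectorUnitary_apply,
    smul_eq_mul, Pi.star_apply]
  exact Finset.sum_congr rfl fun k _ => by ring

theorem spectralIntegral_one (hR : R.IsHermitian) : spectralIntegral hR (fun _ => 1) = 1 := by
  have hU : (hR.eigenvectorUnitary : Matrix (Fin m) (Fin m) ℂ) *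
      star (hR.eigenvectorUnitary : Matrix (Fin m) (Fin m) ℂ) = 1 := Unitary.coe_mul_star_self _
  rw [spectralIntegral_eq]
  simp [hU]

theorem compressedIntegral_one {Θ : Matrix (Fin L × Fin m) (Fin r) ℂ} (hΘ : Θᴴ * Θ = 1)
    (hR : R.IsHermitian) : compressedIntegral Θ hR (fun _ => 1) = 1 := by
  rw [compressedIntegral, spectralIntegral_one, Matrix.one_kronecker_one, Matrix.mul_one, hΘ]

theorem dotProduct_compressedIntegral (Θ : Matrix (Fin L × Fin m) (Fin r) ℂ) (hR : R.IsHermitian)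
    (f : ℝ → ℝ) (v : Fin r → ℂ) : star v ⬝ᵥ (compressedIntegral Θ hR f *ᵥ v) =
      (Matrix.reQuad (compressedIntegral Θ hR f) v : ℂ) := by
  refine Complex.ext (by simp [Matrix.reQuad]) ?_
  rw [Complex.ofReal_im]
  exact (compressedIntegral_isHermitian Θ hR f).im_star_dotProduct_mulVec_self v

/-- Inserting t = -1/(c(w + k)) and x = k(w + k) turns the coefficient of R into -x/w, so T_N(x) =
-(w/x)(w - R)⁻¹. -/
theorem HasEdge.TBeta_eq {a b c wp : ℝ} {hR : R.IsHermitian} (h : HasEdge hR a b c wp)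
    (Θ : Matrix (Fin L × Fin m) (Fin r) ℂ) {x : ℝ}
    (hx : edgePhi c (empLaw hR.eigenvalues) wp < x) :
    TBeta Θ R c x = (-(edgeInv c (empLaw hR.eigenvalues) wp x / x : ℝ) : ℂ) •
      compressedIntegral Θ hR fun s => 1 / (edgeInv c (empLaw hR.eigenvalues) wp x - s) := by
  have ht := h.tReal_eq hx
  set ω := empLaw hR.eigenvalues
  set w := edgeInv c ω wp x
  have hwp : wp < w := h.law.lt_edgeInv h.c_pos h.lt h.zero le_rfl hx
  have hb : b < w := h.lt.trans hwp
  have hwx : edgePhi c ω w = x := (h.law.edgeInv_spec h.c_pos h.lt hx.le).2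
  have hK := h.law.edgeK_pos h.c_pos hb
  have hw0 := h.law.b_pos.trans hb
  have hx0 : 0 < x := hwx ▸ h.law.edgePhi_pos h.c_pos hb
  have hcoef : (x : ℂ) * c * tReal R c x / (1 - x * (c : ℂ) ^ 2 * (tReal R c x) ^ 2) =
      (-(x / w) : ℝ) := by
    have hc := h.c_pos
    rw [ht]
    norm_cast
    have e1 : x * c * -(1 / (c * (w + edgeK c ω w))) = -edgeK c ω w := by
      conv_lhs => rw [← hwx]
      rw [edgePhi]
      have : w + edgeK c ω w ≠ 0 := by positivity
      field_simp
    have e2 : 1 - x * c ^ 2 * (-(1 / (c * (w + edgeK c ω w)))) ^ 2 = w / (w + edgeK c ω w) := by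
      conv_lhs => rw [← hwx]
      rw [edgePhi]
      have : w + edgeK c ω w ≠ 0 := by positivity
      field_simp
      ring
    rw [e1, e2]
    conv_rhs => rw [← hwx]
    rw [edgePhi]
    have : w + edgeK c ω w ≠ 0 := by positivity
    field_simp
  have hfac : ∀ k, (x : ℂ) + ((-(x / w) : ℝ) : ℂ) * hR.eigenvalues k =
      ((x / w * (w - hR.eigenvalues k) : ℝ) : ℂ) := by
    intro k; push_cast
    have : (w : ℂ) ≠ 0 := by exact_mod_cast hw0.ne'
    field_simp
    ring
  have hpos : ∀ k, 0 < w - hR.eigenvalues k := fun k => by linarith [(h.mem k).2]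
  have hT : TMatrix R c x = (-(w / x : ℝ) : ℂ) • spectralIntegral hR fun s => 1 / (w - s) := by
    rw [TMatrix, hcoef, hR.inv_affine (fun k => by
      rw [hfac]
      exact_mod_cast (mul_pos (div_pos hx0 hw0) (hpos k)).ne'), spectralIntegral_eq]
    rw [neg_smul, ← Matrix.smul_mul, ← Matrix.mul_smul, ← Matrix.diagonal_smul]
    congr 5
    ext k
    rw [hfac, Pi.smul_apply, smul_eq_mul, ← Complex.ofReal_inv, ← Complex.ofReal_mul]
    congr 1
    have := (hpos k).ne'
    field_simp
  rw [TBeta, hT, compressedIntegral, Matrix.kronecker_smul, Matrix.mul_smul, Matrix.smul_mul]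

end Compression

/-! ### Limits along the model -/

theorem Matrix.IsHermitian.le_eigenvalues {n : Type*} [Fintype n] [DecidableEq n]
    {R : Matrix n n ℂ} (hR : R.IsHermitian) {a : ℝ}
    (h : (R - (a : ℂ) • (1 : Matrix n n ℂ)).PosSemidef) (k : n) : a ≤ hR.eigenvalues k := by
  have h1 := h.re_dotProduct_nonneg (hR.eigenvectorBasis k).ofLp
  rw [Matrix.sub_mulVec, Matrix.smul_mulVec, Matrix.one_mulVec, dotProduct_sub, map_sub,
    ← hR.eigenvalues_eq, dotProduct_smul, dotProduct_comm,
    ← EuclideanSpace.inner_eq_star_dotProduct, inner_self_eq_norm_sq_to_K,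
    hR.eigenvectorBasis.orthonormal.1 k] at h1
  simpa using h1

namespace SpikedModel

variable {Ω : Type*} [MeasurableSpace Ω] {K P L r : ℕ} {S : SpikedModel Ω K P L r}

theorem sum_eigenvalues (S : SpikedModel Ω K P L r) (N : ℕ) (f : ℝ → ℝ) :
    ∑ k, f ((S.R_herm N).eigenvalues k) = ∑ k, f (S.lam N k) :=
  Fintype.sum_equiv (Fintype.equivOfCardEq (Fintype.card_fin _)).symm _ _ fun _ => rfl

theorem eigenvalues_le_iSup (S : SpikedModel Ω K P L r) (N : ℕ) (k : Fin (S.M N)) :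
    (S.R_herm N).eigenvalues k ≤ ⨆ l, S.lam N l :=
  le_ciSup (f := S.lam N) (Set.finite_range _).bddAbove
    ((Fintype.equivOfCardEq (Fintype.card_fin _)).symm k)

theorem exists_eigenvalues_eq_iSup (S : SpikedModel Ω K P L r) (N : ℕ) (hM : 0 < S.M N) :
    ∃ k, (S.R_herm N).eigenvalues k = ⨆ l, S.lam N l := by
  have : Nonempty (Fin (Fintype.card (Fin (S.M N)))) := ⟨⟨0, by simpa using hM⟩⟩
  obtain ⟨l, hl⟩ := exists_eq_ciSup_of_finite (f := S.lam N)
  refine ⟨Fintype.equivOfCardEq (Fintype.card_fin _) l, ?_⟩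
  rw [← hl, Matrix.IsHermitian.eigenvalues, Equiv.symm_apply_apply]
  rfl

namespace Standing

theorem eventually_pos (hS : S.Standing) : ∀ᶠ N in atTop, 0 < S.M N ∧ 0 < S.c N := by
  filter_upwards [hS.regime.eventually (Ioi_mem_nhds hS.cStar_mem.1)] with N hN
  refine ⟨Nat.pos_of_ne_zero fun h => ?_, hN⟩
  have : (0 : ℝ) < S.c N := hN
  simp [SpikedModel.c, h] at this

theorem exists_le_eigenvalues (hS : S.Standing) :
    ∃ a : ℝ, 0 < a ∧ ∀ N k, a ≤ (S.R_herm N).eigenvalues k := by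
  obtain ⟨a, b, ha, _, h⟩ := hS.noise_bounds
  exact ⟨a, ha, fun N k => (S.R_herm N).le_eigenvalues (h N).1 k⟩

theorem weakApprox_omega (hS : S.Standing) {a : ℝ}
    (ha : ∀ N k, a ≤ (S.R_herm N).eigenvalues k) :
    WeakApprox S.M (fun N _ => 1 / (S.M N : ℝ)) (fun N => (S.R_herm N).eigenvalues) S.ωStar a
      (fun N => ⨆ k, S.lam N k) S.lamPlus where
  finite := have := hS.omega_prob; inferInstance
  nonneg N _ := by positivity
  lim f := by
    refine (hS.omega_lim f).congr fun N => ?_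
    rw [← S.sum_eigenvalues N f, Finset.mul_sum]
  mem := Eventually.of_forall fun N k => ⟨ha N k, S.eigenvalues_le_iSup N k⟩
  tendsto_b := hS.lamPlus_lim

theorem weakApprox_gamma (hS : S.Standing) {a : ℝ}
    (ha : ∀ N k, a ≤ (S.R_herm N).eigenvalues k) (v : Fin r → ℂ) :
    WeakApprox S.M (fun N k => Matrix.reQuad (compressedProj (S.Θ N) (S.R_herm N) k) v)
      (fun N => (S.R_herm N).eigenvalues) (S.γStar.scalar v) a
      (fun N => ⨆ k, S.lam N k) S.lamPlus where
  finite := by unfold PosMatrixMeasure.scalar; infer_instance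
  nonneg N k := reQuad_compressedProj_nonneg _ _ _ _
  lim f := by
    have := (Complex.continuous_re.tendsto _).comp (hS.gammaMeasure_lim f v)
    refine this.congr fun N => ?_
    rw [← reQuad_compressedIntegral]
    rfl
  mem := Eventually.of_forall fun N k => ⟨ha N k, S.eigenvalues_le_iSup N k⟩
  tendsto_b := hS.lamPlus_lim

theorem isSpectralLaw (hS : S.Standing) {a : ℝ} (ha0 : 0 < a)
    (ha : ∀ N k, a ≤ (S.R_herm N).eigenvalues k) : IsSpectralLaw S.ωStar a S.lamPlus :=
  ⟨hS.omega_prob, ha0, (hS.weakApprox_omega ha).ae_mem⟩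

theorem eventually_isSpectralLaw (hS : S.Standing) {a : ℝ} (ha0 : 0 < a)
    (ha : ∀ N k, a ≤ (S.R_herm N).eigenvalues k) :
    ∀ᶠ N in atTop, IsSpectralLaw (empLaw (S.R_herm N).eigenvalues) a (⨆ k, S.lam N k) := by
  filter_upwards [hS.eventually_pos] with N hN
  exact isSpectralLaw_empLaw hN.1 ha0 fun k => ⟨ha N k, S.eigenvalues_le_iSup N k⟩

theorem tendsto_integral_empLaw (hS : S.Standing) {a : ℝ} (ha0 : 0 < a)
    (ha : ∀ N k, a ≤ (S.R_herm N).eigenvalues k) {m : ℝ} (hm : S.lamPlus < m) {F : ℝ → ℝ}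
    (hF : ContinuousOn F (Icc a m)) :
    Tendsto (fun N => ∫ s, F s ∂(empLaw (S.R_herm N).eigenvalues)) atTop
      (𝓝 (∫ s, F s ∂S.ωStar)) := by
  refine ((hS.weakApprox_omega ha).tendsto_sum
    ((hS.isSpectralLaw ha0 ha).le.trans hm.le) hm hF).congr fun N => ?_
  rw [integral_empLaw, Finset.mul_sum]

theorem tendsto_edgeK (hS : S.Standing) {a : ℝ} (ha0 : 0 < a)
    (ha : ∀ N k, a ≤ (S.R_herm N).eigenvalues k) {w : ℝ} (hw : S.lamPlus < w) :
    Tendsto (fun N => edgeK (S.c N) (empLaw (S.R_herm N).eigenvalues) w) atTop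
      (𝓝 (edgeK S.cStar S.ωStar w)) := by
  obtain ⟨m, hm, hmw⟩ := exists_between hw
  exact hS.regime.mul (hS.tendsto_integral_empLaw ha0 ha hm (IsSpectralLaw.continuousOn_k w hmw))

theorem tendsto_edgeA (hS : S.Standing) {a : ℝ} (ha0 : 0 < a)
    (ha : ∀ N k, a ≤ (S.R_herm N).eigenvalues k) {w : ℝ} (hw : S.lamPlus < w) :
    Tendsto (fun N => edgeA (S.c N) (empLaw (S.R_herm N).eigenvalues) w) atTop
      (𝓝 (edgeA S.cStar S.ωStar w)) := by
  obtain ⟨m, hm, hmw⟩ := exists_between hw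
  exact hS.regime.mul (hS.tendsto_integral_empLaw ha0 ha hm
    (IsSpectralLaw.continuousOn_div w hmw (by fun_prop) 2))

theorem tendsto_edgePhi (hS : S.Standing) {a : ℝ} (ha0 : 0 < a)
    (ha : ∀ N k, a ≤ (S.R_herm N).eigenvalues k) {w : ℝ} (hw : S.lamPlus < w) :
    Tendsto (fun N => edgePhi (S.c N) (empLaw (S.R_herm N).eigenvalues) w) atTop
      (𝓝 (edgePhi S.cStar S.ωStar w)) :=
  have h := hS.tendsto_edgeK ha0 ha hw
  h.mul (h.const_add w)

theorem tendsto_edgePhi' (hS : S.Standing) {a : ℝ} (ha0 : 0 < a)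
    (ha : ∀ N k, a ≤ (S.R_herm N).eigenvalues k) {w : ℝ} (hw : S.lamPlus < w) :
    Tendsto (fun N => edgePhi' (S.c N) (empLaw (S.R_herm N).eigenvalues) w) atTop
      (𝓝 (edgePhi' S.cStar S.ωStar w)) :=
  have h := hS.tendsto_edgeK ha0 ha hw
  h.sub ((hS.tendsto_edgeA ha0 ha hw).mul ((h.const_mul 2).const_add w))

theorem tendsto_edgeK_apply (hS : S.Standing) {a : ℝ} (ha0 : 0 < a)
    (ha : ∀ N k, a ≤ (S.R_herm N).eigenvalues k) {w : ℝ} (hw : S.lamPlus < w) {wN : ℕ → ℝ}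
    (hwN : Tendsto wN atTop (𝓝 w)) :
    Tendsto (fun N => edgeK (S.c N) (empLaw (S.R_herm N).eigenvalues) (wN N)) atTop
      (𝓝 (edgeK S.cStar S.ωStar w)) := by
  obtain ⟨β, hβ, hβw⟩ := exists_between hw
  refine tendsto_apply_of_antitoneOn hβw hwN ?_
    (fun w' hw' => hS.tendsto_edgeK ha0 ha (hβ.trans hw'))
    ((hS.isSpectralLaw ha0 ha).analyticAt_edgeK hw).continuousAt
  filter_upwards [hS.eventually_pos, hS.eventually_isSpectralLaw ha0 ha,
    hS.lamPlus_lim.eventually (Iio_mem_nhds hβ)] with N hN hlaw hb w₁ h₁ w₂ _ h12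
  exact hlaw.edgeK_antitone hN.2 (lt_trans hb h₁) h12

/-- Lower bound on `k_N` near the edge, from the spacing of the top eigenvalues. -/
theorem exists_lt_edgeK (hS : S.Standing) {a : ℝ} (ha0 : 0 < a)
    (ha : ∀ N k, a ≤ (S.R_herm N).eigenvalues k) (B : ℝ) :
    ∃ w, S.lamPlus < w ∧ B < edgeK S.cStar S.ωStar w := by
  obtain ⟨κ, hκ, hsp⟩ := hS.spacing
  have hlaw := hS.isSpectralLaw ha0 ha
  have hc := hS.cStar_mem.1
  set T := |B| / (S.cStar * (a ^ 2 / κ)) with hT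
  have hT0 : 0 ≤ T := by positivity
  -- Chosen so that log(κ/(2ε)) = T + 1, while T is the size of the logarithm needed to reach |B|.
  set ε := κ * Real.exp (-(T + 1)) / 2 with hε
  have hε0 : 0 < ε := by positivity
  set w := S.lamPlus + ε
  have hw : S.lamPlus < w := by simp only [w]; linarith
  refine ⟨w, hw, ?_⟩
  have hlow : ∀ᶠ N in atTop, S.c N * (a ^ 2 / κ * (Real.log (2 * ε + κ) - Real.log (2 * ε))) ≤
      edgeK (S.c N) (empLaw (S.R_herm N).eigenvalues) w := by
    filter_upwards [hS.eventually_pos, hsp,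
      hS.lamPlus_lim.eventually (Ioo_mem_nhds (a := S.lamPlus - ε) (b := S.lamPlus + ε)
        (by linarith) (by linarith))] with N hN hspN hbN
    have hM : (0 : ℝ) < S.M N := Nat.cast_pos.2 hN.1
    rw [edgeK, integral_empLaw, S.sum_eigenvalues N fun s => s * w / (w - s)]
    refine mul_le_mul_of_nonneg_left ?_ hN.2.le
    -- A discrete primitive of the lower bound: log u ≤ u - 1 bounds its increments by the terms of
    -- the Riemann sum, and it telescopes.
    set g : ℕ → ℝ := fun k => Real.log (2 * ε + κ * (k / S.M N))
    have htel : Real.log (2 * ε + κ) - Real.log (2 * ε) =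
        ∑ k : Fin (Fintype.card (Fin (S.M N))), (g (k + 1) - g k) := by
      rw [Fin.sum_univ_eq_sum_range (fun k => g (k + 1) - g k), Finset.sum_range_sub]
      simp [g, hM.ne']
    rw [htel, Finset.mul_sum, Finset.mul_sum]
    refine Finset.sum_le_sum fun k _ => ?_
    set d := 2 * ε + κ * ((k : ℝ) / S.M N)
    have hd : 0 < d := by positivity
    have hg : g (k + 1) - g k ≤ κ / S.M N / d := by
      have e1 : g (k + 1) = Real.log (d + κ / S.M N) := by
        simp only [g, d]; congr 1; push_cast; ring
      have e2 : g k = Real.log d := rfl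
      rw [e1, e2, ← Real.log_div (by positivity) hd.ne']
      refine (Real.log_le_sub_one_of_pos (by positivity)).trans (le_of_eq ?_)
      field_simp
      ring
    have hlamle : S.lam N k ≤ ⨆ l, S.lam N l := le_ciSup (Set.finite_range _).bddAbove k
    have hlama : a ≤ S.lam N k := by
      have := ha N (Fintype.equivOfCardEq (Fintype.card_fin _) k)
      rwa [Matrix.IsHermitian.eigenvalues, Equiv.symm_apply_apply] at this
    have hwl : 0 < w - S.lam N k := by
      have := hbN.2; simp only [w]; linarith
    -- One ε comes from the position of w, the other from the distance between the largest
    -- eigenvalue and its limit. The index k starts at zero, so k/M is the spacing bound itself.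
    have hwd : w - S.lam N k ≤ d := by
      have h1 := hspN.2 k
      have h2 := hbN.1
      simp only [w, d]; linarith
    have haw : a ≤ w := hlama.trans (by linarith)
    have hl0 : 0 ≤ S.lam N k := ha0.le.trans hlama
    have hlw0 : 0 ≤ S.lam N k * w := mul_nonneg hl0 (ha0.le.trans haw)
    calc a ^ 2 / κ * (g (k + 1) - g k) ≤ a ^ 2 / κ * (κ / S.M N / d) := by gcongr
      _ = 1 / S.M N * (a * a / d) := by field_simp
      _ ≤ 1 / S.M N * (S.lam N k * w / (w - S.lam N k)) := by gcongr
  have hle := le_of_tendsto_of_tendsto (hS.regime.mul_const _) (hS.tendsto_edgeK ha0 ha hw) hlow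
  refine lt_of_lt_of_le ?_ hle
  have h2 : T + 1 ≤ Real.log (2 * ε + κ) - Real.log (2 * ε) := by
    have e1 : Real.log (2 * ε) = Real.log κ - (T + 1) := by
      rw [hε, mul_div_cancel₀ _ (two_ne_zero), Real.log_mul hκ.ne' (Real.exp_pos _).ne',
        Real.log_exp]
      ring
    have e2 : Real.log κ ≤ Real.log (2 * ε + κ) := Real.log_le_log hκ (by linarith)
    linarith
  calc B ≤ |B| := le_abs_self B
    _ = S.cStar * (a ^ 2 / κ * T) := by rw [hT]; field_simp
    _ < S.cStar * (a ^ 2 / κ * (T + 1)) := by gcongr; linarith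
    _ ≤ _ := by gcongr

theorem eventually_exists_hasEdge (hS : S.Standing) {a : ℝ} (ha0 : 0 < a)
    (ha : ∀ N k, a ≤ (S.R_herm N).eigenvalues k) :
    ∀ᶠ N in atTop, ∃ wp, HasEdge (S.R_herm N) a (⨆ k, S.lam N k) (S.c N) wp := by
  filter_upwards [hS.eventually_pos, hS.eventually_isSpectralLaw ha0 ha] with N hN hlaw
  obtain ⟨k₀, hk₀⟩ := S.exists_eigenvalues_eq_iSup N hN.1
  obtain ⟨wp, h1, h2⟩ := hlaw.exists_edge hN.2 (exists_lt_edgeK_empLaw hN.1 hN.2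
    (fun k => ⟨ha0.trans_le (ha N k), S.eigenvalues_le_iSup N k⟩) hk₀)
  exact ⟨wp, hN.1, ha0, hN.2, fun k => ⟨ha N k, S.eigenvalues_le_iSup N k⟩, h1, h2⟩

variable {a wp : ℝ} {wpN : ℕ → ℝ}

/-- The derivatives φ'_N converge pointwise, and each changes sign exactly at its own critical
point; their signs at fixed points on either side of wp confine that critical point. -/
theorem tendsto_edge_param (hS : S.Standing) (ha0 : 0 < a)
    (ha : ∀ N k, a ≤ (S.R_herm N).eigenvalues k) (hb : S.lamPlus < wp)
    (hwp : edgePhi' S.cStar S.ωStar wp = 0)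
    (hN : ∀ᶠ N in atTop, HasEdge (S.R_herm N) a (⨆ k, S.lam N k) (S.c N) (wpN N)) :
    Tendsto wpN atTop (𝓝 wp) := by
  have hlaw := hS.isSpectralLaw ha0 ha
  have hc := hS.cStar_mem.1
  rw [tendsto_order]
  constructor
  · intro l hl
    -- The test point must also exceed the limit of the largest eigenvalue, so that φ'_N is
    -- eventually controlled there.
    obtain ⟨w, hw1, hw2⟩ := exists_between (max_lt hl hb)
    have hbw := (le_max_right _ _).trans_lt hw1
    filter_upwards [hN, hS.lamPlus_lim.eventually (Iio_mem_nhds hbw),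
      (hS.tendsto_edgePhi' ha0 ha hbw).eventually
        (Iio_mem_nhds (hlaw.edgePhi'_neg hc hb hwp hbw hw2))] with N h hbN hneg
    have h1 : edgePhi' (S.c N) (empLaw (S.R_herm N).eigenvalues) w < 0 := hneg
    by_contra! hle
    have h2 : wpN N < w := hle.trans_lt ((le_max_left _ _).trans_lt hw1)
    have := h.law.edgePhi'_pos h.c_pos h.lt h.zero h2
    linarith
  · intro u hu
    filter_upwards [hN, hS.lamPlus_lim.eventually (Iio_mem_nhds (hb.trans hu)),
      (hS.tendsto_edgePhi' ha0 ha (hb.trans hu)).eventually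
        (Ioi_mem_nhds (hlaw.edgePhi'_pos hc hb hwp hu))] with N h hbN hpos
    have h1 : 0 < edgePhi' (S.c N) (empLaw (S.R_herm N).eigenvalues) u := hpos
    by_contra! hle
    rcases hle.eq_or_lt with heq | hlt
    · rw [heq, h.zero] at h1; exact lt_irrefl _ h1
    · have := h.law.edgePhi'_neg h.c_pos h.lt h.zero hbN hlt
      linarith

theorem tendsto_edge (hS : S.Standing) (ha0 : 0 < a)
    (ha : ∀ N k, a ≤ (S.R_herm N).eigenvalues k) (hb : S.lamPlus < wp)
    (hwp : edgePhi' S.cStar S.ωStar wp = 0)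
    (hN : ∀ᶠ N in atTop, HasEdge (S.R_herm N) a (⨆ k, S.lam N k) (S.c N) (wpN N)) :
    Tendsto (fun N => edgePhi (S.c N) (empLaw (S.R_herm N).eigenvalues) (wpN N)) atTop
      (𝓝 (edgePhi S.cStar S.ωStar wp)) := by
  have h1 := hS.tendsto_edge_param ha0 ha hb hwp hN
  have h2 := hS.tendsto_edgeK_apply ha0 ha hb h1
  exact h2.mul (h1.add h2)

/-- Comparing x with φ_N at fixed points on either side of w(x), all beyond the critical points for
large N, confines the inverse. -/
theorem tendsto_edgeInv (hS : S.Standing) (ha0 : 0 < a)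
    (ha : ∀ N k, a ≤ (S.R_herm N).eigenvalues k) (hb : S.lamPlus < wp)
    (hwp : edgePhi' S.cStar S.ωStar wp = 0)
    (hN : ∀ᶠ N in atTop, HasEdge (S.R_herm N) a (⨆ k, S.lam N k) (S.c N) (wpN N)) {x : ℝ}
    (hx : edgePhi S.cStar S.ωStar wp < x) :
    Tendsto (fun N => edgeInv (S.c N) (empLaw (S.R_herm N).eigenvalues) (wpN N) x) atTop
      (𝓝 (edgeInv S.cStar S.ωStar wp x)) := by
  have hlaw := hS.isSpectralLaw ha0 ha
  have hc := hS.cStar_mem.1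
  set w := edgeInv S.cStar S.ωStar wp x
  have hw : wp < w := hlaw.lt_edgeInv hc hb hwp le_rfl hx
  have hwx : edgePhi S.cStar S.ωStar w = x := (hlaw.edgeInv_spec hc hb hx.le).2
  have hmono := hlaw.edgePhi_strictMonoOn hc hb hwp
  have hpar := hS.tendsto_edge_param ha0 ha hb hwp hN
  have hedge := hS.tendsto_edge ha0 ha hb hwp hN
  rw [tendsto_order]
  constructor
  · intro l hl
    obtain ⟨w', hw1, hw2⟩ := exists_between (max_lt hl hw)
    have hpw := (le_max_right _ _).trans_lt hw1
    have hlt : edgePhi S.cStar S.ωStar w' < x := hwx ▸ hmono hpw.le hw.le hw2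
    filter_upwards [hN, hpar.eventually (Iio_mem_nhds hpw),
      (hS.tendsto_edgePhi ha0 ha (hb.trans hpw)).eventually (Iio_mem_nhds hlt)] with N h h1 h2
    exact ((le_max_left _ _).trans_lt hw1).trans
      (h.law.lt_edgeInv h.c_pos h.lt h.zero (le_of_lt h1) h2)
  · intro u hu
    have hlt : x < edgePhi S.cStar S.ωStar u := by
      conv_lhs => rw [← hwx]
      exact hmono hw.le (hw.trans hu).le hu
    filter_upwards [hN, hpar.eventually (Iio_mem_nhds (hw.trans hu)),
      hedge.eventually (Iio_mem_nhds hx),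
      (hS.tendsto_edgePhi ha0 ha (hb.trans (hw.trans hu))).eventually
        (Ioi_mem_nhds hlt)] with N h h1 h2 h3
    exact h.law.edgeInv_lt h.c_pos h.lt h.zero (le_of_lt h1) (le_of_lt h2) h3

end Standing

/-- `∫ dγ_*(s) / (w - s)`. -/
def resolventStar (S : SpikedModel Ω K P L r) (w : ℝ) : Matrix (Fin r) (Fin r) ℂ :=
  Matrix.of fun i j =>
    polarEntry (fun v => ((∫ s, 1 / (w - s) ∂(S.γStar.scalar v) : ℝ) : ℂ)) i j

namespace Standing

variable {a wp : ℝ} {wpN : ℕ → ℝ}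

theorem analyticAt_resolventStar (hS : S.Standing)
    (ha : ∀ N k, a ≤ (S.R_herm N).eigenvalues k) {w : ℝ} (hw : S.lamPlus < w) (i j : Fin r) :
    AnalyticAt ℝ (fun w => S.resolventStar w i j) w := by
  have h : ∀ v, AnalyticAt ℝ
      (fun w : ℝ => ((∫ s, 1 / (w - s) ∂(S.γStar.scalar v) : ℝ) : ℂ)) w := by
    intro v
    have hv := hS.weakApprox_gamma ha v
    have := hv.finite
    exact (Complex.ofRealCLM.analyticAt _).comp
      (analyticAt_integral_div_sub hv.ae_mem (p := fun _ => 1) (by fun_prop) hw)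
  simp only [resolventStar, Matrix.of_apply, polarEntry]
  exact ((((h _).sub (h _)).sub (analyticAt_const.mul (h _))).add
    (analyticAt_const.mul (h _))).div analyticAt_const (by norm_num)

theorem tendsto_compressedIntegral (hS : S.Standing) (ha0 : 0 < a)
    (ha : ∀ N k, a ≤ (S.R_herm N).eigenvalues k) {w : ℝ} (hw : S.lamPlus < w) {wN : ℕ → ℝ}
    (hwN : Tendsto wN atTop (𝓝 w)) :
    Tendsto (fun N => compressedIntegral (S.Θ N) (S.R_herm N) fun s => 1 / (wN N - s)) atTop
      (𝓝 (S.resolventStar w)) := by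
  refine tendsto_polarEntry fun v => ?_
  simp only [dotProduct_compressedIntegral]
  refine (Complex.continuous_ofReal.tendsto _).comp ?_
  have hv := hS.weakApprox_gamma ha v
  have := hv.finite
  obtain ⟨β, hβ, hβw⟩ := exists_between hw
  refine tendsto_apply_of_antitoneOn
    (f := fun N w => Matrix.reQuad (compressedIntegral (S.Θ N) (S.R_herm N)
      fun s => 1 / (w - s)) v) (F := fun w => ∫ s, 1 / (w - s) ∂(S.γStar.scalar v))
    hβw hwN ?_ (fun w' hw' => ?_)
    (analyticAt_integral_div_sub hv.ae_mem (p := fun _ => 1) (by fun_prop) hw).continuousAt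
  · filter_upwards [hS.lamPlus_lim.eventually (Iio_mem_nhds hβ)] with N hb w₁ h₁ w₂ h₂ h12
    simp only [reQuad_compressedIntegral]
    refine Finset.sum_le_sum fun k _ => mul_le_mul_of_nonneg_left ?_
      (reQuad_compressedProj_nonneg _ _ _ _)
    have h3 := S.eigenvalues_le_iSup N k
    have h4 : (⨆ k, S.lam N k) < β := hb
    have h5 : β < w₁ := h₁
    exact one_div_le_one_div_of_le (by linarith) (by linarith)
  · simp only [reQuad_compressedIntegral]
    refine hv.tendsto_sum ((hS.isSpectralLaw ha0 ha).le.trans hβ.le) hβ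
      (F := fun s => 1 / (w' - s)) ?_
    exact ContinuousOn.div continuousOn_const (by fun_prop) fun s hs => by
      have := hs.2; linarith

end Standing

end SpikedModel

/-! ### Positivity of the covariance of the useful signal -/

theorem Matrix.reQuad_conjTranspose_mul_mul {ι κ : Type*} [Fintype ι] [Fintype κ]
    (C : Matrix ι ι ℂ) (B : Matrix ι κ ℂ) (v : κ → ℂ) :
    reQuad (Bᴴ * C * B) v = reQuad C (B *ᵥ v) := by
  rw [reQuad, reQuad, star_mulVec, ← mulVec_mulVec, ← mulVec_mulVec, dotProduct_mulVec]

/-- The form is the expectation of |∑ₚ v̄ₚ Wₚ|²; square integrability justifies the exchange of sum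
and integral. -/
theorem Matrix.reQuad_covariance_nonneg {Ω ι : Type*} [MeasurableSpace Ω] {ℙ : Measure Ω}
    [Fintype ι] {W : Ω → ι → ℂ} (hW : ∀ p, MemLp (fun ω => W ω p) 2 ℙ) (v : ι → ℂ) :
    0 ≤ reQuad (of fun p q => ∫ ω, W ω p * star (W ω q) ∂ℙ) v := by
  have hint : ∀ p q, Integrable (fun ω => W ω p * star (W ω q)) ℙ := fun p q =>
    (hW p).integrable_mul (hW q).star
  have h : star v ⬝ᵥ ((of fun p q => ∫ ω, W ω p * star (W ω q) ∂ℙ) *ᵥ v) =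
      ∫ ω, ((‖∑ p, star (v p) * W ω p‖ ^ 2 : ℝ) : ℂ) ∂ℙ := by
    have e : ∀ ω, ((‖∑ p, star (v p) * W ω p‖ ^ 2 : ℝ) : ℂ) =
        ∑ p, ∑ q, star (v p) * v q * (W ω p * star (W ω q)) := by
      intro ω
      push_cast
      rw [← Complex.mul_conj', map_sum, Finset.sum_mul_sum]
      refine Finset.sum_congr rfl fun p _ => Finset.sum_congr rfl fun q _ => ?_
      simp only [map_mul, starRingEnd_apply, star_star]
      ring
    simp only [e]
    rw [integral_finsetSum _ fun p _ => integrable_finsetSum _ fun q _ => (hint p q).const_mul _]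
    simp only [dotProduct, mulVec, of_apply, Pi.star_apply, Finset.mul_sum]
    refine Finset.sum_congr rfl fun p _ => ?_
    rw [integral_finsetSum _ fun q _ => (hint p q).const_mul _]
    refine Finset.sum_congr rfl fun q _ => ?_
    rw [integral_const_mul]
    ring
  rw [reQuad, h, integral_complex_ofReal, Complex.ofReal_re]
  exact integral_nonneg fun ω => by positivity

namespace SpikedModel

variable {Ω : Type*} [MeasurableSpace Ω] {K P L r : ℕ} {S : SpikedModel Ω K P L r}

/-- The joint process `(x_n, i_n)`. -/
def joint (S : SpikedModel Ω K P L r) (n : ℤ) (ω : Ω) : Fin P ⊕ Fin K → ℂ :=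
  Sum.elim (S.state n ω) (S.innov n ω)

theorem u_eq_joint (S : SpikedModel Ω K P L r) (N : ℕ) (n : ℤ) (ω : Ω) :
    S.u N n ω = Matrix.fromCols (S.C N) (S.D N) *ᵥ S.joint n ω := by
  rw [joint, Matrix.fromCols_mulVec_sumElim, SpikedModel.u]

namespace Standing

theorem memLp_joint (hS : S.Standing) (n : ℤ) (k : Fin P ⊕ Fin K) :
    MemLp (fun ω => S.joint n ω k) 2 S.prob := by
  cases k with
  | inl k => exact hS.signal.memLp_state n k
  | inr k => exact hS.signal.memLp_noise n k

theorem memLp_u (hS : S.Standing) (N : ℕ) (n : ℤ) (p : Fin (S.M N)) :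
    MemLp (fun ω => S.u N n ω p) 2 S.prob := by
  simp only [u_eq_joint, Matrix.mulVec, dotProduct]
  exact memLp_finsetSum _ fun k _ => (hS.memLp_joint n k).const_mul _

theorem stationary_joint (hS : S.Standing) (n h : ℤ) (k l : Fin P ⊕ Fin K) :
    ∫ ω, S.joint (n + h) ω k * star (S.joint n ω l) ∂S.prob =
      ∫ ω, S.joint h ω k * star (S.joint 0 ω l) ∂S.prob := by
  have hsig := hS.signal
  cases k with
  | inl k =>
    cases l with
    | inl l => exact hsig.stationary_state n h k l
    | inr l => exact hsig.stationary_cross n h k l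
  | inr k =>
    cases l with
    | inl l =>
      -- The innovation–state moment is the conjugate of the state–innovation moment at the opposite
      -- lag, which is the one assumed stationary.
      have key : ∀ n, ∫ ω, S.joint (n + h) ω (Sum.inr k) * star (S.joint n ω (Sum.inl l)) ∂S.prob =
          starRingEnd ℂ (∫ ω, S.state (-h) ω l * star (S.innov 0 ω k) ∂S.prob) := by
        intro n
        rw [← hsig.stationary_cross (n + h) (-h) l k, ← integral_conj, add_neg_cancel_right]
        refine integral_congr_ae (Eventually.of_forall fun ω => ?_)
        simp only [joint, Sum.elim_inl, Sum.elim_inr, map_mul, starRingEnd_apply, star_star]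
        ring
      have h0 := key 0
      rw [zero_add] at h0
      rw [key n, h0]
    | inr l =>
      have h0 := hsig.white 0 h k l
      rw [zero_add] at h0
      exact (hsig.white n h k l).trans h0.symm

theorem stationary_u (hS : S.Standing) (N : ℕ) (n h : ℤ) (p q : Fin (S.M N)) :
    ∫ ω, S.u N (n + h) ω p * star (S.u N n ω q) ∂S.prob =
      ∫ ω, S.u N h ω p * star (S.u N 0 ω q) ∂S.prob := by
  set F := Matrix.fromCols (S.C N) (S.D N)
  have key : ∀ a b : ℤ, ∫ ω, S.u N a ω p * star (S.u N b ω q) ∂S.prob =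
      ∑ k, ∑ l, F p k * star (F q l) * ∫ ω, S.joint a ω k * star (S.joint b ω l) ∂S.prob := by
    intro a b
    have hint : ∀ k l, Integrable (fun ω => S.joint a ω k * star (S.joint b ω l)) S.prob :=
      fun k l => (hS.memLp_joint a k).integrable_mul (hS.memLp_joint b l).star
    have e : ∀ ω, S.u N a ω p * star (S.u N b ω q) =
        ∑ k, ∑ l, F p k * star (F q l) * (S.joint a ω k * star (S.joint b ω l)) := by
      intro ω
      rw [u_eq_joint, u_eq_joint, Matrix.mulVec, Matrix.mulVec, dotProduct, dotProduct, star_sum,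
        Finset.sum_mul_sum]
      refine Finset.sum_congr rfl fun k _ => Finset.sum_congr rfl fun l _ => ?_
      rw [star_mul']
      ring
    simp only [e]
    rw [integral_finsetSum _ fun k _ => integrable_finsetSum _ fun l _ => (hint k l).const_mul _]
    refine Finset.sum_congr rfl fun k _ => ?_
    rw [integral_finsetSum _ fun l _ => (hint k l).const_mul _]
    exact Finset.sum_congr rfl fun l _ => integral_const_mul _ _
  rw [key, key]
  simp only [hS.stationary_joint n h]

/-- An entry depends only on the lag between its two times, and this lag is the same for the stacks
starting at 0 and at L. -/
theorem covariance_shift (hS : S.Standing) (N : ℕ) (p q : Fin L × Fin (S.M N)) :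
    ∫ ω, S.uL N L ω p * star (S.uL N L ω q) ∂S.prob = S.Ru N p q := by
  have h1 := hS.stationary_u N ((L : ℤ) + ((q.1 : ℕ) : ℤ)) ((p.1 : ℕ) - ((q.1 : ℕ) : ℤ)) p.2 q.2
  have h2 := hS.stationary_u N (0 + ((q.1 : ℕ) : ℤ)) ((p.1 : ℕ) - ((q.1 : ℕ) : ℤ)) p.2 q.2
  rw [add_add_sub_cancel] at h1 h2
  exact h1.trans h2.symm

/-- The block matrix is the covariance matrix of the concatenation of the stacked vectors starting
at 0 and at L. -/
theorem reQuad_blocks_nonneg (hS : S.Standing) (N : ℕ)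
    (v : (Fin L × Fin (S.M N)) ⊕ (Fin L × Fin (S.M N)) → ℂ) :
    0 ≤ Matrix.reQuad (Matrix.fromBlocks (S.Ru N) (S.Rfp N)ᴴ (S.Rfp N) (S.Ru N)) v := by
  have hW : ∀ p, MemLp (fun ω => Sum.elim (S.uL N 0 ω) (S.uL N L ω) p) 2 S.prob := by
    rintro (p | p) <;> exact hS.memLp_u N _ _
  convert Matrix.reQuad_covariance_nonneg hW v using 2
  ext p q
  rcases p with p | p <;> rcases q with q | q
  · rfl
  · simp only [Matrix.fromBlocks_apply₁₂, Matrix.conjTranspose_apply, Matrix.of_apply,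
      SpikedModel.Rfp, Sum.elim_inl, Sum.elim_inr]
    rw [← starRingEnd_apply, ← integral_conj]
    refine integral_congr_ae (Eventually.of_forall fun ω => ?_)
    simp only [map_mul, starRingEnd_apply, star_star]
    ring
  · rfl
  · exact (hS.covariance_shift N p q).symm

/-- The block matrix is a limit of compressions of the covariance matrix of two consecutive stacked
vectors of the signal. -/
theorem reQuad_star_blocks_nonneg (hS : S.Standing) (v : Fin r ⊕ Fin r → ℂ) :
    0 ≤ Matrix.reQuad (Matrix.fromBlocks (Matrix.diagonal fun k => (S.δStar k : ℂ) ^ 2) S.ΓStarᴴ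
      S.ΓStar (Matrix.diagonal fun k => (S.δStar k : ℂ) ^ 2)) v := by
  have hD : Tendsto (fun N => Matrix.diagonal fun k => (S.δ N k : ℂ) ^ 2) atTop
      (𝓝 (Matrix.diagonal fun k => (S.δStar k : ℂ) ^ 2)) := by
    have h1 : Continuous fun d : Fin r → ℝ =>
        (Matrix.diagonal fun k => (d k : ℂ) ^ 2 : Matrix (Fin r) (Fin r) ℂ) :=
      Continuous.matrix_diagonal (by fun_prop)
    exact (h1.tendsto _).comp hS.delta_lim
  have hG : Tendsto (fun N => ((S.Θ N)ᴴ * S.Rfp N * S.Θ N)ᴴ) atTop (𝓝 S.ΓStarᴴ) :=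
    (continuous_id.matrix_conjTranspose.tendsto _).comp hS.gamma_lim
  have hB : Tendsto (fun N => Matrix.fromBlocks (Matrix.diagonal fun k => (S.δ N k : ℂ) ^ 2)
      ((S.Θ N)ᴴ * S.Rfp N * S.Θ N)ᴴ ((S.Θ N)ᴴ * S.Rfp N * S.Θ N)
      (Matrix.diagonal fun k => (S.δ N k : ℂ) ^ 2)) atTop
      (𝓝 (Matrix.fromBlocks (Matrix.diagonal fun k => (S.δStar k : ℂ) ^ 2) S.ΓStarᴴ
        S.ΓStar (Matrix.diagonal fun k => (S.δStar k : ℂ) ^ 2))) := by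
    have hcont : Continuous fun q : Matrix (Fin r) (Fin r) ℂ × Matrix (Fin r) (Fin r) ℂ ×
        Matrix (Fin r) (Fin r) ℂ × Matrix (Fin r) (Fin r) ℂ =>
        Matrix.fromBlocks q.1 q.2.1 q.2.2.1 q.2.2.2 :=
      Continuous.matrix_fromBlocks (by fun_prop) (by fun_prop) (by fun_prop) (by fun_prop)
    exact (hcont.tendsto _).comp
      (hD.prodMk_nhds (hG.prodMk_nhds (hS.gamma_lim.prodMk_nhds hD)))
  have hcq : Continuous fun A : Matrix (Fin r ⊕ Fin r) (Fin r ⊕ Fin r) ℂ => Matrix.reQuad A v := by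
    unfold Matrix.reQuad
    fun_prop
  refine ge_of_tendsto ((hcq.tendsto _).comp hB) ?_
  filter_upwards [hS.eigen] with N hN
  obtain ⟨hΘ, -, -, hRu⟩ := hN
  have hD' : (S.Θ N)ᴴ * S.Ru N * S.Θ N = Matrix.diagonal fun k => (S.δ N k : ℂ) ^ 2 := by
    rw [hRu]
    have : (S.Θ N)ᴴ * (S.Θ N * (Matrix.diagonal fun k => (S.δ N k : ℂ) ^ 2) * (S.Θ N)ᴴ) * S.Θ N =
        ((S.Θ N)ᴴ * S.Θ N) * (Matrix.diagonal fun k => (S.δ N k : ℂ) ^ 2) *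
          ((S.Θ N)ᴴ * S.Θ N) := by simp only [Matrix.mul_assoc]
    rw [this, hΘ, Matrix.one_mul, Matrix.mul_one]
  -- Compression by diag(Θ_N, Θ_N) turns the full covariance into the r-dimensional blocks.
  have hblock : Matrix.fromBlocks (Matrix.diagonal fun k => (S.δ N k : ℂ) ^ 2)
      ((S.Θ N)ᴴ * S.Rfp N * S.Θ N)ᴴ ((S.Θ N)ᴴ * S.Rfp N * S.Θ N)
      (Matrix.diagonal fun k => (S.δ N k : ℂ) ^ 2) =
      (Matrix.fromBlocks (S.Θ N) 0 0 (S.Θ N))ᴴ *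
        Matrix.fromBlocks (S.Ru N) (S.Rfp N)ᴴ (S.Rfp N) (S.Ru N) *
        Matrix.fromBlocks (S.Θ N) 0 0 (S.Θ N) := by
    rw [Matrix.fromBlocks_conjTranspose, Matrix.fromBlocks_multiply, Matrix.fromBlocks_multiply]
    simp only [Matrix.conjTranspose_zero, Matrix.zero_mul, Matrix.mul_zero, add_zero, zero_add,
      hD', Matrix.conjTranspose_mul, Matrix.conjTranspose_conjTranspose, Matrix.mul_assoc]
  simp only [Function.comp]
  rw [hblock, Matrix.reQuad_conjTranspose_mul_mul]
  exact hS.reQuad_blocks_nonneg N _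

end Standing

end SpikedModel

/-! ### Inverses of positive definite matrices -/

namespace Matrix

variable {n : Type*} [Fintype n]

theorem IsHermitian.posDef_of_reQuad {A : Matrix n n ℂ} (hA : A.IsHermitian)
    (h : ∀ v, v ≠ 0 → 0 < reQuad A v) : A.PosDef := by
  refine PosDef.of_dotProduct_mulVec_pos hA fun v hv => ?_
  rw [Complex.pos_iff]
  exact ⟨h v hv, (hA.im_star_dotProduct_mulVec_self v).symm⟩

theorem sum_norm_sq_pos {v : n → ℂ} (hv : v ≠ 0) : 0 < ∑ i, ‖v i‖ ^ 2 := by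
  obtain ⟨i, hi⟩ := Function.ne_iff.1 hv
  refine Finset.sum_pos' (fun _ _ => by positivity) ⟨i, Finset.mem_univ _, ?_⟩
  have : 0 < ‖v i‖ := norm_pos_iff.2 hi
  positivity

variable [DecidableEq n]

theorem reQuad_one (v : n → ℂ) : reQuad (1 : Matrix n n ℂ) v = ∑ i, ‖v i‖ ^ 2 := by
  rw [reQuad, one_mulVec, dotProduct, Complex.re_sum]
  refine Finset.sum_congr rfl fun i _ => ?_
  rw [Pi.star_apply, ← starRingEnd_apply, Complex.conj_mul']
  norm_cast

/-- With x = A⁻¹v and y = B⁻¹v, expand 0 ≤ (x - y)*A(x - y) and bound y*Ay by y*By = y*v; no square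
roots are needed. -/
theorem reQuad_inv_le_inv {A B : Matrix n n ℂ} (hA : A.PosDef) (hB : B.PosDef)
    (h : ∀ v, reQuad A v ≤ reQuad B v) (v : n → ℂ) : reQuad B⁻¹ v ≤ reQuad A⁻¹ v := by
  have hAd : IsUnit A.det := (isUnit_iff_isUnit_det _).1 hA.isUnit
  have hBd : IsUnit B.det := (isUnit_iff_isUnit_det _).1 hB.isUnit
  set x := A⁻¹ *ᵥ v
  set y := B⁻¹ *ᵥ v
  have hAx : A *ᵥ x = v := by
    simp only [x]; rw [mulVec_mulVec, mul_nonsing_inv _ hAd, one_mulVec]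
  have hBy : B *ᵥ y = v := by
    simp only [y]; rw [mulVec_mulVec, mul_nonsing_inv _ hBd, one_mulVec]
  have hsym : ∀ u : n → ℂ, (star u ⬝ᵥ v).re = (star v ⬝ᵥ u).re := by
    intro u
    rw [← star_star (star u ⬝ᵥ v), star_dotProduct, star_star, ← starRingEnd_apply, Complex.conj_re]
  have hxA : star x ⬝ᵥ (A *ᵥ y) = star v ⬝ᵥ y := by
    calc star x ⬝ᵥ (A *ᵥ y) = star (A *ᵥ x) ⬝ᵥ y := by
          rw [star_mulVec A x, hA.1.eq, dotProduct_mulVec]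
      _ = star v ⬝ᵥ y := by rw [hAx]
  have h0 : 0 ≤ reQuad A (x - y) := hA.posSemidef.re_dotProduct_nonneg (x - y)
  have e : reQuad A (x - y) = (star x ⬝ᵥ v).re - (star v ⬝ᵥ y).re - (star y ⬝ᵥ v).re +
      reQuad A y := by
    simp only [reQuad, star_sub, mulVec_sub, sub_dotProduct, dotProduct_sub, hAx, hxA,
      Complex.sub_re]
    ring
  have hy := h y
  have e2 : reQuad B y = (star y ⬝ᵥ v).re := by rw [reQuad, hBy]
  rw [e, hsym x, hsym y] at h0
  rw [e2, hsym y] at hy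
  change (star v ⬝ᵥ y).re ≤ (star v ⬝ᵥ x).re
  linarith

/-- Cramer's rule: the entries of the inverse are quotients of determinants. -/
theorem analyticAt_inv_apply {A : ℝ → Matrix n n ℂ} {y : ℝ}
    (h : ∀ i j, AnalyticAt ℝ (fun x => A x i j) y) (hdet : (A y).det ≠ 0) (i j : n) :
    AnalyticAt ℝ (fun x => (A x)⁻¹ i j) y := by
  have e : (fun x => (A x)⁻¹ i j) =
      fun x => (A x).det⁻¹ * ((A x).updateRow j (Pi.single i 1)).det := by
    funext x
    rw [inv_def, smul_apply, adjugate_apply, Ring.inverse_eq_inv', smul_eq_mul]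
  rw [e]
  refine ((analyticAt_det h).inv hdet).mul (analyticAt_det fun k l => ?_)
  by_cases hk : k = j
  · subst hk
    simp only [updateRow_self]
    exact analyticAt_const
  · simp only [updateRow_ne hk]
    exact h k l

end Matrix

/-! ### The limit matrix function -/

namespace SpikedModel

variable {Ω : Type*} [MeasurableSpace Ω] {K P L r : ℕ} {S : SpikedModel Ω K P L r}

namespace Standing

variable {a : ℝ}

theorem resolventStar_isHermitian (hS : S.Standing) (ha0 : 0 < a)
    (ha : ∀ N k, a ≤ (S.R_herm N).eigenvalues k) {w : ℝ} (hw : S.lamPlus < w) :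
    (S.resolventStar w).IsHermitian := by
  have h := hS.tendsto_compressedIntegral ha0 ha hw (tendsto_const_nhds (x := w))
  have h2 : Tendsto _ atTop (𝓝 (S.resolventStar w)ᴴ) :=
    (continuous_id.matrix_conjTranspose.tendsto _).comp h
  refine tendsto_nhds_unique (h2.congr fun N => ?_) h
  exact (compressedIntegral_isHermitian (S.Θ N) (S.R_herm N) _).eq

theorem reQuad_resolventStar (hS : S.Standing) (ha0 : 0 < a)
    (ha : ∀ N k, a ≤ (S.R_herm N).eigenvalues k) {w : ℝ} (hw : S.lamPlus < w) (v : Fin r → ℂ) :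
    Matrix.reQuad (S.resolventStar w) v = ∫ s, 1 / (w - s) ∂(S.γStar.scalar v) := by
  obtain ⟨m, hm, hmw⟩ := exists_between hw
  have hcq : Continuous fun A : Matrix (Fin r) (Fin r) ℂ => Matrix.reQuad A v := by
    unfold Matrix.reQuad
    fun_prop
  have h1 := (hcq.tendsto _).comp
    (hS.tendsto_compressedIntegral ha0 ha hw (tendsto_const_nhds (x := w)))
  refine tendsto_nhds_unique h1 ?_
  simp only [Function.comp_def, reQuad_compressedIntegral]
  refine (hS.weakApprox_gamma ha v).tendsto_sum ((hS.isSpectralLaw ha0 ha).le.trans hm.le) hm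
    (F := fun s => 1 / (w - s)) ?_
  exact ContinuousOn.div continuousOn_const (by fun_prop) fun s hs => by
    have := hs.2; linarith

/-- Since Θ_N is an isometry for large N, γ_N has total mass the identity, and no mass is lost in
the limit. This is what makes ∫ w/(w - s) dγ_* invertible. -/
theorem gamma_scalar_mass (hS : S.Standing) (ha : ∀ N k, a ≤ (S.R_herm N).eigenvalues k)
    (v : Fin r → ℂ) : (S.γStar.scalar v).real univ = ∑ i, ‖v i‖ ^ 2 := by
  refine tendsto_nhds_unique (hS.weakApprox_gamma ha v).tendsto_mass
    (tendsto_const_nhds.congr' ?_)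
  filter_upwards [hS.eigen] with N hN
  have h := reQuad_compressedIntegral (S.Θ N) (S.R_herm N) (fun _ => 1) v
  rw [compressedIntegral_one hN.1, Matrix.reQuad_one] at h
  simpa using h

theorem integral_gamma_mono (hS : S.Standing) (ha : ∀ N k, a ≤ (S.R_herm N).eigenvalues k)
    (v : Fin r → ℂ) {F G : ℝ → ℝ} (hF : ContinuousOn F (Icc a S.lamPlus))
    (hG : ContinuousOn G (Icc a S.lamPlus)) (hFG : ∀ s ∈ Icc a S.lamPlus, F s ≤ G s) :
    ∫ s, F s ∂(S.γStar.scalar v) ≤ ∫ s, G s ∂(S.γStar.scalar v) :=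
  have h := hS.weakApprox_gamma ha v
  have := h.finite
  integral_mono_ae (hF.integrable_of_ae_mem_Icc h.ae_mem) (hG.integrable_of_ae_mem_Icc h.ae_mem)
    (h.ae_mem.mono hFG)

theorem continuousOn_inv_sub {w : ℝ} (hw : S.lamPlus < w) (q : ℝ) :
    ContinuousOn (fun s => q * (1 / (w - s))) (Icc a S.lamPlus) :=
  continuousOn_const.mul (ContinuousOn.div continuousOn_const (by fun_prop) fun s hs => by
    have := hs.2; linarith)

theorem reQuad_smul_resolventStar (hS : S.Standing) (ha0 : 0 < a)
    (ha : ∀ N k, a ≤ (S.R_herm N).eigenvalues k) {w : ℝ} (hw : S.lamPlus < w) (v : Fin r → ℂ) :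
    Matrix.reQuad ((w : ℂ) • S.resolventStar w) v =
      ∫ s, w * (1 / (w - s)) ∂(S.γStar.scalar v) := by
  rw [Matrix.reQuad_smul, hS.reQuad_resolventStar ha0 ha hw, integral_const_mul]

theorem le_reQuad_smul_resolventStar (hS : S.Standing) (ha0 : 0 < a)
    (ha : ∀ N k, a ≤ (S.R_herm N).eigenvalues k) {w : ℝ} (hw : S.lamPlus < w) (v : Fin r → ℂ) :
    ∑ i, ‖v i‖ ^ 2 ≤ Matrix.reQuad ((w : ℂ) • S.resolventStar w) v := by
  rw [hS.reQuad_smul_resolventStar ha0 ha hw, ← hS.gamma_scalar_mass ha v]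
  have h1 := hS.integral_gamma_mono ha v (F := fun _ => 1) continuousOn_const
    (continuousOn_inv_sub hw w) fun s hs => by
      have h1 : 0 < w - s := by linarith [hs.2]
      rw [mul_one_div, le_div_iff₀ h1]
      linarith [hs.1]
  simpa using h1

theorem reQuad_smul_resolventStar_le (hS : S.Standing) (ha0 : 0 < a)
    (ha : ∀ N k, a ≤ (S.R_herm N).eigenvalues k) {w : ℝ} (hw : S.lamPlus < w) (v : Fin r → ℂ) :
    Matrix.reQuad ((w : ℂ) • S.resolventStar w) v ≤ w / (w - S.lamPlus) * ∑ i, ‖v i‖ ^ 2 := by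
  rw [hS.reQuad_smul_resolventStar ha0 ha hw, ← hS.gamma_scalar_mass ha v]
  have hb := (hS.isSpectralLaw ha0 ha).b_pos
  have h1 := hS.integral_gamma_mono ha v (G := fun _ => w / (w - S.lamPlus))
    (continuousOn_inv_sub hw w) continuousOn_const fun s hs => by
      have h1 : 0 < w - S.lamPlus := by linarith
      rw [mul_one_div]
      exact div_le_div_of_nonneg_left (by linarith) h1 (by linarith [hs.2])
  simpa [mul_comm] using h1

theorem reQuad_smul_resolventStar_antitone (hS : S.Standing) (ha0 : 0 < a)
    (ha : ∀ N k, a ≤ (S.R_herm N).eigenvalues k) {w₁ w₂ : ℝ} (hw : S.lamPlus < w₁)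
    (h12 : w₁ ≤ w₂) (v : Fin r → ℂ) : Matrix.reQuad ((w₂ : ℂ) • S.resolventStar w₂) v ≤
      Matrix.reQuad ((w₁ : ℂ) • S.resolventStar w₁) v := by
  rw [hS.reQuad_smul_resolventStar ha0 ha hw,
    hS.reQuad_smul_resolventStar ha0 ha (hw.trans_le h12)]
  refine hS.integral_gamma_mono ha v (continuousOn_inv_sub (hw.trans_le h12) w₂)
    (continuousOn_inv_sub hw w₁) fun s hs => ?_
  have h1 : 0 < w₁ - s := by linarith [hs.2]
  have h2 : 0 < w₂ - s := by linarith [hs.2]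
  rw [mul_one_div, mul_one_div, div_le_div_iff₀ h2 h1]
  have : 0 ≤ s := ha0.le.trans hs.1
  nlinarith

theorem posDef_smul_resolventStar (hS : S.Standing) (ha0 : 0 < a)
    (ha : ∀ N k, a ≤ (S.R_herm N).eigenvalues k) {w : ℝ} (hw : S.lamPlus < w) :
    ((w : ℂ) • S.resolventStar w).PosDef := by
  refine Matrix.IsHermitian.posDef_of_reQuad ?_ fun v hv =>
    (Matrix.sum_norm_sq_pos hv).trans_le (hS.le_reQuad_smul_resolventStar ha0 ha hw v)
  rw [Matrix.IsHermitian, Matrix.conjTranspose_smul,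
    (hS.resolventStar_isHermitian ha0 ha hw).eq]
  simp

end Standing

/-- `(w ∫ dγ_*(s) / (w - s))⁻¹`. -/
def invResolvent (S : SpikedModel Ω K P L r) (w : ℝ) : Matrix (Fin r) (Fin r) ℂ :=
  ((w : ℂ) • S.resolventStar w)⁻¹

/-- The block matrix with diagonal blocks `Δ_*²` and off-diagonal blocks `σ Γ_*^*`, `σ Γ_*`. -/
def signalBlock (S : SpikedModel Ω K P L r) (σ : ℂ) : Matrix (Fin r ⊕ Fin r) (Fin r ⊕ Fin r) ℂ :=
  Matrix.fromBlocks (Matrix.diagonal fun k => (S.δStar k : ℂ) ^ 2) (σ • S.ΓStarᴴ)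
    (σ • S.ΓStar) (Matrix.diagonal fun k => (S.δStar k : ℂ) ^ 2)

/-- `H_*` in terms of `y`, `w` and `p = -c_* 𝐭_*(y)`. -/
def hMatrix (S : SpikedModel Ω K P L r) (y w p : ℝ) :
    Matrix (Fin r ⊕ Fin r) (Fin r ⊕ Fin r) ℂ :=
  ((1 / (2 * (1 + p)) : ℝ) : ℂ) • S.signalBlock 1 -
    ((1 / (2 * (1 - p)) : ℝ) : ℂ) • S.signalBlock (-1)
    + (y : ℂ) • Matrix.fromBlocks (S.invResolvent w) 0 0 (S.invResolvent w)

/-- Partial fractions of -p/(1 - p²) and 1/(1 - p²) separate the signal terms into two positive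
semidefinite blocks whose scalar coefficients are monotone in p. -/
theorem HStar_eq_hMatrix {t : ℝ → ℂ} {T : ℝ → Matrix (Fin r) (Fin r) ℂ} {y w p : ℝ} (hy : 0 < y)
    (hp0 : 0 ≤ p) (hp : p < 1)
    (ht : (S.cStar : ℂ) * (y * t (y ^ 2)) = -(p : ℂ))
    (hT : (y : ℂ) • T (y ^ 2) = ((-(1 / y) : ℝ) : ℂ) • ((w : ℂ) • S.resolventStar w))
    (hdet : IsUnit ((w : ℂ) • S.resolventStar w).det) :
    S.HStar t T y = S.hMatrix y w p := by
  have hinv : ((y : ℂ) • T (y ^ 2))⁻¹ = -((y : ℂ) • S.invResolvent w) := by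
    rw [hT]
    apply Matrix.inv_eq_right_inv
    rw [invResolvent, Matrix.mul_neg, Matrix.smul_mul, Matrix.mul_smul,
      Matrix.mul_nonsing_inv _ hdet,
      smul_smul, ← neg_smul]
    have hy' : (y : ℂ) ≠ 0 := by exact_mod_cast hy.ne'
    rw [show -(((-(1 / y) : ℝ) : ℂ) * (y : ℂ)) = 1 by push_cast; field_simp, one_smul]
  have h1 : (1 : ℂ) - p ≠ 0 := by
    have : (1 : ℝ) - p ≠ 0 := by linarith
    exact_mod_cast this
  have h2 : (1 : ℂ) + p ≠ 0 := by
    have : (1 : ℝ) + p ≠ 0 := by linarith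
    exact_mod_cast this
  have h3 : (1 : ℂ) - (-(p : ℂ)) ^ 2 ≠ 0 := by
    rw [show (1 : ℂ) - (-(p : ℂ)) ^ 2 = (1 - p) * (1 + p) by ring]
    exact mul_ne_zero h1 h2
  have c1 : -(p : ℂ) / (1 - (-(p : ℂ)) ^ 2) =
      1 / (2 * (1 + (p : ℂ))) - 1 / (2 * (1 - (p : ℂ))) := by
    rw [show (1 : ℂ) - (-(p : ℂ)) ^ 2 = (1 - p) * (1 + p) by ring]
    field_simp; ring
  have c2 : 1 / (1 - (-(p : ℂ)) ^ 2) =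
      1 / (2 * (1 + (p : ℂ))) + 1 / (2 * (1 - (p : ℂ))) := by
    rw [show (1 : ℂ) - (-(p : ℂ)) ^ 2 = (1 - p) * (1 + p) by ring]
    field_simp; ring
  simp only [HStar]
  rw [ht, hinv, c1, c2, hMatrix, signalBlock, signalBlock]
  simp only [Matrix.fromBlocks_smul, Matrix.fromBlocks_add, Matrix.fromBlocks_neg, sub_eq_add_neg,
    neg_neg, smul_zero, add_zero]
  push_cast
  congr 1 <;> module

namespace Standing

variable {a : ℝ}

theorem signalBlock_isHermitian (S : SpikedModel Ω K P L r) (σ : ℝ) :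
    (S.signalBlock σ).IsHermitian := by
  rw [signalBlock, Matrix.IsHermitian, Matrix.fromBlocks_conjTranspose]
  simp [Matrix.diagonal_conjTranspose, Matrix.conjTranspose_smul, Pi.star_def]

theorem reQuad_signalBlock_one_nonneg (hS : S.Standing) (v : Fin r ⊕ Fin r → ℂ) :
    0 ≤ Matrix.reQuad (S.signalBlock 1) v := by
  rw [signalBlock, one_smul, one_smul]
  exact hS.reQuad_star_blocks_nonneg v

/-- Conjugation by diag(1, -1) flips the sign of the off-diagonal blocks. -/
theorem reQuad_signalBlock_neg_one_nonneg (hS : S.Standing) (v : Fin r ⊕ Fin r → ℂ) :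
    0 ≤ Matrix.reQuad (S.signalBlock (-1)) v := by
  have : S.signalBlock (-1) = (Matrix.fromBlocks 1 0 0 (-1))ᴴ * S.signalBlock 1 *
      Matrix.fromBlocks 1 0 0 (-1) := by
    rw [signalBlock, signalBlock, Matrix.fromBlocks_conjTranspose, Matrix.fromBlocks_multiply,
      Matrix.fromBlocks_multiply]
    simp
  rw [this, Matrix.reQuad_conjTranspose_mul_mul]
  exact hS.reQuad_signalBlock_one_nonneg _

theorem reQuad_fromBlocks_diag (Q : Matrix (Fin r) (Fin r) ℂ) (v : Fin r ⊕ Fin r → ℂ) :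
    Matrix.reQuad (Matrix.fromBlocks Q 0 0 Q) v =
      Matrix.reQuad Q (v ∘ Sum.inl) + Matrix.reQuad Q (v ∘ Sum.inr) := by
  simp only [Matrix.reQuad, Matrix.fromBlocks_mulVec, Matrix.zero_mulVec, add_zero, zero_add]
  rw [← Complex.add_re]
  congr 1
  simp [dotProduct, Fintype.sum_sum_type]

theorem invResolvent_isHermitian (hS : S.Standing) (ha0 : 0 < a)
    (ha : ∀ N k, a ≤ (S.R_herm N).eigenvalues k) {w : ℝ} (hw : S.lamPlus < w) :
    (S.invResolvent w).IsHermitian :=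
  (hS.posDef_smul_resolventStar ha0 ha hw).1.inv

theorem hMatrix_isHermitian (hS : S.Standing) (ha0 : 0 < a)
    (ha : ∀ N k, a ≤ (S.R_herm N).eigenvalues k) {y w p : ℝ} (hw : S.lamPlus < w) :
    (S.hMatrix y w p).IsHermitian := by
  have h1 := signalBlock_isHermitian S 1
  have h2 := signalBlock_isHermitian S (-1)
  have h3 : (Matrix.fromBlocks (S.invResolvent w) 0 0 (S.invResolvent w)).IsHermitian := by
    rw [Matrix.IsHermitian, Matrix.fromBlocks_conjTranspose,
      (hS.invResolvent_isHermitian ha0 ha hw).eq]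
    simp
  push_cast at h1 h2
  rw [Matrix.IsHermitian, hMatrix, Matrix.conjTranspose_add, Matrix.conjTranspose_sub,
    Matrix.conjTranspose_smul, Matrix.conjTranspose_smul, Matrix.conjTranspose_smul, h1.eq, h2.eq,
    h3.eq]
  simp only [← starRingEnd_apply, Complex.conj_ofReal]

theorem reQuad_invResolvent_antitone (hS : S.Standing) (ha0 : 0 < a)
    (ha : ∀ N k, a ≤ (S.R_herm N).eigenvalues k) {w₁ w₂ : ℝ} (hw : S.lamPlus < w₁)
    (h12 : w₁ ≤ w₂) (v : Fin r → ℂ) :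
    Matrix.reQuad (S.invResolvent w₁) v ≤ Matrix.reQuad (S.invResolvent w₂) v :=
  Matrix.reQuad_inv_le_inv (hS.posDef_smul_resolventStar ha0 ha (hw.trans_le h12))
    (hS.posDef_smul_resolventStar ha0 ha hw)
    (hS.reQuad_smul_resolventStar_antitone ha0 ha hw h12) v

/-- The measure sits in (-∞, λ₊], so the integral of w/(w - s) is at most w/(w - λ₊) times the
identity; inversion reverses the inequality. -/
theorem le_reQuad_invResolvent (hS : S.Standing) (ha0 : 0 < a)
    (ha : ∀ N k, a ≤ (S.R_herm N).eigenvalues k) {w : ℝ} (hw : S.lamPlus < w) (v : Fin r → ℂ) :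
    (1 - S.lamPlus / w) * ∑ i, ‖v i‖ ^ 2 ≤ Matrix.reQuad (S.invResolvent w) v := by
  have hw0 : 0 < w := (hS.isSpectralLaw ha0 ha).b_pos.trans hw
  set q := w / (w - S.lamPlus)
  have hq : 0 < q := div_pos hw0 (by linarith)
  have hB : (((q : ℝ) : ℂ) • (1 : Matrix (Fin r) (Fin r) ℂ)).PosDef := by
    refine Matrix.IsHermitian.posDef_of_reQuad ?_ fun v hv => ?_
    · rw [Matrix.IsHermitian, Matrix.conjTranspose_smul]; simp
    · rw [Matrix.reQuad_smul, Matrix.reQuad_one]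
      exact mul_pos hq (Matrix.sum_norm_sq_pos hv)
  have h := Matrix.reQuad_inv_le_inv (hS.posDef_smul_resolventStar ha0 ha hw) hB (fun v => by
    rw [Matrix.reQuad_smul q, Matrix.reQuad_one]
    exact hS.reQuad_smul_resolventStar_le ha0 ha hw v) v
  have hinv : (((q : ℝ) : ℂ) • (1 : Matrix (Fin r) (Fin r) ℂ))⁻¹ =
      ((1 - S.lamPlus / w : ℝ) : ℂ) • (1 : Matrix (Fin r) (Fin r) ℂ) := by
    apply Matrix.inv_eq_right_inv
    rw [smul_mul_smul_comm, Matrix.one_mul, ← Complex.ofReal_mul,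
      show q * (1 - S.lamPlus / w) = 1 by
        have : w - S.lamPlus ≠ 0 := by linarith
        simp only [q]; field_simp]
    simp
  rwa [hinv, Matrix.reQuad_smul, Matrix.reQuad_one] at h

/-- Decreasing p raises 1/(1 + p) and lowers 1/(1 - p), so both signal terms help. For the rest,
y₂W₂ - y₁W₁ = (y₂ - y₁)W₁ + y₂(W₂ - W₁), where W₁ is at least the bound at w₀ and W₂ ≥ W₁. The base
point w₀ makes the rate uniform. -/
theorem hMatrix_increasing (hS : S.Standing) (ha0 : 0 < a)
    (ha : ∀ N k, a ≤ (S.R_herm N).eigenvalues k) {y₁ y₂ w₀ w₁ w₂ p₁ p₂ : ℝ} (hy1 : 0 ≤ y₁)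
    (hy : y₁ ≤ y₂) (hw0 : S.lamPlus < w₀) (hw01 : w₀ ≤ w₁) (hw : w₁ ≤ w₂) (hp2 : 0 ≤ p₂)
    (hp : p₂ ≤ p₁) (hp1 : p₁ < 1) (v : Fin r ⊕ Fin r → ℂ) :
    Matrix.reQuad (S.hMatrix y₁ w₁ p₁) v +
      (1 - S.lamPlus / w₀) * (y₂ - y₁) * ∑ i, ‖v i‖ ^ 2 ≤
      Matrix.reQuad (S.hMatrix y₂ w₂ p₂) v := by
  have hb := (hS.isSpectralLaw ha0 ha).b_pos
  have hq : ∀ u : Fin r → ℂ, y₁ * Matrix.reQuad (S.invResolvent w₁) u +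
      (1 - S.lamPlus / w₀) * (y₂ - y₁) * ∑ i, ‖u i‖ ^ 2 ≤
      y₂ * Matrix.reQuad (S.invResolvent w₂) u := by
    intro u
    have h1 := hS.reQuad_invResolvent_antitone ha0 ha (hw0.trans_le hw01) hw u
    have h2 := hS.le_reQuad_invResolvent ha0 ha hw0 u
    have h3 := hS.reQuad_invResolvent_antitone ha0 ha hw0 hw01 u
    have h4 := mul_le_mul_of_nonneg_left (h2.trans h3) (sub_nonneg.2 hy)
    have h5 := mul_le_mul_of_nonneg_left h1 (hy1.trans hy)
    linarith
  have e1 := hq (v ∘ Sum.inl)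
  have e2 := hq (v ∘ Sum.inr)
  have c1 : 1 / (2 * (1 + p₁)) ≤ 1 / (2 * (1 + p₂)) := by
    apply one_div_le_one_div_of_le <;> linarith
  have c2 : 1 / (2 * (1 - p₂)) ≤ 1 / (2 * (1 - p₁)) := by
    apply one_div_le_one_div_of_le <;> linarith
  have d1 := mul_le_mul_of_nonneg_right c1 (hS.reQuad_signalBlock_one_nonneg v)
  have d2 := mul_le_mul_of_nonneg_right c2 (hS.reQuad_signalBlock_neg_one_nonneg v)
  simp only [hMatrix, Matrix.reQuad_add, Matrix.reQuad_sub, Matrix.reQuad_smul,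
    reQuad_fromBlocks_diag, Fintype.sum_sum_type]
  simp only [Function.comp_apply] at e1 e2
  linarith

theorem analyticAt_invResolvent (hS : S.Standing) (ha0 : 0 < a)
    (ha : ∀ N k, a ≤ (S.R_herm N).eigenvalues k) {w : ℝ} (hw : S.lamPlus < w) (i j : Fin r) :
    AnalyticAt ℝ (fun w => S.invResolvent w i j) w := by
  refine Matrix.analyticAt_inv_apply (fun k l => ?_)
    ((Matrix.isUnit_iff_isUnit_det _).1 (hS.posDef_smul_resolventStar ha0 ha hw).isUnit).ne_zero i j
  exact (Complex.ofRealCLM.analyticAt _).mul (hS.analyticAt_resolventStar ha hw k l)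

theorem analyticAt_hMatrix (hS : S.Standing) (ha0 : 0 < a)
    (ha : ∀ N k, a ≤ (S.R_herm N).eigenvalues k) {w p : ℝ → ℝ} {y : ℝ} (hw : AnalyticAt ℝ w y)
    (hp : AnalyticAt ℝ p y) (hwy : S.lamPlus < w y) (hp0 : 0 ≤ p y) (hp1 : p y < 1)
    (i j : Fin r ⊕ Fin r) : AnalyticAt ℝ (fun y => S.hMatrix y (w y) (p y) i j) y := by
  have h1 : AnalyticAt ℝ (fun y => ((1 / (2 * (1 + p y)) : ℝ) : ℂ)) y :=
    (Complex.ofRealCLM.analyticAt _).comp (analyticAt_const.div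
      (analyticAt_const.mul (analyticAt_const.add hp)) (by positivity))
  have h2 : AnalyticAt ℝ (fun y => ((1 / (2 * (1 - p y)) : ℝ) : ℂ)) y :=
    (Complex.ofRealCLM.analyticAt _).comp (analyticAt_const.div
      (analyticAt_const.mul (analyticAt_const.sub hp)) (by
        have : 0 < 1 - p y := by linarith
        positivity))
  have h3 : AnalyticAt ℝ (fun y => Matrix.fromBlocks (S.invResolvent (w y)) 0 0
      (S.invResolvent (w y)) i j) y := by
    have h : ∀ k l, AnalyticAt ℝ (fun y => S.invResolvent (w y) k l) y := fun k l =>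
      (hS.analyticAt_invResolvent ha0 ha hwy k l).comp hw
    rcases i with i | i <;> rcases j with j | j
    · exact h i j
    · exact analyticAt_const
    · exact analyticAt_const
    · exact h i j
  exact ((h1.mul analyticAt_const).sub (h2.mul analyticAt_const)).add
    ((Complex.ofRealCLM.analyticAt _).mul h3)

theorem tendsto_hMatrix (hS : S.Standing) (ha0 : 0 < a)
    (ha : ∀ N k, a ≤ (S.R_herm N).eigenvalues k) {l : Filter ℝ} {w p : ℝ → ℝ} {y₀ w₀ p₀ : ℝ}
    (hy : Tendsto id l (𝓝 y₀)) (hw : Tendsto w l (𝓝 w₀)) (hp : Tendsto p l (𝓝 p₀))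
    (hw0 : S.lamPlus < w₀) (hp0 : 0 ≤ p₀) (hp1 : p₀ < 1) :
    Tendsto (fun y => S.hMatrix y (w y) (p y)) l (𝓝 (S.hMatrix y₀ w₀ p₀)) := by
  have hc : ∀ {f : ℝ → ℝ} {q : ℝ}, Tendsto f l (𝓝 q) →
      Tendsto (fun y => (f y : ℂ)) l (𝓝 (q : ℂ)) := fun h =>
    (Complex.continuous_ofReal.tendsto _).comp h
  have h1 : Tendsto (fun y => 1 / (2 * (1 + p y))) l (𝓝 (1 / (2 * (1 + p₀)))) :=
    tendsto_const_nhds.div ((hp.const_add 1).const_mul 2) (by positivity)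
  have h2 : Tendsto (fun y => 1 / (2 * (1 - p y))) l (𝓝 (1 / (2 * (1 - p₀)))) :=
    tendsto_const_nhds.div ((hp.const_sub 1).const_mul 2) (by
      have : 0 < 1 - p₀ := by linarith
      positivity)
  have h3 : Tendsto (fun y => S.invResolvent (w y)) l (𝓝 (S.invResolvent w₀)) :=
    tendsto_pi_nhds.2 fun i => tendsto_pi_nhds.2 fun j =>
      ((hS.analyticAt_invResolvent ha0 ha hw0 i j).continuousAt.tendsto).comp hw
  have h4 : Tendsto (fun y => Matrix.fromBlocks (S.invResolvent (w y)) 0 0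
      (S.invResolvent (w y))) l
      (𝓝 (Matrix.fromBlocks (S.invResolvent w₀) 0 0 (S.invResolvent w₀))) := by
    have : Continuous fun Q : Matrix (Fin r) (Fin r) ℂ =>
        Matrix.fromBlocks Q (0 : Matrix (Fin r) (Fin r) ℂ) 0 Q :=
      Continuous.matrix_fromBlocks (by fun_prop) (by fun_prop) (by fun_prop) (by fun_prop)
    exact (this.tendsto _).comp h3
  exact (((hc h1).smul_const _).sub ((hc h2).smul_const _)).add ((hc hy).smul h4)

end Standing

end SpikedModel

/-! ### Closed forms of the limits and regularity of H_* -/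

namespace SpikedModel

variable {Ω : Type*} [MeasurableSpace Ω] {K P L r : ℕ}

/-- `w_*(x)`: the inverse of `edgePhi` to the right of its critical point `wp`. -/
def wStar (S : SpikedModel Ω K P L r) (wp x : ℝ) : ℝ := edgeInv S.cStar S.ωStar wp x

/-- `k_*(x) = edgeK (w_*(x))`. -/
def kStar (S : SpikedModel Ω K P L r) (wp x : ℝ) : ℝ := edgeK S.cStar S.ωStar (S.wStar wp x)

/-- `t_*` in closed form. -/
def tStar (S : SpikedModel Ω K P L r) (wp x : ℝ) : ℂ :=
  ((-(1 / (S.cStar * (S.wStar wp x + S.kStar wp x))) : ℝ) : ℂ)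

/-- `T_{β_*}` in closed form. -/
def TStar (S : SpikedModel Ω K P L r) (wp x : ℝ) : Matrix (Fin r) (Fin r) ℂ :=
  ((-(S.wStar wp x / x) : ℝ) : ℂ) • S.resolventStar (S.wStar wp x)

/-- `-c_* y t_*(y²)` in closed form. -/
def pStar (S : SpikedModel Ω K P L r) (wp y : ℝ) : ℝ :=
  y / (S.wStar wp (y ^ 2) + S.kStar wp (y ^ 2))

variable {S : SpikedModel Ω K P L r} {a wp : ℝ}

namespace Standing

theorem lamPlus_lt_wStar (hS : S.Standing) (ha0 : 0 < a)
    (ha : ∀ N k, a ≤ (S.R_herm N).eigenvalues k) (hb : S.lamPlus < wp) {x : ℝ}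
    (hx : edgePhi S.cStar S.ωStar wp ≤ x) : S.lamPlus < S.wStar wp x :=
  hb.trans_le ((hS.isSpectralLaw ha0 ha).edgeInv_spec hS.cStar_mem.1 hb hx).1

theorem wStar_pos (hS : S.Standing) (ha0 : 0 < a)
    (ha : ∀ N k, a ≤ (S.R_herm N).eigenvalues k) (hb : S.lamPlus < wp) {x : ℝ}
    (hx : edgePhi S.cStar S.ωStar wp ≤ x) : 0 < S.wStar wp x :=
  (hS.isSpectralLaw ha0 ha).b_pos.trans (hS.lamPlus_lt_wStar ha0 ha hb hx)

theorem kStar_pos (hS : S.Standing) (ha0 : 0 < a)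
    (ha : ∀ N k, a ≤ (S.R_herm N).eigenvalues k) (hb : S.lamPlus < wp) {x : ℝ}
    (hx : edgePhi S.cStar S.ωStar wp ≤ x) : 0 < S.kStar wp x :=
  (hS.isSpectralLaw ha0 ha).edgeK_pos hS.cStar_mem.1 (hS.lamPlus_lt_wStar ha0 ha hb hx)

theorem kStar_mul (hS : S.Standing) (ha0 : 0 < a)
    (ha : ∀ N k, a ≤ (S.R_herm N).eigenvalues k) (hb : S.lamPlus < wp) {x : ℝ}
    (hx : edgePhi S.cStar S.ωStar wp ≤ x) :
    S.kStar wp x * (S.wStar wp x + S.kStar wp x) = x :=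
  ((hS.isSpectralLaw ha0 ha).edgeInv_spec hS.cStar_mem.1 hb hx).2

theorem tendsto_wStar_edge (hS : S.Standing) (ha0 : 0 < a)
    (ha : ∀ N k, a ≤ (S.R_herm N).eigenvalues k) (hb : S.lamPlus < wp)
    (hwp : edgePhi' S.cStar S.ωStar wp = 0) :
    Tendsto (S.wStar wp) (𝓝[>] edgePhi S.cStar S.ωStar wp)
      (𝓝 (S.wStar wp (edgePhi S.cStar S.ωStar wp))) := by
  have h := hS.isSpectralLaw ha0 ha
  have h1 : S.wStar wp (edgePhi S.cStar S.ωStar wp) = wp :=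
    h.edgeInv_edge hS.cStar_mem.1 hb hwp
  rw [h1]
  exact h.tendsto_edgeInv_edge hS.cStar_mem.1 hb hwp

theorem tendsto_kStar_edge (hS : S.Standing) (ha0 : 0 < a)
    (ha : ∀ N k, a ≤ (S.R_herm N).eigenvalues k) (hb : S.lamPlus < wp)
    (hwp : edgePhi' S.cStar S.ωStar wp = 0) :
    Tendsto (S.kStar wp) (𝓝[>] edgePhi S.cStar S.ωStar wp)
      (𝓝 (S.kStar wp (edgePhi S.cStar S.ωStar wp))) :=
  ((hS.isSpectralLaw ha0 ha).analyticAt_edgeK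
    (hS.lamPlus_lt_wStar ha0 ha hb le_rfl)).continuousAt.tendsto.comp
    (hS.tendsto_wStar_edge ha0 ha hb hwp)

/-- For x beyond the limit edge, x is eventually beyond the edge at N, so the finite-N closed forms
apply and pass to the limit term by term. -/
theorem isLimit (hS : S.Standing) (ha0 : 0 < a)
    (ha : ∀ N k, a ≤ (S.R_herm N).eigenvalues k) (hb : S.lamPlus < wp)
    (hwp : edgePhi' S.cStar S.ωStar wp = 0) :
    S.IsLimit (edgePhi S.cStar S.ωStar wp) (S.tStar wp) (S.TStar wp) := by
  classical
  have hc := hS.cStar_mem.1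
  have hlaw := hS.isSpectralLaw ha0 ha
  obtain ⟨wpN, hN⟩ : ∃ wpN : ℕ → ℝ, ∀ᶠ N in atTop,
      HasEdge (S.R_herm N) a (⨆ k, S.lam N k) (S.c N) (wpN N) := by
    -- The default 0 matters only for the finitely many N without an edge parameter.
    refine ⟨fun N => if h : ∃ w, HasEdge (S.R_herm N) a (⨆ k, S.lam N k) (S.c N) w
      then h.choose else 0, ?_⟩
    filter_upwards [hS.eventually_exists_hasEdge ha0 ha] with N h
    rw [dif_pos h]
    exact h.choose_spec
  have hedge := hS.tendsto_edge ha0 ha hb hwp hN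
  have hofReal : ∀ {l : Filter ℝ} {f : ℝ → ℝ} {q : ℝ}, Tendsto f l (𝓝 q) →
      Tendsto (fun y => (f y : ℂ)) l (𝓝 (q : ℂ)) := fun h =>
    (Complex.continuous_ofReal.tendsto _).comp h
  have hpos : ∀ {x}, edgePhi S.cStar S.ωStar wp ≤ x →
      S.cStar * (S.wStar wp x + S.kStar wp x) ≠ 0 := fun hx =>
    (mul_pos hc (add_pos (hS.wStar_pos ha0 ha hb hx) (hS.kStar_pos ha0 ha hb hx))).ne'
  refine ⟨?_, ?_, ?_, ?_, ?_⟩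
  · exact hedge.congr' (hN.mono fun N h => h.xPlus_eq.symm)
  · intro x hx
    have hw := hS.tendsto_edgeInv ha0 ha hb hwp hN hx
    have hk := hS.tendsto_edgeK_apply ha0 ha (hS.lamPlus_lt_wStar ha0 ha hb hx.le) hw
    have hlim := ((tendsto_const_nhds (x := (1 : ℝ))).div (hS.regime.mul (hw.add hk))
      (hpos hx.le)).neg
    refine ((Complex.continuous_ofReal.tendsto _).comp hlim).congr' ?_
    filter_upwards [hN, hedge.eventually (eventually_lt_nhds hx)] with N h h2
    rw [h.tReal_eq h2]
    simp
  · intro x hx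
    have hw := hS.tendsto_edgeInv ha0 ha hb hwp hN hx
    have hT := hS.tendsto_compressedIntegral ha0 ha (hS.lamPlus_lt_wStar ha0 ha hb hx.le) hw
    have hq := (Complex.continuous_ofReal.tendsto _).comp (hw.div_const x).neg
    refine (hq.smul hT).congr' ?_
    filter_upwards [hN, hedge.eventually (eventually_lt_nhds hx)] with N h h2
    rw [h.TBeta_eq (S.Θ N) h2]
    simp
  · exact hofReal (tendsto_const_nhds.div (((hS.tendsto_wStar_edge ha0 ha hb hwp).add
      (hS.tendsto_kStar_edge ha0 ha hb hwp)).const_mul S.cStar) (hpos le_rfl)).neg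
  · have hw := hS.tendsto_wStar_edge ha0 ha hb hwp
    have hx := (hlaw.edgePhi_pos hc hb).ne'
    refine Tendsto.smul (hofReal (hw.div (tendsto_id.mono_left nhdsWithin_le_nhds) hx).neg) ?_
    exact tendsto_pi_nhds.2 fun i => tendsto_pi_nhds.2 fun j =>
      (hS.analyticAt_resolventStar ha (hS.lamPlus_lt_wStar ha0 ha hb le_rfl)
        i j).continuousAt.tendsto.comp hw

/-- The points `y ≥ √x_{+,*}` satisfy `y² ≥ x_{+,*}`. -/
theorem edgePhi_le_sq (hS : S.Standing) (ha0 : 0 < a)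
    (ha : ∀ N k, a ≤ (S.R_herm N).eigenvalues k) (hb : S.lamPlus < wp) {y : ℝ}
    (hy : √(edgePhi S.cStar S.ωStar wp) ≤ y) :
    0 < y ∧ edgePhi S.cStar S.ωStar wp ≤ y ^ 2 := by
  have h := (hS.isSpectralLaw ha0 ha).edgePhi_pos hS.cStar_mem.1 hb
  exact ⟨(Real.sqrt_pos.2 h).trans_le hy, Real.sqrt_le_left ((Real.sqrt_nonneg _).trans hy) |>.1 hy⟩

theorem pStar_pos (hS : S.Standing) (ha0 : 0 < a)
    (ha : ∀ N k, a ≤ (S.R_herm N).eigenvalues k) (hb : S.lamPlus < wp) {y : ℝ}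
    (hy : √(edgePhi S.cStar S.ωStar wp) ≤ y) : 0 < S.pStar wp y := by
  obtain ⟨hy0, hx⟩ := hS.edgePhi_le_sq ha0 ha hb hy
  exact div_pos hy0 (add_pos (hS.wStar_pos ha0 ha hb hx) (hS.kStar_pos ha0 ha hb hx))

/-- Since y² = k(w + k), the factor y disappears from p²; both p < 1 and the monotonicity of p are
read off this form. -/
theorem pStar_sq (hS : S.Standing) (ha0 : 0 < a)
    (ha : ∀ N k, a ≤ (S.R_herm N).eigenvalues k) (hb : S.lamPlus < wp) {y : ℝ}
    (hy : √(edgePhi S.cStar S.ωStar wp) ≤ y) : S.pStar wp y ^ 2 =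
      S.kStar wp (y ^ 2) / (S.wStar wp (y ^ 2) + S.kStar wp (y ^ 2)) := by
  obtain ⟨hy0, hx⟩ := hS.edgePhi_le_sq ha0 ha hb hy
  have h1 := hS.wStar_pos ha0 ha hb hx
  have h2 := hS.kStar_pos ha0 ha hb hx
  have h3 := hS.kStar_mul ha0 ha hb hx
  rw [pStar, div_pow, div_eq_div_iff (by positivity) (by positivity)]
  linear_combination (-(S.wStar wp (y ^ 2) + S.kStar wp (y ^ 2))) * h3

theorem pStar_lt_one (hS : S.Standing) (ha0 : 0 < a)
    (ha : ∀ N k, a ≤ (S.R_herm N).eigenvalues k) (hb : S.lamPlus < wp) {y : ℝ}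
    (hy : √(edgePhi S.cStar S.ωStar wp) ≤ y) : S.pStar wp y < 1 := by
  obtain ⟨hy0, hx⟩ := hS.edgePhi_le_sq ha0 ha hb hy
  have h1 := hS.wStar_pos ha0 ha hb hx
  have h2 := hS.kStar_pos ha0 ha hb hx
  refine (sq_lt_one_iff₀ (hS.pStar_pos ha0 ha hb hy).le).1 ?_
  rw [hS.pStar_sq ha0 ha hb hy, div_lt_one (by positivity)]
  linarith

theorem wStar_mono (hS : S.Standing) (ha0 : 0 < a)
    (ha : ∀ N k, a ≤ (S.R_herm N).eigenvalues k) (hb : S.lamPlus < wp)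
    (hwp : edgePhi' S.cStar S.ωStar wp = 0) {x₁ x₂ : ℝ}
    (hx : edgePhi S.cStar S.ωStar wp ≤ x₁) (h12 : x₁ ≤ x₂) : S.wStar wp x₁ ≤ S.wStar wp x₂ :=
  ((hS.isSpectralLaw ha0 ha).edgeInv_strictMonoOn hS.cStar_mem.1 hb hwp).monotoneOn hx
    (mem_Ici.2 (hx.trans h12)) h12

/-- As y grows, w grows and k does not, so k/(w + k) cannot increase. -/
theorem pStar_antitone (hS : S.Standing) (ha0 : 0 < a)
    (ha : ∀ N k, a ≤ (S.R_herm N).eigenvalues k) (hb : S.lamPlus < wp)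
    (hwp : edgePhi' S.cStar S.ωStar wp = 0) {y₁ y₂ : ℝ}
    (hy : √(edgePhi S.cStar S.ωStar wp) ≤ y₁) (h12 : y₁ ≤ y₂) :
    S.pStar wp y₂ ≤ S.pStar wp y₁ := by
  obtain ⟨hy0, hx⟩ := hS.edgePhi_le_sq ha0 ha hb hy
  have hsq : y₁ ^ 2 ≤ y₂ ^ 2 := by gcongr
  have hw := hS.wStar_mono ha0 ha hb hwp hx hsq
  have hk : S.kStar wp (y₂ ^ 2) ≤ S.kStar wp (y₁ ^ 2) :=
    (hS.isSpectralLaw ha0 ha).edgeK_antitone hS.cStar_mem.1 (hS.lamPlus_lt_wStar ha0 ha hb hx) hw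
  have h1 := hS.wStar_pos ha0 ha hb hx
  have h2 := hS.kStar_pos ha0 ha hb hx
  have h3 := hS.wStar_pos ha0 ha hb (hx.trans hsq)
  have h4 := hS.kStar_pos ha0 ha hb (hx.trans hsq)
  refine (sq_le_sq₀ (hS.pStar_pos ha0 ha hb (hy.trans h12)).le (hS.pStar_pos ha0 ha hb hy).le).1 ?_
  rw [hS.pStar_sq ha0 ha hb hy, hS.pStar_sq ha0 ha hb (hy.trans h12),
    div_le_div_iff₀ (by positivity) (by positivity)]
  have := mul_le_mul hk hw h1.le h2.le
  linarith

theorem HStar_eq (hS : S.Standing) (ha0 : 0 < a)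
    (ha : ∀ N k, a ≤ (S.R_herm N).eigenvalues k) (hb : S.lamPlus < wp) {y : ℝ}
    (hy : √(edgePhi S.cStar S.ωStar wp) ≤ y) : S.HStar (S.tStar wp) (S.TStar wp) y =
      S.hMatrix y (S.wStar wp (y ^ 2)) (S.pStar wp y) := by
  obtain ⟨hy0, hx⟩ := hS.edgePhi_le_sq ha0 ha hb hy
  have h1 := hS.wStar_pos ha0 ha hb hx
  have h2 := hS.kStar_pos ha0 ha hb hx
  have hc := hS.cStar_mem.1
  refine HStar_eq_hMatrix hy0 (hS.pStar_pos ha0 ha hb hy).le (hS.pStar_lt_one ha0 ha hb hy) ?_ ?_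
    ((Matrix.isUnit_iff_isUnit_det _).1 (hS.posDef_smul_resolventStar ha0 ha
      (hS.lamPlus_lt_wStar ha0 ha hb hx)).isUnit)
  · have : S.cStar * (y * -(1 / (S.cStar * (S.wStar wp (y ^ 2) + S.kStar wp (y ^ 2))))) =
        -S.pStar wp y := by
      rw [pStar]
      field_simp
    rw [tStar]
    exact_mod_cast this
  · rw [TStar, smul_smul, smul_smul]
    congr 1
    have : y * -(S.wStar wp (y ^ 2) / y ^ 2) = -(1 / y) * S.wStar wp (y ^ 2) := by field_simp
    exact_mod_cast this

theorem analyticAt_HStar (hS : S.Standing) (ha0 : 0 < a)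
    (ha : ∀ N k, a ≤ (S.R_herm N).eigenvalues k) (hb : S.lamPlus < wp)
    (hwp : edgePhi' S.cStar S.ωStar wp = 0) {y : ℝ}
    (hy : √(edgePhi S.cStar S.ωStar wp) < y) (i j : Fin r ⊕ Fin r) :
    AnalyticAt ℝ (fun y => S.HStar (S.tStar wp) (S.TStar wp) y i j) y := by
  obtain ⟨hy0, hx⟩ := hS.edgePhi_le_sq ha0 ha hb hy.le
  have hlaw := hS.isSpectralLaw ha0 ha
  have hx' : edgePhi S.cStar S.ωStar wp < y ^ 2 := (Real.sqrt_lt' hy0).1 hy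
  have hl := hS.lamPlus_lt_wStar ha0 ha hb hx
  have hsq : AnalyticAt ℝ (fun y : ℝ => y ^ 2) y := analyticAt_id.pow 2
  have hw : AnalyticAt ℝ (fun y => S.wStar wp (y ^ 2)) y :=
    (hlaw.analyticAt_edgeInv hS.cStar_mem.1 hb hwp hx').comp (f := fun y : ℝ => y ^ 2) hsq
  have hk : AnalyticAt ℝ (fun y => S.kStar wp (y ^ 2)) y :=
    (hlaw.analyticAt_edgeK hl).comp (f := fun y => S.wStar wp (y ^ 2)) hw
  have hp : AnalyticAt ℝ (S.pStar wp) y := analyticAt_id.div (hw.add hk)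
    (add_pos (hS.wStar_pos ha0 ha hb hx) (hS.kStar_pos ha0 ha hb hx)).ne'
  refine (hS.analyticAt_hMatrix ha0 ha hw hp hl (hS.pStar_pos ha0 ha hb hy.le).le
    (hS.pStar_lt_one ha0 ha hb hy.le) i j).congr ?_
  filter_upwards [eventually_gt_nhds hy] with z hz
  rw [hS.HStar_eq ha0 ha hb hz.le]

theorem tendsto_HStar (hS : S.Standing) (ha0 : 0 < a)
    (ha : ∀ N k, a ≤ (S.R_herm N).eigenvalues k) (hb : S.lamPlus < wp)
    (hwp : edgePhi' S.cStar S.ωStar wp = 0) :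
    Tendsto (S.HStar (S.tStar wp) (S.TStar wp)) (𝓝[>] √(edgePhi S.cStar S.ωStar wp))
      (𝓝 (S.HStar (S.tStar wp) (S.TStar wp) √(edgePhi S.cStar S.ωStar wp))) := by
  have h0 := (hS.isSpectralLaw ha0 ha).edgePhi_pos hS.cStar_mem.1 hb
  set x₀ := edgePhi S.cStar S.ωStar wp
  have hid : Tendsto id (𝓝[>] √x₀) (𝓝 √x₀) := tendsto_id.mono_left nhdsWithin_le_nhds
  -- The squared variable must stay to the right of the edge, since w is known to converge only from
  -- that side.
  have hsq : Tendsto (fun y : ℝ => y ^ 2) (𝓝[>] √x₀) (𝓝[>] x₀) := by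
    refine tendsto_nhdsWithin_iff.2 ⟨?_, ?_⟩
    · simpa [Real.sq_sqrt h0.le] using hid.pow 2
    · filter_upwards [self_mem_nhdsWithin] with y hy
      exact (Real.sqrt_lt' ((Real.sqrt_nonneg _).trans_lt hy)).1 hy
  have hw := (hS.tendsto_wStar_edge ha0 ha hb hwp).comp hsq
  have hk := (hS.tendsto_kStar_edge ha0 ha hb hwp).comp hsq
  have e : √x₀ ^ 2 = x₀ := Real.sq_sqrt h0.le
  have hl := hS.lamPlus_lt_wStar ha0 ha hb (le_refl x₀)
  have hp : Tendsto (S.pStar wp) (𝓝[>] √x₀) (𝓝 (S.pStar wp √x₀)) := by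
    have h := hid.div (hw.add hk) (add_pos (hS.wStar_pos ha0 ha hb (le_refl x₀))
      (hS.kStar_pos ha0 ha hb (le_refl x₀))).ne'
    rw [pStar, e]
    exact h
  rw [hS.HStar_eq ha0 ha hb le_rfl, e]
  refine (hS.tendsto_hMatrix ha0 ha hid hw hp hl (hS.pStar_pos ha0 ha hb le_rfl).le
    (hS.pStar_lt_one ha0 ha hb le_rfl)).congr' ?_
  filter_upwards [self_mem_nhdsWithin] with y hy
  rw [hS.HStar_eq ha0 ha hb (le_of_lt hy)]
  rfl

end Standing

end SpikedModel

end

theorem mainTheorem9 {Ω : Type*} [MeasurableSpace Ω] {K P L r : ℕ}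
    (S : SpikedModel Ω K P L r) (hS : S.Standing) :
    ∃ (xp : ℝ) (t : ℝ → ℂ) (T : ℝ → Matrix (Fin r) (Fin r) ℂ),
      0 < xp ∧ S.IsLimit xp t T ∧
      Tendsto (S.HStar t T) (𝓝[>] √xp) (𝓝 (S.HStar t T √xp)) ∧
      AnalyticOnNhd ℝ (fun y => (S.HStar t T y).det) (Ioi √xp) ∧
      ∃ hH : ∀ y, √xp ≤ y → (S.HStar t T y).IsHermitian,
        (∀ (k : Fin (Fintype.card (Fin r ⊕ Fin r))) (y₁ y₂ : ℝ) (h₁ : √xp ≤ y₁) (h₂ : y₁ < y₂),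
          (hH y₁ h₁).eigenvalues₀ k < (hH y₂ (h₁.trans h₂.le)).eigenvalues₀ k) ∧
        ∃ hfin : {y : ℝ | √xp < y ∧ (S.HStar t T y).det = 0}.Finite,
          ∃ s : ℕ,
            ∑ y ∈ hfin.toFinset, analyticOrderAt (fun y => (S.HStar t T y).det) y = (s : ℕ∞) ∧
            s ≤ 2 * r ∧
            s = {k | (hH √xp le_rfl).eigenvalues₀ k < 0}.ncard := by
  obtain ⟨a, ha0, ha⟩ := hS.exists_le_eigenvalues
  have hlaw := hS.isSpectralLaw ha0 ha
  have hc := hS.cStar_mem.1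
  obtain ⟨wp, hb, hwp⟩ := hlaw.exists_edge hc (hS.exists_lt_edgeK ha0 ha)
  have hlim := hS.tendsto_HStar ha0 ha hb hwp
  have han := fun (y : ℝ) (hy : √(edgePhi S.cStar S.ωStar wp) < y) (i j : Fin r ⊕ Fin r) =>
    hS.analyticAt_HStar ha0 ha hb hwp hy i j
  have hH : ∀ y, √(edgePhi S.cStar S.ωStar wp) ≤ y →
      (S.HStar (S.tStar wp) (S.TStar wp) y).IsHermitian := fun y hy => by
    rw [hS.HStar_eq ha0 ha hb hy]
    exact hS.hMatrix_isHermitian ha0 ha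
      (hS.lamPlus_lt_wStar ha0 ha hb (hS.edgePhi_le_sq ha0 ha hb hy).2)
  -- The growth rate of H_*: the lower bound on W at the critical point, strictly positive because
  -- wp lies beyond the spectrum.
  have hκ : 0 < 1 - S.lamPlus / wp :=
    sub_pos.2 ((div_lt_one (hlaw.b_pos.trans hb)).2 hb)
  obtain ⟨hmono, hfin, s, hs1, hs2, hs3⟩ := Matrix.zeros_det_of_increasing hκ hH
    (fun y₁ y₂ h1 h12 v => by
      obtain ⟨hy0, hx⟩ := hS.edgePhi_le_sq ha0 ha hb h1
      have hsq : y₁ ^ 2 ≤ y₂ ^ 2 := by gcongr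
      rw [hS.HStar_eq ha0 ha hb h1, hS.HStar_eq ha0 ha hb (h1.trans h12.le)]
      exact hS.hMatrix_increasing ha0 ha hy0.le h12.le hb
        (hlaw.edgeInv_spec hc hb hx).1 (hS.wStar_mono ha0 ha hb hwp hx hsq)
        (hS.pStar_pos ha0 ha hb (h1.trans h12.le)).le
        (hS.pStar_antitone ha0 ha hb hwp h1 h12.le) (hS.pStar_lt_one ha0 ha hb h1) v)
    hlim han
  refine ⟨edgePhi S.cStar S.ωStar wp, S.tStar wp, S.TStar wp, hlaw.edgePhi_pos hc hb,
    hS.isLimit ha0 ha hb hwp, hlim, fun y hy => Matrix.analyticAt_det (han y hy), hH, hmono, hfin,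
    s, hs1, hs2.trans (by simp [two_mul]), hs3⟩
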